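/- **Setting.** States are $\mathcal S=\mathbb R^{d_s}$, $\mathcal A$ is a measurable action space, $\phi:\mathcal S\times\mathcal A\to\mathbb R^d$ is a measurable feature map with $\|\phi(s,a)\|_2\le 1$, $r:\mathcal S\times\mathcal A\to[0,1]$ is a measurable reward, $H$ is the horizon and $s_0$ the initial state. For a matrix $W\in\mathbb R^{d_s\times d}$ let $P_W(\cdot|s,a)=\mathcal N(W\phi(s,a),\sigma^2 I)$. The true dynamics is $P^\star=P_{W^\star}$ with spectral norm $\|W^\star\|_2\le F$ (kernelized nonlinear regulator, KNR). Policies are Markov kernels $\pi:\mathcal S\to\Delta(\mathcal A)$, $\Pi$ is a class of policies, $J(\pi;r,P)$ is the expected sum of the $H$ rewards collected by $\pi$ from $s_0$ under $P$, and $d^\pi$ is the average over $h=0,\dots,H-1$ of the laws of $(s_h,a_h)$ under $\pi$ and $P^\star$. **Algorithm PC-MLP** (inputs $N,M,K,c,F$, step size $\eta$, regularization $\lambda=1$). Start with an arbitrary policy $\pi_1$. In round $n=1,\dots,N$: draw $K$ i.i.d. pairs from $d^{\pi_n}$ and let $\widehat\Sigma_{\pi_n}$ be the empirical mean of $\phi\phi^\top$;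 put $\widehat\Sigma_n=\lambda I+\sum_{i\le n}\widehat\Sigma_{\pi_i}$ and $$\widehat b_n(s,a)=2\min\Big\{c\sqrt{\tfrac12\phi(s,a)^\top\widehat\Sigma_n^{-1}\phi(s,a)},\,H\Big\};$$ draw $M$ i.i.d. triples with $(s,a)\sim\frac1n\sum_{i\le n}d^{\pi_i}$, $s'\sim P^\star(\cdot|s,a)$, and let $\widehat W_n$ be the average of the iterates $W^0,\dots,W^{M-1}$ of projected SGD on these triples: $W^0=0$, $W^{i+1}=\mathrm{Proj}_{\{\|W\|_2\le F\}}\big(W^i-\eta(W^i\phi(s_i,a_i)-s_i')\phi(s_i,a_i)^\top\big)$, the projection being in Frobenius norm; if $n<N$, let $\pi_{n+1}\in\operatorname{argmax}_{\pi\in\Pi}J(\pi;r+\widehat b_n,P_{\widehat W_n})$. Return a policy $\widehat\pi$ that is best for $J(\cdot;r,P^\star)$ among $\pi_1,\dots,\pi_N$. **Theorem (Sample complexity for KNRs).** There is a universal constant $C\ge1$ with the following property. Let $\delta\in(0,\tfrac12)$, $\epsilon\in(0,1)$, $\sigma>0$, $F\ge1$, let $H,d,d_s$ be natural numbers, and assume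 that $$X:=\frac{H^6F^2d_sd}{\sigma^2\epsilon^2}\ \ge\ 2 .$$ Then there are hyper-parameters depending only on $(H,d,d_s,F,\sigma,\epsilon,\delta)$, with $\eta>0$, $\lambda=1$ and $$N=\Theta(X\ln X),\quad M=\Theta\big(N^2(F^2+FB)^2\ln^2(N/\delta)\big),\quad c=\Theta\Big(\frac H\sigma\sqrt{F^2d_s}\Big),\quad K=\big\lceil 32N^2\ln(8Nd/\delta)\big\rceil,$$ where $B=F+\sigma\sqrt{d_s\ln(2d_sNM/\delta)}$ and $f=\Theta(g)$ means $C^{-1}g\le f\le Cg$, such that in every environment as above (every $\mathcal A,\phi,W^\star,r,s_0,\Pi$) and for every run of PC-MLP, with probability at least $1-2\delta$, $$J(\widehat\pi;r,P^\star)\ \ge\ \max_{\pi\in\Pi}J(\pi;r,P^\star)-\epsilon ,$$ and, on the same event, $N\ge2$ and the uniform mixture of the planned policies $\pi_2,\dots,\pi_N$, whose value is $\frac1{N-1}\sum_{n=2}^NJ(\pi_n;r,P^\star)$, is also $\epsilon$-optimal in this sense. The number of samples satisfies $$N(K+M)\ \le\ C\,\frac{H^{18}d^3d_s^3}{\sigma^6\epsilon^6}\big(F^{10}+\sigma^2F^8d_s\big)\,\nu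 ,$$ where $\nu$ contains only logarithms: $$\nu=\ln^3X\cdot\Big[\ln^2\tfrac N\delta\Big(\ln\tfrac{2d_sN}\delta+\ln Y\Big)+\ln\tfrac{Nd}\delta\Big],\qquad Y=\Big(8F^4+9\sigma^2F^2d_s\ln\tfrac{2d_sN}\delta\Big)\ln^2\!\tfrac N\delta\,N^2+18\sigma^2F^2d_s .$$ Ignoring logarithms, the sample complexity is $\widetilde O\Big(\frac{H^{18}d^3d_s^3}{\sigma^6\epsilon^6}\big(F^{10}+\sigma^2F^8d_s\big)\Big)$. -/

import Mathlib

open MeasureTheory ProbabilityTheory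
open scoped ENNReal Matrix MatrixOrder

namespace KNR

/-! ### Matrices: spectral norm, Frobenius distance, projection -/

/-- The spectral norm `‖W‖₂` (operator norm between Euclidean spaces). -/
noncomputable def specNorm {m n : ℕ} (W : Matrix (Fin m) (Fin n) ℝ) : ℝ :=
  ‖(Matrix.toEuclideanLin W).toContinuousLinearMap‖

/-- The squared Frobenius norm. -/
def frobSq {m n : ℕ} (W : Matrix (Fin m) (Fin n) ℝ) : ℝ :=
  ∑ i, ∑ j, W i j ^ 2

/-- `U` is a point of the spectral-norm ball of radius `F` closest to `V` (in Frobenius norm). -/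
def IsBallProj {m n : ℕ} (F : ℝ) (V U : Matrix (Fin m) (Fin n) ℝ) : Prop :=
  specNorm U ≤ F ∧ ∀ U' : Matrix (Fin m) (Fin n) ℝ, specNorm U' ≤ F →
    frobSq (V - U) ≤ frobSq (V - U')

/-- The projection onto the spectral-norm ball `{W : ‖W‖₂ ≤ F}` (for `0 ≤ F`). -/
noncomputable def ballProj {m n : ℕ} (F : ℝ) (V : Matrix (Fin m) (Fin n) ℝ) :
    Matrix (Fin m) (Fin n) ℝ :=
  Classical.epsilon (IsBallProj F V)

theorem continuous_specNorm {m n : ℕ} :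
    Continuous (specNorm : Matrix (Fin m) (Fin n) ℝ → ℝ) := by
  let L : Matrix (Fin m) (Fin n) ℝ →ₗ[ℝ]
      (EuclideanSpace ℝ (Fin n) →L[ℝ] EuclideanSpace ℝ (Fin m)) :=
    (LinearMap.toContinuousLinearMap :
      (EuclideanSpace ℝ (Fin n) →ₗ[ℝ] EuclideanSpace ℝ (Fin m)) ≃ₗ[ℝ] _).toLinearMap ∘ₗ
      (Matrix.toEuclideanLin :
        Matrix (Fin m) (Fin n) ℝ ≃ₗ[ℝ] _).toLinearMap
  have hL : Continuous L := L.continuous_of_finiteDimensional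
  exact hL.norm

theorem abs_entry_le_specNorm {m n : ℕ} (W : Matrix (Fin m) (Fin n) ℝ) (i : Fin m) (j : Fin n) :
    |W i j| ≤ specNorm W := by
  have h1 := (Matrix.toEuclideanLin W).toContinuousLinearMap.le_opNorm
    (EuclideanSpace.single j (1 : ℝ))
  have h2 := PiLp.norm_apply_le
    ((Matrix.toEuclideanLin W).toContinuousLinearMap (EuclideanSpace.single j (1 : ℝ))) i
  have h3 : ((Matrix.toEuclideanLin W).toContinuousLinearMap
      (EuclideanSpace.single j (1 : ℝ))) i = W i j := by
    simp [Matrix.toLpLin_apply]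
  rw [h3] at h2
  simp only [PiLp.norm_single, norm_one, mul_one, Real.norm_eq_abs] at h1 h2
  exact h2.trans h1

/-- The projection exists. -/
theorem isBallProj_ballProj {m n : ℕ} {F : ℝ} (hF : 0 ≤ F) (V : Matrix (Fin m) (Fin n) ℝ) :
    IsBallProj F V (ballProj F V) := by
  apply Classical.epsilon_spec (p := IsBallProj F V)
  have hcl : IsClosed {U : Matrix (Fin m) (Fin n) ℝ | specNorm U ≤ F} :=
    isClosed_le continuous_specNorm continuous_const
  have hK : IsCompact {U : Matrix (Fin m) (Fin n) ℝ | ∀ i j, U i j ∈ Set.Icc (-F) F} := by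
    have : {U : Matrix (Fin m) (Fin n) ℝ | ∀ i j, U i j ∈ Set.Icc (-F) F}
        = Set.pi Set.univ (fun _ => Set.pi Set.univ (fun _ => Set.Icc (-F) F)) := by
      ext U
      exact ⟨fun h i _ j _ => h i j, fun h i j => h i trivial j trivial⟩
    rw [this]
    exact isCompact_univ_pi fun _ => isCompact_univ_pi fun _ => isCompact_Icc
  have hcomp : IsCompact {U : Matrix (Fin m) (Fin n) ℝ | specNorm U ≤ F} := by
    refine hK.of_isClosed_subset hcl ?_
    intro U hU i j
    exact abs_le.mp ((abs_entry_le_specNorm U i j).trans hU)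
  have hne : {U : Matrix (Fin m) (Fin n) ℝ | specNorm U ≤ F}.Nonempty := by
    refine ⟨0, ?_⟩
    simpa [specNorm] using hF
  have hcont : ContinuousOn (fun U : Matrix (Fin m) (Fin n) ℝ => frobSq (V - U))
      {U | specNorm U ≤ F} := by
    apply Continuous.continuousOn
    unfold frobSq
    refine continuous_finsetSum _ fun i _ => continuous_finsetSum _ fun j _ => ?_
    exact (continuous_const.sub (continuous_apply_apply i j)).pow 2
  obtain ⟨U, hU, hmin⟩ := hcomp.exists_isMinOn hne hcont
  exact ⟨U, hU, fun U' hU' => hmin hU'⟩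

/-! ### Dynamics, policies, occupancy distributions, values -/

/-- The state space `ℝ^{d_s}`. -/
abbrev State (ds : ℕ) := EuclideanSpace ℝ (Fin ds)

/-- The feature space `ℝ^d`. -/
abbrev Feat (d : ℕ) := EuclideanSpace ℝ (Fin d)

/-- A (stochastic, stationary) policy: a Markov kernel from states to actions. -/
structure Policy (ds : ℕ) (A : Type*) [MeasurableSpace A] where
  toKernel : Kernel (State ds) A
  isMarkov : IsMarkovKernel toKernel

attribute [instance] Policy.isMarkov

theorem measurable_gaussian {X : Type*} [MeasurableSpace X] {ds : ℕ}
    (S : Matrix (Fin ds) (Fin ds) ℝ) {f : X → State ds} (hf : Measurable f) :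
    Measurable fun x => multivariateGaussian (f x) S := by
  have h1 : Measurable fun p : State ds × State ds =>
      p.1 + Matrix.toEuclideanCLM (𝕜 := ℝ) (CFC.sqrt S) p.2 := by fun_prop
  have h2 : (fun x => multivariateGaussian (f x) S)
      = fun x => ((stdGaussian (State ds)).map (Prod.mk (f x))).map
          (fun p : State ds × State ds =>
            p.1 + Matrix.toEuclideanCLM (𝕜 := ℝ) (CFC.sqrt S) p.2) := by
    funext x
    rw [Measure.map_map h1 measurable_prodMk_left]
    rfl
  rw [h2]
  exact (Measure.measurable_map _ h1).comp (Measurable.map_prodMk_left.comp hf)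

section MDP

variable {ds d : ℕ} {A : Type*} [MeasurableSpace A]

/-- The kernelized nonlinear regulator dynamics
`P_W(· | s, a) = N(W φ(s, a), σ² I)`. -/
noncomputable def dynamics (φ : State ds × A → Feat d) (hφ : Measurable φ) (σ : ℝ)
    (W : Matrix (Fin ds) (Fin d) ℝ) : Kernel (State ds × A) (State ds) where
  toFun x := multivariateGaussian (Matrix.toEuclideanLin W (φ x)) (σ ^ 2 • 1)
  measurable' := measurable_gaussian _
    ((Matrix.toEuclideanLin W).continuous_of_finiteDimensional.measurable.comp hφ)

instance (φ : State ds × A → Feat d) (hφ : Measurable φ) (σ : ℝ)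
    (W : Matrix (Fin ds) (Fin d) ℝ) : IsMarkovKernel (dynamics φ hφ σ W) :=
  ⟨fun x => inferInstanceAs
    (IsProbabilityMeasure (multivariateGaussian (Matrix.toEuclideanLin W (φ x)) (σ ^ 2 • 1)))⟩

/-- The law of the state `s_h` when `π` is run from `s₀` in the dynamics `P`. -/
noncomputable def stateDist (P : Kernel (State ds × A) (State ds)) (s₀ : State ds)
    (π : Policy ds A) : ℕ → Measure (State ds)
  | 0 => Measure.dirac s₀
  | h + 1 => P ∘ₘ (stateDist P s₀ π h ⊗ₘ π.toKernel)

/-- `d_h^π`: the law of `(s_h, a_h)` when `π` is run from `s₀` in the dynamics `P`. -/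
noncomputable def stepDist (P : Kernel (State ds × A) (State ds)) (s₀ : State ds)
    (π : Policy ds A) (h : ℕ) : Measure (State ds × A) :=
  stateDist P s₀ π h ⊗ₘ π.toKernel

/-- `d^π = (1/H) ∑_{h < H} d_h^π`. -/
noncomputable def avgDist (H : ℕ) (P : Kernel (State ds × A) (State ds)) (s₀ : State ds)
    (π : Policy ds A) : Measure (State ds × A) :=
  (H : ℝ≥0∞)⁻¹ • ∑ h ∈ Finset.range H, stepDist P s₀ π h

/-- The state-action distribution of the uniform mixture of the policies `π 0, …, π n`
(a policy is drawn uniformly and then followed). -/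
noncomputable def coverDist (H : ℕ) (P : Kernel (State ds × A) (State ds)) (s₀ : State ds)
    (π : ℕ → Policy ds A) (n : ℕ) : Measure (State ds × A) :=
  ((n + 1 : ℕ) : ℝ≥0∞)⁻¹ • ∑ i ∈ Finset.range (n + 1), avgDist H P s₀ (π i)

/-- `J(π; r, P)`: the expected total reward of `π` over `H` steps from `s₀`. -/
noncomputable def value (H : ℕ) (P : Kernel (State ds × A) (State ds)) (s₀ : State ds)
    (r : State ds × A → ℝ) (π : Policy ds A) : ℝ :=
  ∑ h ∈ Finset.range H, ∫ x, r x ∂(stepDist P s₀ π h)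

/-! ### The ingredients of PC-MLP -/

/-- The empirical regularized covariance
`Σ̂_n = λ I + ∑_{i ≤ n} (1/K) ∑_{k < K} φ(x i k) φ(x i k)ᵀ`
(rounds are numbered from `0`). -/
noncomputable def empCov (φ : State ds × A → Feat d) (lam : ℝ) (K : ℕ)
    (x : ℕ → ℕ → State ds × A) (n : ℕ) : Matrix (Fin d) (Fin d) ℝ :=
  lam • 1 + ∑ i ∈ Finset.range (n + 1), (K : ℝ)⁻¹ •
    ∑ k ∈ Finset.range K, Matrix.vecMulVec (φ (x i k)).ofLp (φ (x i k)).ofLp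

/-- The reward bonus `b̂(s, a) = 2 min {c √(½ φ(s, a)ᵀ Σ̂⁻¹ φ(s, a)), H}`. -/
noncomputable def bonus (φ : State ds × A → Feat d) (c : ℝ) (H : ℕ)
    (S : Matrix (Fin d) (Fin d) ℝ) (x : State ds × A) : ℝ :=
  2 * min (c * √(1 / 2 * ((φ x).ofLp ⬝ᵥ (S⁻¹ *ᵥ (φ x).ofLp)))) (H : ℝ)

/-- The iterates of projected SGD for the squared loss, on the stream of triples
`z 0, z 1, … ∈ (S × A) × S`: `W⁰ = 0` and
`W^{i+1} = Proj (W^i - η (W^i φ(s_i, a_i) - s'_i) φ(s_i, a_i)ᵀ)`. -/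
noncomputable def sgdIter (φ : State ds × A → Feat d) (F η : ℝ)
    (z : ℕ → (State ds × A) × State ds) : ℕ → Matrix (Fin ds) (Fin d) ℝ
  | 0 => 0
  | i + 1 => ballProj F (sgdIter φ F η z i - η • Matrix.vecMulVec
      (sgdIter φ F η z i *ᵥ (φ (z i).1).ofLp - (z i).2.ofLp) (φ (z i).1).ofLp)

/-- The fitted parameter: the average of the first `M` iterates of projected SGD. -/
noncomputable def sgdFit (φ : State ds × A → Feat d) (F η : ℝ) (M : ℕ)
    (z : ℕ → (State ds × A) × State ds) : Matrix (Fin ds) (Fin d) ℝ :=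
  (M : ℝ)⁻¹ • ∑ i ∈ Finset.range M, sgdIter φ F η z i

end MDP

/-- The hyper-parameters of PC-MLP: number of rounds `N`, of triples per round for model fitting
`M`, of state-action pairs per round for the covariance `K`, bonus scale `c`, regularization
`lam`, SGD radius `F` and SGD step size `η`. -/
structure HyperParams where
  N : ℕ
  M : ℕ
  K : ℕ
  c : ℝ
  lam : ℝ
  F : ℝ
  η : ℝ

/-- `IsPCMLPRun … μ ℱ x z π` : on the probability space `(Ω, μ)`, the random samples `x`, `z` and
the random policies `π` are produced by a run of PC-MLP with planning class `Pol` in the environment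
with dynamics `P`, reward `r` and initial state `s₀`. In round `n < N`:
the algorithm draws `K` pairs `x n k ∼ d^{π_n}` and forms `Σ̂_n` and the bonus; it draws `M` triples
`z n m = ((s, a), s')` with `(s, a) ∼ d^{Uniform(π_0, …, π_n)}`, `s' ∼ P(· | s, a)` and fits
`Ŵ_n` by projected SGD; then `π_{n+1}` maximizes `J(·; r + b̂_n, P_{Ŵ_n})` over `Pol`.
The samples are drawn one after another: `ℱ t` is the information available after `t` draws, and
each draw has the prescribed law conditionally on it. -/
structure IsPCMLPRun {ds d : ℕ} {A : Type*} [MeasurableSpace A] {Ω : Type*} [mΩ : MeasurableSpace Ω]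
    (H : ℕ) (σ : ℝ) (p : HyperParams)
    (φ : State ds × A → Feat d) (hφ : Measurable φ) (P : Kernel (State ds × A) (State ds))
    (r : State ds × A → ℝ) (s₀ : State ds) (Pol : Set (Policy ds A))
    (μ : Measure Ω) (ℱ : Filtration ℕ mΩ)
    (x : ℕ → ℕ → Ω → State ds × A) (z : ℕ → ℕ → Ω → (State ds × A) × State ds)
    (π : ℕ → Ω → Policy ds A) : Prop where
  /-- the initial policy is arbitrary but fixed -/
  init : ∃ π₀ : Policy ds A, ∀ ω, π 0 ω = π₀
  cov_measurable : ∀ n < p.N, ∀ k < p.K,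
    Measurable[ℱ (n * (p.K + p.M) + k + 1)] (x n k)
  cov_law : ∀ n < p.N, ∀ k < p.K, ∀ B : Set (State ds × A), MeasurableSet B →
    μ⟦x n k ⁻¹' B | ℱ (n * (p.K + p.M) + k)⟧ =ᵐ[μ]
      fun ω => (avgDist H P s₀ (π n ω)).real B
  model_measurable : ∀ n < p.N, ∀ m < p.M,
    Measurable[ℱ (n * (p.K + p.M) + p.K + m + 1)] (z n m)
  model_law : ∀ n < p.N, ∀ m < p.M, ∀ B : Set ((State ds × A) × State ds), MeasurableSet B →
    μ⟦z n m ⁻¹' B | ℱ (n * (p.K + p.M) + p.K + m)⟧ =ᵐ[μ]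
      fun ω => (coverDist H P s₀ (fun i => π i ω) n ⊗ₘ P).real B
  plan_mem : ∀ n, n + 1 < p.N → ∀ ω, π (n + 1) ω ∈ Pol
  plan_max : ∀ n, n + 1 < p.N → ∀ ω, ∀ π' ∈ Pol,
    value H (dynamics φ hφ σ (sgdFit φ p.F p.η p.M fun m => z n m ω)) s₀
        (fun y => r y + bonus φ p.c H (empCov φ p.lam p.K (fun i k => x i k ω) n) y) π' ≤
      value H (dynamics φ hφ σ (sgdFit φ p.F p.η p.M fun m => z n m ω)) s₀
        (fun y => r y + bonus φ p.c H (empCov φ p.lam p.K (fun i k => x i k ω) n) y) (π (n + 1) ω)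

/-! ### The quantities in the sample complexity bound -/

/-- `X = H⁶ F² d_s d / (σ² ε²)`. -/
noncomputable def cplx (H d ds : ℕ) (F σ ε : ℝ) : ℝ :=
  (H : ℝ) ^ 6 * F ^ 2 * ds * d / (σ ^ 2 * ε ^ 2)

/-- `B = F + σ √(d_s ln(2 d_s N M / δ))`. -/
noncomputable def stateBound (ds N M : ℕ) (F σ δ : ℝ) : ℝ :=
  F + σ * √(ds * Real.log (2 * ds * N * M / δ))

/-- The logarithmic factor
`ν = ln³ X · (ln²(N/δ) · (ln(2 d_s N/δ) + ln(Y)) + ln(N d/δ))`, where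
`Y = (8F⁴ + 9σ²F²d_s ln(2 d_s N/δ)) ln²(N/δ) N² + 18σ²F²d_s`. -/
noncomputable def logFactor (H d ds N : ℕ) (F σ ε δ : ℝ) : ℝ :=
  Real.log (cplx H d ds F σ ε) ^ 3 *
    (Real.log (N / δ) ^ 2 *
      (Real.log (2 * ds * N / δ) +
        Real.log ((8 * F ^ 4 + 9 * σ ^ 2 * F ^ 2 * ds * Real.log (2 * ds * N / δ)) *
          Real.log (N / δ) ^ 2 * N ^ 2 + 18 * σ ^ 2 * F ^ 2 * ds)) +
      Real.log (N * d / δ))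

end KNR

/-! The argument is optimism with an elliptical bonus. Rounds are numbered from 0. Let Δ be the
error of the parameter fitted in round n and let T be the identity plus the feature covariances of
the occupancy measures of π 0, …, π n. The Frobenius norm of Δ plus the summed squared prediction
errors under these policies is the trace of Δ T Δᵀ (`residCov_regCov`). A fit with error of order
d_s F²/N therefore confines Δ to an ellipsoid, and Cauchy–Schwarz gives ‖Δφ‖² ≲ d_s F² φᵀT⁻¹φ. The
Gaussian expectation of a bounded function changes by at most a multiple of ‖Δφ‖/σ
(`abs_integral_gaussian_sub_le`), so the bonus dominates the one-step model error.

The simulation lemma `value_le_value_add_sum` is then used twice. Going from the true dynamics to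
the model, it shows that the planned value is optimistic. Going back, it bounds the regret of π (n +
1) by a multiple of H² times its expected bonus under the true dynamics
(`value_sub_value_le_of_bonus`). The elliptical potential lemma `sum_integral_quadForm_inv_le`
bounds the summed squared bonuses by a multiple of d ln N. By Cauchy–Schwarz the average regret is
at most ε once N is large compared with X ln N (`mixture_optimal`), and the best policy is at least
as good as the average.

Two kinds of estimates must hold with high probability. For the covariances, the outer products φφᵀ
are vectors in Euclidean space, and cosh of the scaled norm of their centred sum grows in mean by a
bounded factor per draw (`vecMean_concentration`). The precision 3/(4N) per round is such that the
error accumulated over N rounds is absorbed by the regularizer. For the fits, the exponential of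
θ‖W^i - W⋆‖² plus the accumulated excess risk times θη/2 is a supermartingale up to deterministic
factors, because the noise enters a gradient step as a linear plus a quadratic form in a Gaussian
vector (`sgdIter_concentration`). The noise is never truncated: B enters only through the prescribed
size of M, which makes M the solution of an implicit equation (`exists_sampleSize`).

The random policies are arbitrary functions of ω, so the sampling laws are not assumed measurable in
ω. Everything needed about them is extracted from the conditional probabilities of the draws
(`condLaw_lintegral`). -/

namespace KNR

/-! ### Expectations along prescribed conditional laws -/

section CondLaw

variable {Ω E Y : Type*} {m mΩ : MeasurableSpace Ω} [MeasurableSpace E] [MeasurableSpace Y]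
  {μ : Measure Ω}
  {z : Ω → Y} {κ : Ω → Measure Y}

/-- No measurability of `κ` is assumed. For each fixed `B`, the function `κ ω B` agrees almost
everywhere with a conditional probability, hence is a.e. measurable, and integrating that
conditional probability over the `m`-measurable set `U ⁻¹' S` gives the identity. -/
theorem condLaw_rect [IsProbabilityMeasure μ] (hm : m ≤ mΩ) (hz : Measurable z)
    [∀ ω, IsProbabilityMeasure (κ ω)]
    (h : ∀ B, MeasurableSet B → μ⟦z ⁻¹' B | m⟧ =ᵐ[μ] fun ω => (κ ω).real B)
    {U : Ω → E} (hU : Measurable[m] U) {S : Set E} (hS : MeasurableSet S)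
    {B : Set Y} (hB : MeasurableSet B) :
    AEMeasurable (fun ω => κ ω {y | (U ω, y) ∈ S ×ˢ B}) μ ∧
      μ {ω | (U ω, z ω) ∈ S ×ˢ B} = ∫⁻ ω, κ ω {y | (U ω, y) ∈ S ×ˢ B} ∂μ := by
  have hUS : MeasurableSet[m] (U ⁻¹' S) := hU hS
  have heq : (fun ω => κ ω {y | (U ω, y) ∈ S ×ˢ B}) =
      (U ⁻¹' S).indicator (fun ω => κ ω B) := by
    funext ω
    by_cases hω : U ω ∈ S
    · simp [Set.indicator, hω]
    · simp [Set.indicator, hω]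
  have hint : Integrable ((z ⁻¹' B).indicator fun _ => (1 : ℝ)) μ :=
    (integrable_const 1).indicator (hz hB)
  have hκ : (fun ω => κ ω B) =ᵐ[μ] fun ω => ENNReal.ofReal ((μ⟦z ⁻¹' B | m⟧) ω) := by
    filter_upwards [h B hB] with ω hω
    rw [hω]
    simp [Measure.real]
  have hκm : AEMeasurable (fun ω => κ ω B) μ :=
    ⟨_, (stronglyMeasurable_condExp.measurable.mono hm le_rfl).ennreal_ofReal, hκ⟩
  rw [heq]
  refine ⟨hκm.indicator (hm _ hUS), ?_⟩
  rw [lintegral_indicator (hm _ hUS), lintegral_congr_ae (ae_restrict_of_ae hκ),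
    ← ofReal_integral_eq_lintegral_ofReal integrable_condExp.integrableOn
      (ae_restrict_of_ae (condExp_nonneg (ae_of_all _ fun ω => Set.indicator_nonneg (by simp) ω))),
    setIntegral_condExp hm hint hUS]
  erw [integral_indicator (hz hB)]
  simp only [integral_const, MeasurableSet.univ, measureReal_restrict_apply, Set.univ_inter,
    smul_eq_mul, mul_one, Set.mem_prod]
  rw [measureReal_restrict_apply (hz hB)]
  simp only [Measure.real, ENNReal.ofReal_toReal (measure_ne_top _ _)]
  congr 1
  ext ω
  simp [and_comm]

/-- Dynkin's π-λ argument: rectangles form a π-system, and both the a.e. measurability and the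
identity pass to complements and disjoint unions. -/
theorem condLaw_set [IsProbabilityMeasure μ] (hm : m ≤ mΩ) (hz : Measurable z)
    [∀ ω, IsProbabilityMeasure (κ ω)]
    (h : ∀ B, MeasurableSet B → μ⟦z ⁻¹' B | m⟧ =ᵐ[μ] fun ω => (κ ω).real B)
    {U : Ω → E} (hU : Measurable[m] U) {C : Set (E × Y)} (hC : MeasurableSet C) :
    AEMeasurable (fun ω => κ ω {y | (U ω, y) ∈ C}) μ ∧
      μ {ω | (U ω, z ω) ∈ C} = ∫⁻ ω, κ ω {y | (U ω, y) ∈ C} ∂μ := by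
  have hUm : Measurable U := hU.mono hm le_rfl
  have hUz : Measurable fun ω => (U ω, z ω) := hUm.prodMk hz
  have hsec : ∀ ω, Measurable fun y : Y => (U ω, y) := fun ω => measurable_prodMk_left
  induction C, hC using MeasurableSpace.induction_on_inter generateFrom_prod.symm
    isPiSystem_prod with
  | empty => simp
  | basic t ht =>
    obtain ⟨S, hS, B, hB, rfl⟩ := ht
    exact condLaw_rect hm hz h hU hS hB
  | compl t ht ih =>
    have h1 : (fun ω => κ ω {y | (U ω, y) ∈ tᶜ}) = fun ω => 1 - κ ω {y | (U ω, y) ∈ t} := by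
      funext ω
      exact prob_compl_eq_one_sub (hsec ω ht)
    have h2 : μ {ω | (U ω, z ω) ∈ tᶜ} = 1 - μ {ω | (U ω, z ω) ∈ t} :=
      prob_compl_eq_one_sub (hUz ht)
    rw [h1, h2]
    refine ⟨aemeasurable_const.sub ih.1, ?_⟩
    rw [lintegral_sub' ih.1 _ (ae_of_all _ fun ω => prob_le_one), ih.2]
    · simp
    · rw [← ih.2]; exact measure_ne_top _ _
  | iUnion f hd hf ih =>
    have h1 : (fun ω => κ ω {y | (U ω, y) ∈ ⋃ i, f i}) =
        fun ω => ∑' i, κ ω {y | (U ω, y) ∈ f i} := by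
      funext ω
      refine Eq.trans ?_ (measure_iUnion (fun i j hij => (hd hij).preimage _)
        (fun i => hsec ω (hf i)))
      congr 1
      ext y
      simp
    have h2 : μ {ω | (U ω, z ω) ∈ ⋃ i, f i} = ∑' i, μ {ω | (U ω, z ω) ∈ f i} := by
      refine Eq.trans ?_ (measure_iUnion (fun i j hij => (hd hij).preimage _)
        (fun i => hUz (hf i)))
      congr 1
      ext y
      simp
    rw [h1, h2]
    refine ⟨AEMeasurable.tsum fun i => (ih i).1, ?_⟩
    rw [lintegral_tsum fun i => (ih i).1]
    exact tsum_congr fun i => (ih i).2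

/-- Disintegration of expectations along a conditional law. -/
theorem condLaw_lintegral [IsProbabilityMeasure μ] (hm : m ≤ mΩ) (hz : Measurable z)
    [∀ ω, IsProbabilityMeasure (κ ω)]
    (h : ∀ B, MeasurableSet B → μ⟦z ⁻¹' B | m⟧ =ᵐ[μ] fun ω => (κ ω).real B)
    {U : Ω → E} (hU : Measurable[m] U) {G : E × Y → ℝ≥0∞} (hG : Measurable G) :
    AEMeasurable (fun ω => ∫⁻ y, G (U ω, y) ∂κ ω) μ ∧
      ∫⁻ ω, G (U ω, z ω) ∂μ = ∫⁻ ω, ∫⁻ y, G (U ω, y) ∂κ ω ∂μ := by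
  have hUm : Measurable U := hU.mono hm le_rfl
  have hUz : Measurable fun ω => (U ω, z ω) := hUm.prodMk hz
  have hsec : ∀ ω, Measurable fun y : Y => (U ω, y) := fun ω => measurable_prodMk_left
  refine Measurable.ennreal_induction (motive := fun G : E × Y → ℝ≥0∞ =>
    AEMeasurable (fun ω => ∫⁻ y, G (U ω, y) ∂κ ω) μ ∧
      ∫⁻ ω, G (U ω, z ω) ∂μ = ∫⁻ ω, ∫⁻ y, G (U ω, y) ∂κ ω ∂μ) ?_ ?_ ?_ hG
  · intro c s hs
    have h1 : ∀ ω, ∫⁻ y, s.indicator (fun _ => c) (U ω, y) ∂κ ω =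
        c * κ ω {y | (U ω, y) ∈ s} := by
      intro ω
      exact lintegral_indicator_const (hsec ω hs) c
    have h2 : ∫⁻ ω, s.indicator (fun _ => c) (U ω, z ω) ∂μ = c * μ {ω | (U ω, z ω) ∈ s} :=
      lintegral_indicator_const (hUz hs) c
    obtain ⟨h3, h4⟩ := condLaw_set hm hz h hU hs
    simp only [h1, h2]
    refine ⟨h3.const_mul c, ?_⟩
    rw [lintegral_const_mul'' _ h3, h4]
  · intro f g _ hf hg ihf ihg
    have h1 : ∀ ω, ∫⁻ y, (f + g) (U ω, y) ∂κ ω =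
        ∫⁻ y, f (U ω, y) ∂κ ω + ∫⁻ y, g (U ω, y) ∂κ ω := fun ω =>
      lintegral_add_left (hf.comp (hsec ω)) _
    simp only [h1]
    refine ⟨ihf.1.add ihg.1, ?_⟩
    rw [lintegral_add_left' ihf.1, ← ihf.2, ← ihg.2]
    exact lintegral_add_left (hf.comp hUz) _
  · intro f hf hmono ih
    have h1 : ∀ ω, ∫⁻ y, ⨆ n, f n (U ω, y) ∂κ ω = ⨆ n, ∫⁻ y, f n (U ω, y) ∂κ ω := by
      intro ω
      exact lintegral_iSup (fun n => (hf n).comp (hsec ω)) fun i j hij y => hmono hij _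
    have h2 : ∫⁻ ω, ⨆ n, f n (U ω, z ω) ∂μ = ⨆ n, ∫⁻ ω, f n (U ω, z ω) ∂μ := by
      exact lintegral_iSup (fun n => (hf n).comp hUz) fun i j hij y => hmono hij _
    simp only [h1, h2]
    refine ⟨AEMeasurable.iSup fun n => (ih n).1, ?_⟩
    rw [lintegral_iSup' (fun n => (ih n).1)
      (ae_of_all _ fun ω i j hij => lintegral_mono fun y => hmono hij _)]
    exact iSup_congr fun n => (ih n).2

/-- Integrals against a conditional law have a version that is measurable for the conditioning
σ-algebra. -/
theorem condLaw_lintegral_version [∀ ω, IsProbabilityMeasure (κ ω)]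
    (h : ∀ B, MeasurableSet B → μ⟦z ⁻¹' B | m⟧ =ᵐ[μ] fun ω => (κ ω).real B)
    {f : Y → ℝ≥0∞} (hf : Measurable f) :
    ∃ g : Ω → ℝ≥0∞, Measurable[m] g ∧ (fun ω => ∫⁻ y, f y ∂κ ω) =ᵐ[μ] g := by
  refine Measurable.ennreal_induction (motive := fun f : Y → ℝ≥0∞ =>
    ∃ g : Ω → ℝ≥0∞, Measurable[m] g ∧ (fun ω => ∫⁻ y, f y ∂κ ω) =ᵐ[μ] g) ?_ ?_ ?_ hf
  · intro c s hs
    refine ⟨fun ω => c * ENNReal.ofReal ((μ⟦z ⁻¹' s | m⟧) ω), ?_, ?_⟩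
    · exact (stronglyMeasurable_condExp.measurable.ennreal_ofReal).const_mul c
    · filter_upwards [h s hs] with ω hω
      rw [lintegral_indicator_const hs, hω]
      simp [Measure.real]
  · intro f g _ hf hg ihf ihg
    obtain ⟨f', hf', hff'⟩ := ihf
    obtain ⟨g', hg', hgg'⟩ := ihg
    refine ⟨fun ω => f' ω + g' ω, hf'.add hg', ?_⟩
    filter_upwards [hff', hgg'] with ω h1 h2
    rw [← h1, ← h2]
    exact lintegral_add_left hf _
  · intro f hf hmono ih
    choose g hg hfg using ih
    refine ⟨fun ω => ⨆ n, g n ω, Measurable.iSup hg, ?_⟩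
    filter_upwards [ae_all_iff.2 hfg] with ω hω
    simp only [← hω]
    exact lintegral_iSup hf fun i j hij y => hmono hij _

theorem condLaw_integral_version [∀ ω, IsProbabilityMeasure (κ ω)]
    (h : ∀ B, MeasurableSet B → μ⟦z ⁻¹' B | m⟧ =ᵐ[μ] fun ω => (κ ω).real B)
    {f : Y → ℝ} (hf : Measurable f) {b : ℝ} (hb : ∀ y, |f y| ≤ b) :
    ∃ g : Ω → ℝ, Measurable[m] g ∧ (fun ω => ∫ y, f y ∂κ ω) =ᵐ[μ] g := by
  -- Adding `b` makes the integrand nonnegative; since `κ ω` has mass one, subtracting `b`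
  -- afterwards undoes the shift.
  obtain ⟨g, hg, hfg⟩ := condLaw_lintegral_version h (f := fun y => ENNReal.ofReal (f y + b))
    (by fun_prop)
  refine ⟨fun ω => (g ω).toReal - b, hg.ennreal_toReal.sub_const b, ?_⟩
  filter_upwards [hfg] with ω hω
  have hi : Integrable f (κ ω) := Integrable.of_bound hf.aestronglyMeasurable b (ae_of_all _ hb)
  rw [← hω, ← integral_eq_lintegral_of_nonneg_ae
    (ae_of_all _ fun y => by have := neg_le_of_abs_le (hb y); change 0 ≤ f y + b; linarith)
    (by fun_prop), integral_add hi (integrable_const b)]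
  simp

end CondLaw

/-! ### Gaussian exponential moments and the cost of shifting the mean -/

section Gaussian

theorem multivariateGaussian_smul_one {ds : ℕ} (m : State ds) {σ : ℝ} (hσ : 0 ≤ σ) :
    multivariateGaussian m (σ ^ 2 • (1 : Matrix (Fin ds) (Fin ds) ℝ)) =
      (stdGaussian (State ds)).map fun ξ => m + σ • ξ := by
  have h : CFC.sqrt (σ ^ 2 • (1 : Matrix (Fin ds) (Fin ds) ℝ)) = σ • 1 := by
    refine CFC.sqrt_unique ?_ ?_
    · rw [smul_mul_smul_comm, mul_one, sq]
    · exact (Matrix.PosSemidef.one.smul hσ).nonneg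
  rw [multivariateGaussian, h]
  congr 1
  funext ξ
  simp

theorem lintegral_stdGaussian_prod {ds : ℕ} {f : Fin ds → ℝ → ℝ≥0∞} (hf : ∀ i, Measurable (f i)) :
    ∫⁻ ξ, ∏ i, f i (ξ i) ∂(stdGaussian (State ds)) = ∏ i, ∫⁻ x, f i x ∂(gaussianReal 0 1) := by
  rw [← map_pi_eq_stdGaussian, lintegral_map (by fun_prop) (by fun_prop)]
  have h : iIndepFun (fun (i : Fin ds) (ω : Fin ds → ℝ) => f i (ω i))
      (Measure.pi fun _ => gaussianReal 0 1) :=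
    iIndepFun_pi (fun i => (hf i).aemeasurable)
  rw [lintegral_prod_eq_prod_lintegral_of_indepFun Finset.univ _ h (by fun_prop)]
  refine Finset.prod_congr rfl fun i _ => ?_
  exact (measurePreserving_eval (fun _ : Fin ds => gaussianReal 0 1) i).lintegral_comp (hf i)

/-- Completing the square: the tilted density is a multiple of the Gaussian density with variance v
= 1/(1 - 2b) and mean av. -/
theorem exp_mul_gaussianPDFReal {b : ℝ} (hb : b ≤ 1 / 4) (a x : ℝ) :
    Real.exp (a * x + b * x ^ 2) * gaussianPDFReal 0 1 x =
      √(1 / (1 - 2 * b)) * Real.exp (a ^ 2 * (1 / (1 - 2 * b)) / 2) *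
        gaussianPDFReal (a * (1 / (1 - 2 * b))) (Real.toNNReal (1 / (1 - 2 * b))) x := by
  have h1 : 0 < 1 - 2 * b := by linarith
  set v : ℝ := 1 / (1 - 2 * b) with hv
  have hv0 : 0 < v := by positivity
  have hb' : b = (1 - 1 / v) / 2 := by rw [hv]; field_simp; ring
  simp only [gaussianPDFReal, Real.coe_toNNReal v hv0.le, NNReal.coe_one]
  have h2 : √v * (√(2 * Real.pi * v))⁻¹ = (√(2 * Real.pi * 1))⁻¹ := by
    rw [Real.sqrt_mul (by positivity) v]
    have := Real.sqrt_pos.2 hv0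
    field_simp
  calc _ = (√(2 * Real.pi * 1))⁻¹ *
        (Real.exp (a * x + b * x ^ 2) * Real.exp (-(x - 0) ^ 2 / (2 * 1))) := by ring
    _ = (√v * (√(2 * Real.pi * v))⁻¹) *
        (Real.exp (a ^ 2 * v / 2) * Real.exp (-(x - a * v) ^ 2 / (2 * v))) := by
      rw [h2, ← Real.exp_add, ← Real.exp_add]
      congr 2
      rw [hb']
      field_simp
      ring
    _ = _ := by ring

/-- The exact value is √v · exp(a²v/2) with v = 1/(1 - 2b). The condition b ≤ 1/4 gives v ≤ 2, and
also √v ≤ exp(2b), since (1 + 4b)(1 - 2b) ≥ 1. -/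
theorem lintegral_exp_quadratic_gaussianReal {b : ℝ} (hb0 : 0 ≤ b) (hb : b ≤ 1 / 4) (a : ℝ) :
    ∫⁻ x, ENNReal.ofReal (Real.exp (a * x + b * x ^ 2)) ∂(gaussianReal 0 1) ≤
      ENNReal.ofReal (Real.exp (a ^ 2 + 2 * b)) := by
  have h1 : 0 < 1 - 2 * b := by linarith
  have hv0 : 0 < 1 / (1 - 2 * b) := by positivity
  have hv2 : 1 / (1 - 2 * b) ≤ 2 := by rw [div_le_iff₀ h1]; linarith
  rw [gaussianReal_of_var_ne_zero _ one_ne_zero,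
    lintegral_withDensity_eq_lintegral_mul _ (measurable_gaussianPDF 0 1) (by fun_prop)]
  have h2 : ∀ x, (gaussianPDF 0 1 * fun x => ENNReal.ofReal (Real.exp (a * x + b * x ^ 2))) x =
      ENNReal.ofReal (√(1 / (1 - 2 * b)) * Real.exp (a ^ 2 * (1 / (1 - 2 * b)) / 2)) *
        gaussianPDF (a * (1 / (1 - 2 * b))) (Real.toNNReal (1 / (1 - 2 * b))) x := by
    intro x
    simp only [Pi.mul_apply, gaussianPDF]
    rw [← ENNReal.ofReal_mul (gaussianPDFReal_nonneg _ _ _), ← ENNReal.ofReal_mul (by positivity),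
      mul_comm, exp_mul_gaussianPDFReal hb]
  simp_rw [h2]
  rw [lintegral_const_mul _ (measurable_gaussianPDF _ _), lintegral_gaussianPDF_eq_one _
    (by simpa using hv0), mul_one]
  refine ENNReal.ofReal_le_ofReal ?_
  have h3 : √(1 / (1 - 2 * b)) ≤ Real.exp (2 * b) := by
    rw [Real.sqrt_le_left (Real.exp_pos _).le, ← Real.exp_nat_mul, div_le_iff₀ h1]
    have := Real.add_one_le_exp (((2 : ℕ) : ℝ) * (2 * b))
    push_cast at this ⊢
    nlinarith [Real.exp_pos (2 * (2 * b))]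
  rw [add_comm, Real.exp_add]
  refine mul_le_mul h3 (Real.exp_le_exp.2 ?_) (Real.exp_pos _).le (Real.exp_pos _).le
  nlinarith [sq_nonneg a]

/-- An upper bound for the moment generating function of a linear plus a quadratic form of a
standard Gaussian vector. -/
theorem lintegral_exp_quadratic_stdGaussian {ds : ℕ} {b : ℝ} (hb0 : 0 ≤ b) (hb : b ≤ 1 / 4)
    (a : State ds) :
    ∫⁻ ξ, ENNReal.ofReal (Real.exp (∑ i, a i * ξ i + b * ∑ i, ξ i ^ 2)) ∂(stdGaussian (State ds)) ≤
      ENNReal.ofReal (Real.exp (∑ i, a i ^ 2 + 2 * b * ds)) := by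
  have h : ∀ ξ : State ds, ENNReal.ofReal (Real.exp (∑ i, a i * ξ i + b * ∑ i, ξ i ^ 2)) =
      ∏ i, ENNReal.ofReal (Real.exp (a i * ξ i + b * ξ i ^ 2)) := by
    intro ξ
    rw [← ENNReal.ofReal_prod_of_nonneg fun i _ => (Real.exp_pos _).le, ← Real.exp_sum,
      Finset.sum_add_distrib, Finset.mul_sum]
  simp_rw [h]
  rw [lintegral_stdGaussian_prod (f := fun i x => ENNReal.ofReal (Real.exp (a i * x + b * x ^ 2)))
    (by fun_prop)]
  refine (Finset.prod_le_prod' fun i _ =>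
    lintegral_exp_quadratic_gaussianReal hb0 hb (a i)).trans ?_
  rw [← ENNReal.ofReal_prod_of_nonneg fun i _ => (Real.exp_pos _).le, ← Real.exp_sum,
    Finset.sum_add_distrib]
  simp [mul_comm]

/-- The Cameron–Martin density. -/
noncomputable def shiftDensity {ds : ℕ} (h ξ : State ds) : ℝ :=
  Real.exp (∑ i, (h i * ξ i - h i ^ 2 / 2))

theorem measurable_shiftDensity {ds : ℕ} (h : State ds) : Measurable (shiftDensity h) := by
  unfold shiftDensity
  fun_prop

theorem withDensity_gaussianReal (m : ℝ) {s : Set ℝ} (hs : MeasurableSet s) :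
    ∫⁻ x, s.indicator (fun x => ENNReal.ofReal (Real.exp (m * x - m ^ 2 / 2))) x
      ∂(gaussianReal 0 1) = gaussianReal m 1 s := by
  rw [gaussianReal_of_var_ne_zero _ one_ne_zero,
    lintegral_withDensity_eq_lintegral_mul _ (measurable_gaussianPDF 0 1)
      (Measurable.indicator (by fun_prop) hs), gaussianReal_apply _ one_ne_zero,
    ← lintegral_indicator hs]
  refine lintegral_congr fun x => ?_
  by_cases hx : x ∈ s
  · simp only [Pi.mul_apply, Set.indicator_of_mem hx, gaussianPDF]
    rw [← ENNReal.ofReal_mul (gaussianPDFReal_nonneg _ _ _)]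
    congr 1
    simp only [gaussianPDFReal]
    rw [mul_assoc, ← Real.exp_add]
    congr 2
    simp
    ring
  · simp [hx]

/-- It suffices to compare the two measures on boxes, where both factor over the coordinates and
`withDensity_gaussianReal` is the one-dimensional case. -/
theorem stdGaussian_map_add {ds : ℕ} (h : State ds) :
    (stdGaussian (State ds)).map (fun ξ => h + ξ) =
      (stdGaussian (State ds)).withDensity fun ξ => ENNReal.ofReal (shiftDensity h ξ) := by
  have h1 : (stdGaussian (State ds)).map (fun ξ => h + ξ) =
      (Measure.pi fun i => gaussianReal (h i) 1).map (WithLp.toLp 2) := by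
    rw [← map_pi_eq_stdGaussian, Measure.map_map (by fun_prop) (by fun_prop)]
    have : (Measure.pi fun i => gaussianReal (h i) 1) =
        (Measure.pi fun _ : Fin ds => gaussianReal 0 1).map fun x i => h i + x i := by
      rw [Measure.pi_map_pi (f := fun i x => h i + x) (by fun_prop)]
      congr 1
      funext i
      rw [gaussianReal_map_const_add, zero_add]
    rw [this, Measure.map_map (by fun_prop) (by fun_prop)]
    rfl
  have h2 : (Measure.pi fun i => gaussianReal (h i) 1) =
      ((stdGaussian (State ds)).withDensity fun ξ => ENNReal.ofReal (shiftDensity h ξ)).map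
        (WithLp.ofLp) := by
    refine Measure.pi_eq fun s hs => ?_
    have hs' : MeasurableSet (Set.univ.pi s) := .univ_pi hs
    have hms : MeasurableSet (WithLp.ofLp ⁻¹' Set.univ.pi s : Set (State ds)) :=
      (by fun_prop : Measurable (WithLp.ofLp : State ds → _)) hs'
    rw [Measure.map_apply (by fun_prop) hs', withDensity_apply _ hms, ← lintegral_indicator hms]
    simp_rw [← withDensity_gaussianReal _ (hs _)]
    rw [← lintegral_stdGaussian_prod fun i => Measurable.indicator (by fun_prop) (hs i)]
    refine lintegral_congr fun ξ => ?_
    by_cases hξ : ∀ i, ξ i ∈ s i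
    · have : ξ ∈ (WithLp.ofLp ⁻¹' Set.univ.pi s : Set (State ds)) := fun i _ => hξ i
      rw [Set.indicator_of_mem this]
      simp_rw [fun i => Set.indicator_of_mem (hξ i)
        (fun x => ENNReal.ofReal (Real.exp (h i * x - h i ^ 2 / 2)))]
      rw [← ENNReal.ofReal_prod_of_nonneg fun i _ => (Real.exp_pos _).le, ← Real.exp_sum]
      rfl
    · have : ξ ∉ (WithLp.ofLp ⁻¹' Set.univ.pi s : Set (State ds)) := fun hm =>
        hξ fun i => hm i trivial
      rw [Set.indicator_of_notMem this]
      push Not at hξ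
      obtain ⟨i, hi⟩ := hξ
      exact (Finset.prod_eq_zero (Finset.mem_univ i) (Set.indicator_of_notMem hi _)).symm
  rw [h1, h2, Measure.map_map (by fun_prop) (by fun_prop)]
  exact Measure.map_id

theorem integral_stdGaussian_add {ds : ℕ} (h : State ds) {V : State ds → ℝ} (hV : Measurable V) :
    ∫ ξ, V (h + ξ) ∂(stdGaussian (State ds)) =
      ∫ ξ, shiftDensity h ξ * V ξ ∂(stdGaussian (State ds)) := by
  rw [← integral_map (φ := fun ξ => h + ξ) (by fun_prop) hV.aestronglyMeasurable,
    stdGaussian_map_add, integral_withDensity_eq_integral_toReal_smul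
      (measurable_shiftDensity h).ennreal_ofReal (ae_of_all _ fun _ => ENNReal.ofReal_lt_top)]
  simp [ENNReal.toReal_ofReal, shiftDensity, (Real.exp_pos _).le]

theorem integral_shiftDensity {ds : ℕ} (h : State ds) :
    ∫ ξ, shiftDensity h ξ ∂(stdGaussian (State ds)) = 1 := by
  have := integral_stdGaussian_add h (V := fun _ => 1) measurable_const
  simpa using this.symm

theorem integrable_shiftDensity {ds : ℕ} (h : State ds) :
    Integrable (shiftDensity h) (stdGaussian (State ds)) := by
  -- The Bochner integral of a non-integrable function is 0 by convention, whereas this integral is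
  -- 1.
  by_contra hn
  have := integral_undef hn
  rw [integral_shiftDensity] at this
  exact one_ne_zero this

theorem shiftDensity_sq {ds : ℕ} (h ξ : State ds) :
    shiftDensity h ξ ^ 2 = Real.exp (∑ i, h i ^ 2) * shiftDensity ((2 : ℝ) • h) ξ := by
  unfold shiftDensity
  rw [← Real.exp_nat_mul, ← Real.exp_add, Finset.mul_sum, ← Finset.sum_add_distrib]
  congr 1
  refine Finset.sum_congr rfl fun i _ => ?_
  simp
  ring

theorem sq_integral_abs_le {Ω : Type*} [MeasurableSpace Ω] {μ : Measure Ω} [IsProbabilityMeasure μ]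
    {f : Ω → ℝ} (hf : AEStronglyMeasurable f μ) (hf2 : Integrable (fun x => f x ^ 2) μ) :
    (∫ x, |f x| ∂μ) ^ 2 ≤ ∫ x, f x ^ 2 ∂μ := by
  have hL : MemLp f 2 μ := (memLp_two_iff_integrable_sq hf).2 hf2
  have h1 : Integrable (fun x => |f x|) μ := (hL.integrable one_le_two).abs
  set a := ∫ x, |f x| ∂μ with ha
  have h2 : 0 ≤ ∫ x, (|f x| - a) ^ 2 ∂μ := integral_nonneg fun x => sq_nonneg _
  have h3 : ∫ x, (|f x| - a) ^ 2 ∂μ = ∫ x, f x ^ 2 ∂μ - 2 * a * a + a ^ 2 := by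
    have : ∀ x, (|f x| - a) ^ 2 = f x ^ 2 - 2 * a * |f x| + a ^ 2 := fun x => by
      rw [sub_sq, sq_abs]; ring
    simp_rw [this]
    have h4 : Integrable (fun x => 2 * a * |f x|) μ := h1.const_mul _
    have h5 : Integrable (fun x => f x ^ 2 - 2 * a * |f x|) μ := hf2.sub h4
    rw [integral_add h5 (integrable_const _), integral_sub hf2 h4, integral_const_mul]
    simp [← ha]
  nlinarith

/-- The L¹ norm is at most the L² norm, and the χ² distance is explicit: the second moment of the
density is exp(‖h‖²), because its square is a multiple of the density for the shift 2h. -/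
theorem integral_abs_shiftDensity_sub_one {ds : ℕ} (h : State ds) :
    (∫ ξ, |shiftDensity h ξ - 1| ∂(stdGaussian (State ds))) ^ 2 ≤
      Real.exp (∑ i, h i ^ 2) - 1 := by
  have hi1 : Integrable (fun ξ => shiftDensity h ξ ^ 2) (stdGaussian (State ds)) := by
    simp_rw [shiftDensity_sq]
    exact (integrable_shiftDensity _).const_mul _
  have hi2 : Integrable (fun ξ => 2 * shiftDensity h ξ) (stdGaussian (State ds)) :=
    (integrable_shiftDensity _).const_mul _
  have he : ∀ ξ, (shiftDensity h ξ - 1) ^ 2 = shiftDensity h ξ ^ 2 - 2 * shiftDensity h ξ + 1 :=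
    fun ξ => by ring
  have hi3 : Integrable (fun ξ => shiftDensity h ξ ^ 2 - 2 * shiftDensity h ξ)
    (stdGaussian (State ds)) := hi1.sub hi2
  refine (sq_integral_abs_le ?_ ?_).trans (le_of_eq ?_)
  · exact ((measurable_shiftDensity h).sub_const 1).aestronglyMeasurable
  · simp_rw [he]
    exact hi3.add (integrable_const _)
  · simp_rw [he]
    rw [integral_add hi3 (integrable_const _), integral_sub hi1 hi2, integral_const_mul]
    simp_rw [shiftDensity_sq]
    rw [integral_const_mul, integral_shiftDensity, integral_shiftDensity]
    simp
    ring

/-- The difference is the integral of `V` against the density minus 1. The restriction on ‖h‖ is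
what linearizes the χ² bound: exp(t) - 1 ≤ 4t for 0 ≤ t ≤ 1/4, used with t = ‖h‖². -/
theorem abs_integral_stdGaussian_add_sub_le {ds : ℕ} (h : State ds) {V : State ds → ℝ}
    (hV : Measurable V) {R : ℝ} (hR : ∀ s, |V s| ≤ R) (hh : ‖h‖ ≤ 1 / 2) :
    |∫ ξ, V (h + ξ) ∂(stdGaussian (State ds)) - ∫ ξ, V ξ ∂(stdGaussian (State ds))| ≤
      R * (2 * ‖h‖) := by
  have hR0 : 0 ≤ R := (abs_nonneg _).trans (hR 0)
  have hVi : Integrable V (stdGaussian (State ds)) :=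
    Integrable.of_bound hV.aestronglyMeasurable R (ae_of_all _ hR)
  have hLi := integrable_shiftDensity h
  have hLV : Integrable (fun ξ => shiftDensity h ξ * V ξ) (stdGaussian (State ds)) :=
    hLi.mul_bdd hV.aestronglyMeasurable (ae_of_all _ hR)
  have hLa : Integrable (fun ξ => |shiftDensity h ξ - 1|) (stdGaussian (State ds)) :=
    (hLi.sub (integrable_const 1)).abs
  rw [integral_stdGaussian_add h hV, ← integral_sub hLV hVi]
  have h1 : |∫ ξ, (shiftDensity h ξ * V ξ - V ξ) ∂(stdGaussian (State ds))| ≤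
      ∫ ξ, R * |shiftDensity h ξ - 1| ∂(stdGaussian (State ds)) := by
    refine (abs_integral_le_integral_abs).trans (integral_mono (hLV.sub hVi).abs (hLa.const_mul R)
      fun ξ => ?_)
    have : shiftDensity h ξ * V ξ - V ξ = V ξ * (shiftDensity h ξ - 1) := by ring
    simp only [this, abs_mul]
    exact mul_le_mul_of_nonneg_right (hR ξ) (abs_nonneg _)
  rw [integral_const_mul] at h1
  refine h1.trans (mul_le_mul_of_nonneg_left ?_ hR0)
  refine abs_le_of_sq_le_sq' ?_ (by positivity) |>.2
  refine (integral_abs_shiftDensity_sub_one h).trans ?_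
  have hn : ∑ i, h i ^ 2 = ‖h‖ ^ 2 := by rw [EuclideanSpace.real_norm_sq_eq]
  rw [hn]
  set t := ‖h‖ ^ 2 with ht
  have ht4 : t ≤ 1 / 4 := by rw [ht]; nlinarith [norm_nonneg h]
  have ht0 : 0 ≤ t := by positivity
  have h2 := Real.add_one_le_exp (-t)
  have h3 : Real.exp t * Real.exp (-t) = 1 := by rw [← Real.exp_add]; simp
  have : (2 * ‖h‖) ^ 2 = 4 * t := by rw [ht]; ring
  rw [this]
  nlinarith [Real.exp_pos t]

/-- Two Gaussian laws with the same isotropic covariance are close when their means are. -/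
theorem abs_integral_gaussian_sub_le {ds : ℕ} {σ : ℝ} (hσ : 0 < σ) (m₁ m₂ : State ds)
    {V : State ds → ℝ} (hV : Measurable V) {R : ℝ} (hR : ∀ s, 0 ≤ V s ∧ V s ≤ R) :
    |∫ s, V s ∂(multivariateGaussian m₁ (σ ^ 2 • 1)) -
        ∫ s, V s ∂(multivariateGaussian m₂ (σ ^ 2 • 1))| ≤
      R * min 1 (2 * (‖m₁ - m₂‖ / σ)) := by
  have hR0 : 0 ≤ R := (hR 0).1.trans (hR 0).2
  have hi : ∀ (ν : Measure (State ds)) [IsProbabilityMeasure ν], Integrable V ν := fun ν _ =>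
    Integrable.of_bound hV.aestronglyMeasurable R (ae_of_all _ fun s =>
      abs_le.2 ⟨by linarith [(hR s).1, (hR s).2], (hR s).2⟩)
  have hb : ∀ (ν : Measure (State ds)) [IsProbabilityMeasure ν],
      0 ≤ ∫ s, V s ∂ν ∧ ∫ s, V s ∂ν ≤ R := fun ν _ =>
    ⟨integral_nonneg fun s => (hR s).1, by
      have := integral_mono (hi ν) (integrable_const R) fun s => (hR s).2
      simpa using this⟩
  have htriv : |∫ s, V s ∂(multivariateGaussian m₁ (σ ^ 2 • 1)) -
        ∫ s, V s ∂(multivariateGaussian m₂ (σ ^ 2 • 1))| ≤ R := by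
    have h1 := hb (multivariateGaussian m₁ (σ ^ 2 • 1))
    have h2 := hb (multivariateGaussian m₂ (σ ^ 2 • 1))
    rw [abs_le]
    constructor <;> linarith
  set h : State ds := σ⁻¹ • (m₁ - m₂) with hh
  have hnorm : ‖h‖ = ‖m₁ - m₂‖ / σ := by
    rw [hh, norm_smul, Real.norm_of_nonneg (inv_nonneg.2 hσ.le)]; ring
  rw [← hnorm]
  -- For larger shifts the minimum equals 1, and two numbers in [0, R] differ by at most R.
  by_cases hle : ‖h‖ ≤ 1 / 2
  · rw [min_eq_right (by linarith)]
    have key := abs_integral_stdGaussian_add_sub_le h (V := fun ξ => V (m₂ + σ • ξ))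
      (by fun_prop) (R := R) (fun s => abs_le.2 ⟨by linarith [(hR (m₂ + σ • s)).1], (hR _).2⟩) hle
    rw [multivariateGaussian_smul_one _ hσ.le, multivariateGaussian_smul_one _ hσ.le,
      integral_map (by fun_prop) hV.aestronglyMeasurable,
      integral_map (by fun_prop) hV.aestronglyMeasurable]
    have he : ∀ ξ, m₂ + σ • (h + ξ) = m₁ + σ • ξ := by
      intro ξ
      rw [hh, smul_add, smul_smul, mul_inv_cancel₀ hσ.ne', one_smul]
      abel
    simpa only [he] using key
  · rw [min_eq_left (by linarith), mul_one]
    exact htriv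

end Gaussian

/-! ### Value functions and the simulation lemma -/

section Simulation

variable {ds d : ℕ} {A : Type*} [MeasurableSpace A]

instance isProbabilityMeasure_stateDist (P : Kernel (State ds × A) (State ds)) [IsMarkovKernel P]
    (s₀ : State ds) (π : Policy ds A) (h : ℕ) : IsProbabilityMeasure (stateDist P s₀ π h) := by
  induction h with
  | zero => exact Measure.dirac.isProbabilityMeasure
  | succ h ih => unfold stateDist; infer_instance

instance isProbabilityMeasure_stepDist (P : Kernel (State ds × A) (State ds)) [IsMarkovKernel P]
    (s₀ : State ds) (π : Policy ds A) (h : ℕ) : IsProbabilityMeasure (stepDist P s₀ π h) := by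
  unfold stepDist; infer_instance

theorem integrable_of_bounded {Ω : Type*} [MeasurableSpace Ω] (ν : Measure Ω)
    [IsFiniteMeasure ν] {f : Ω → ℝ} (hf : Measurable f) {b : ℝ} (hb : ∀ x, 0 ≤ f x ∧ f x ≤ b) :
    Integrable f ν :=
  Integrable.of_bound hf.aestronglyMeasurable b (ae_of_all _ fun x => by
    rw [Real.norm_of_nonneg (hb x).1]; exact (hb x).2)

theorem integral_mem_of_bounded {Ω : Type*} [MeasurableSpace Ω] (ν : Measure Ω)
    [IsProbabilityMeasure ν] {f : Ω → ℝ} (hf : Measurable f) {b : ℝ}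
    (hb : ∀ x, 0 ≤ f x ∧ f x ≤ b) : 0 ≤ ∫ x, f x ∂ν ∧ ∫ x, f x ∂ν ≤ b :=
  ⟨integral_nonneg fun x => (hb x).1, by
    simpa using integral_mono (integrable_of_bounded ν hf hb) (integrable_const b)
      fun x => (hb x).2⟩

/-- The expected total reward collected in `k` steps from a given state. -/
noncomputable def valueFn (P : Kernel (State ds × A) (State ds)) (f : State ds × A → ℝ)
    (π : Policy ds A) : ℕ → State ds → ℝ
  | 0 => fun _ => 0
  | k + 1 => fun s => ∫ a, (f (s, a) + ∫ s', valueFn P f π k s' ∂(P (s, a))) ∂(π.toKernel s)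

theorem valueFn_spec (P : Kernel (State ds × A) (State ds)) [IsMarkovKernel P]
    {f : State ds × A → ℝ} (hf : Measurable f) {b : ℝ} (hb : ∀ x, 0 ≤ f x ∧ f x ≤ b)
    (π : Policy ds A) (k : ℕ) :
    Measurable (valueFn P f π k) ∧ ∀ s, 0 ≤ valueFn P f π k s ∧ valueFn P f π k s ≤ k * b := by
  induction k with
  | zero => simp [valueFn]
  | succ k ih =>
    obtain ⟨hm, hb'⟩ := ih
    have h1 : Measurable fun x => ∫ s', valueFn P f π k s' ∂(P x) :=
      (hm.stronglyMeasurable.integral_kernel (κ := P)).measurable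
    have h2 : Measurable fun x => f x + ∫ s', valueFn P f π k s' ∂(P x) := hf.add h1
    have h3 : ∀ x, 0 ≤ f x + ∫ s', valueFn P f π k s' ∂(P x) ∧
        f x + ∫ s', valueFn P f π k s' ∂(P x) ≤ (k + 1 : ℕ) * b := fun x => by
      have h4 := integral_mem_of_bounded (P x) hm hb'
      have h5 := hb x
      push_cast
      constructor <;> linarith
    refine ⟨?_, fun s => ?_⟩
    · exact (h2.stronglyMeasurable.integral_kernel_prod_right' (κ := π.toKernel)).measurable
    · exact integral_mem_of_bounded (π.toKernel s)
        (f := fun a => f (s, a) + ∫ s', valueFn P f π k s' ∂(P (s, a)))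
        (h2.comp measurable_prodMk_left) fun a => h3 (s, a)

theorem integral_stateDist_policy (Q : Kernel (State ds × A) (State ds)) [IsMarkovKernel Q]
    (s₀ : State ds) (π : Policy ds A) (h : ℕ) {g : State ds × A → ℝ} (hg : Measurable g) {b : ℝ}
    (hb : ∀ x, 0 ≤ g x ∧ g x ≤ b) :
    ∫ s, ∫ a, g (s, a) ∂(π.toKernel s) ∂(stateDist Q s₀ π h) = ∫ x, g x ∂(stepDist Q s₀ π h) :=
  (Measure.integral_compProd (integrable_of_bounded _ hg hb)).symm

theorem integral_stateDist_succ (Q : Kernel (State ds × A) (State ds)) [IsMarkovKernel Q]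
    (s₀ : State ds) (π : Policy ds A) (h : ℕ) {V : State ds → ℝ} (hV : Measurable V) {b : ℝ}
    (hb : ∀ x, 0 ≤ V x ∧ V x ≤ b) :
    ∫ s, V s ∂(stateDist Q s₀ π (h + 1)) =
      ∫ x, ∫ s, V s ∂(Q x) ∂(stepDist Q s₀ π h) := by
  rw [stateDist, ← Measure.snd_compProd, Measure.snd,
    integral_map measurable_snd.aemeasurable hV.aestronglyMeasurable]
  exact Measure.integral_compProd
    (integrable_of_bounded _ (hV.comp measurable_snd) fun x => hb x.2)

/-- The simulation lemma, for a value function. -/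
theorem valueFn_eq_sum (P Q : Kernel (State ds × A) (State ds)) [IsMarkovKernel P]
    [IsMarkovKernel Q] {f : State ds × A → ℝ} (hf : Measurable f) {b : ℝ}
    (hb : ∀ x, 0 ≤ f x ∧ f x ≤ b) (s₀ : State ds) (π : Policy ds A) (H : ℕ) :
    valueFn P f π H s₀ = ∑ h ∈ Finset.range H, ∫ x, (f x +
      (∫ s, valueFn P f π (H - h - 1) s ∂(P x) - ∫ s, valueFn P f π (H - h - 1) s ∂(Q x)))
        ∂(stepDist Q s₀ π h) := by
  -- By the Bellman equation for `P`, the h-th term is the expected remaining `P`-value at step h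
  -- minus that at step h + 1, both along trajectories of `Q`, so the sum telescopes to the value at
  -- `s₀`.
  have hstep : ∀ h ∈ Finset.range H, ∫ x, (f x +
      (∫ s, valueFn P f π (H - h - 1) s ∂(P x) - ∫ s, valueFn P f π (H - h - 1) s ∂(Q x)))
        ∂(stepDist Q s₀ π h) = ∫ s, valueFn P f π (H - h) s ∂(stateDist Q s₀ π h) -
          ∫ s, valueFn P f π (H - (h + 1)) s ∂(stateDist Q s₀ π (h + 1)) := by
    intro h hh
    obtain ⟨k, hk⟩ : ∃ k, H - h = k + 1 := ⟨H - h - 1, by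
      have := Finset.mem_range.1 hh; omega⟩
    have hk' : H - (h + 1) = k := by omega
    rw [hk', hk, Nat.add_sub_cancel]
    obtain ⟨hm, hb'⟩ := valueFn_spec P hf hb π k
    have hPm : Measurable fun x => ∫ s, valueFn P f π k s ∂(P x) :=
      (hm.stronglyMeasurable.integral_kernel (κ := P)).measurable
    have hQm : Measurable fun x => ∫ s, valueFn P f π k s ∂(Q x) :=
      (hm.stronglyMeasurable.integral_kernel (κ := Q)).measurable
    have hPb := fun x => integral_mem_of_bounded (P x) hm hb'
    have hQb := fun x => integral_mem_of_bounded (Q x) hm hb'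
    rw [integral_stateDist_succ Q s₀ π h hm hb']
    have h2 := integral_stateDist_policy Q s₀ π h (hf.add hPm) (b := b + k * b)
      fun x => ⟨add_nonneg (hb x).1 (hPb x).1, add_le_add (hb x).2 (hPb x).2⟩
    have h3 : ∫ s, valueFn P f π (k + 1) s ∂(stateDist Q s₀ π h) =
      ∫ x, (f x + ∫ s, valueFn P f π k s ∂(P x)) ∂(stepDist Q s₀ π h) := h2
    rw [h3, ← integral_sub]
    · refine integral_congr_ae (ae_of_all _ fun x => ?_)
      simp only
      ring
    · exact (integrable_of_bounded _ hf hb).add (integrable_of_bounded _ hPm hPb)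
    · exact integrable_of_bounded _ hQm hQb
  rw [Finset.sum_congr rfl hstep, Finset.sum_range_sub']
  simp [stateDist, valueFn]

/-- This is the telescoping identity with both dynamics equal: the model error vanishes and only the
expected rewards remain. -/
theorem value_eq_valueFn (P : Kernel (State ds × A) (State ds)) [IsMarkovKernel P]
    {f : State ds × A → ℝ} (hf : Measurable f) {b : ℝ}
    (hb : ∀ x, 0 ≤ f x ∧ f x ≤ b) (s₀ : State ds) (π : Policy ds A) (H : ℕ) :
    value H P s₀ f π = valueFn P f π H s₀ := by
  rw [valueFn_eq_sum P P hf hb]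
  simp [value]

/-- The simulation lemma: if the one-step model error against every value function of `P` is at
most `g - f`, then `g` under `Q` is worth at least as much as `f` under `P`. -/
theorem value_le_value_add_sum (P Q : Kernel (State ds × A) (State ds)) [IsMarkovKernel P]
    [IsMarkovKernel Q] {f g u : State ds × A → ℝ} (hf : Measurable f) (hg : Measurable g)
    (hu : Measurable u) {b c : ℝ} (hb : ∀ x, 0 ≤ f x ∧ f x ≤ b)
    (hc : ∀ x, 0 ≤ g x ∧ g x ≤ c) {e : ℝ} (hub : ∀ x, 0 ≤ u x ∧ u x ≤ e)
    (s₀ : State ds) (π : Policy ds A) (H : ℕ)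
    (h : ∀ k < H, ∀ x, f x + (∫ s, valueFn P f π k s ∂(P x) - ∫ s, valueFn P f π k s ∂(Q x)) ≤
      g x + u x) :
    value H P s₀ f π ≤ value H Q s₀ g π + value H Q s₀ u π := by
  rw [value_eq_valueFn P hf hb, valueFn_eq_sum P Q hf hb, value, value, ← Finset.sum_add_distrib]
  refine Finset.sum_le_sum fun i hi => ?_
  have hi' := Finset.mem_range.1 hi
  rw [← integral_add (integrable_of_bounded _ hg hc) (integrable_of_bounded _ hu hub)]
  obtain ⟨hm, hb'⟩ := valueFn_spec P hf hb π (H - i - 1)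
  have hPm : Measurable fun x => ∫ s, valueFn P f π (H - i - 1) s ∂(P x) :=
    (hm.stronglyMeasurable.integral_kernel (κ := P)).measurable
  have hQm : Measurable fun x => ∫ s, valueFn P f π (H - i - 1) s ∂(Q x) :=
    (hm.stronglyMeasurable.integral_kernel (κ := Q)).measurable
  refine integral_mono ?_ ?_ fun x => h _ (by omega) x
  · exact (integrable_of_bounded _ hf hb).add
      ((integrable_of_bounded _ hPm fun x => integral_mem_of_bounded (P x) hm hb').sub
        (integrable_of_bounded _ hQm fun x => integral_mem_of_bounded (Q x) hm hb'))
  · exact (integrable_of_bounded _ hg hc).add (integrable_of_bounded _ hu hub)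

end Simulation

/-! ### Positive definite forms, log-determinants and the elliptical potential -/

section LinearAlgebra

variable {d : ℕ}

theorem dotProduct_mulVec_symm {S : Matrix (Fin d) (Fin d) ℝ} (hS : S.IsHermitian)
    (u v : Fin d → ℝ) : u ⬝ᵥ (S *ᵥ v) = v ⬝ᵥ (S *ᵥ u) := by
  have h : Sᵀ = S := by
    have := hS.eq
    rwa [Matrix.conjTranspose_eq_transpose_of_trivial] at this
  rw [dotProduct_comm, ← Matrix.vecMul_transpose, h, Matrix.dotProduct_mulVec]

theorem quadForm_nonneg {S : Matrix (Fin d) (Fin d) ℝ} (hS : S.PosSemidef) (v : Fin d → ℝ) :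
    0 ≤ v ⬝ᵥ (S *ᵥ v) := by
  simpa using hS.dotProduct_mulVec_nonneg v

/-- Nonnegativity of the form of `T` at u - T⁻¹v, expanded. The right side is the maximum of the
left over u, and this variational formula yields both the order reversal of inverses and
Cauchy–Schwarz. -/
theorem two_mul_dotProduct_sub_le {T : Matrix (Fin d) (Fin d) ℝ} (hT : T.PosDef)
    (u v : Fin d → ℝ) : 2 * (u ⬝ᵥ v) - u ⬝ᵥ (T *ᵥ u) ≤ v ⬝ᵥ (T⁻¹ *ᵥ v) := by
  have h := quadForm_nonneg hT.posSemidef (u - T⁻¹ *ᵥ v)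
  have hdet : IsUnit T.det := hT.det_pos.ne'.isUnit
  have h1 : T *ᵥ (T⁻¹ *ᵥ v) = v := by
    rw [Matrix.mulVec_mulVec, Matrix.mul_nonsing_inv _ hdet, Matrix.one_mulVec]
  have h2 : (T⁻¹ *ᵥ v) ⬝ᵥ (T *ᵥ u) = u ⬝ᵥ v := by
    rw [dotProduct_mulVec_symm hT.isHermitian, h1]
  rw [Matrix.mulVec_sub, h1, sub_dotProduct, dotProduct_sub, dotProduct_sub, h2,
    dotProduct_comm (T⁻¹ *ᵥ v) v] at h
  linarith

/-- Inversion of positive definite matrices reverses the Loewner order. -/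
theorem quadForm_inv_le {S T : Matrix (Fin d) (Fin d) ℝ} (hS : S.PosDef) (hT : T.PosDef) {k : ℝ}
    (hk : 0 < k) (h : ∀ v, v ⬝ᵥ (T *ᵥ v) ≤ k * (v ⬝ᵥ (S *ᵥ v))) (v : Fin d → ℝ) :
    v ⬝ᵥ (S⁻¹ *ᵥ v) ≤ k * (v ⬝ᵥ (T⁻¹ *ᵥ v)) := by
  have hdet : IsUnit S.det := hS.det_pos.ne'.isUnit
  set w := S⁻¹ *ᵥ v with hw
  have h1 : S *ᵥ w = v := by
    rw [hw, Matrix.mulVec_mulVec, Matrix.mul_nonsing_inv _ hdet, Matrix.one_mulVec]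
  -- If T equalled kS, then w/k = T⁻¹v would be the maximizer in the variational formula.
  have h2 := two_mul_dotProduct_sub_le hT (k⁻¹ • w) v
  have h3 := h w
  rw [h1] at h3
  rw [Matrix.mulVec_smul, smul_dotProduct, smul_dotProduct, dotProduct_smul, smul_eq_mul,
    smul_eq_mul, smul_eq_mul] at h2
  rw [dotProduct_comm v w]
  have h4 : k * (2 * (k⁻¹ * (w ⬝ᵥ v)) - k⁻¹ * (k⁻¹ * (w ⬝ᵥ (T *ᵥ w)))) ≤
    k * (v ⬝ᵥ (T⁻¹ *ᵥ v)) := mul_le_mul_of_nonneg_left h2 hk.le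
  have h5 : k * (2 * (k⁻¹ * (w ⬝ᵥ v)) - k⁻¹ * (k⁻¹ * (w ⬝ᵥ (T *ᵥ w)))) =
    2 * (w ⬝ᵥ v) - k⁻¹ * (w ⬝ᵥ (T *ᵥ w)) := by field_simp
  have h6 : k⁻¹ * (w ⬝ᵥ (T *ᵥ w)) ≤ w ⬝ᵥ v := by
    rw [inv_mul_le_iff₀ hk]; exact h3
  linarith

/-- The Cauchy–Schwarz inequality for a positive definite form and its dual. -/
theorem dotProduct_sq_le {S : Matrix (Fin d) (Fin d) ℝ} (hS : S.PosDef) (u v : Fin d → ℝ) :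
    (u ⬝ᵥ v) ^ 2 ≤ (u ⬝ᵥ (S *ᵥ u)) * (v ⬝ᵥ (S⁻¹ *ᵥ v)) := by
  by_cases hu : u = 0
  · simp [hu]
  have hpos : 0 < u ⬝ᵥ (S *ᵥ u) := by simpa using hS.dotProduct_mulVec_pos hu
  set q := u ⬝ᵥ (S *ᵥ u) with hq
  -- This multiple of u maximizes the left side along the line spanned by u.
  have h := two_mul_dotProduct_sub_le hS ((u ⬝ᵥ v / q) • u) v
  rw [Matrix.mulVec_smul, smul_dotProduct, smul_dotProduct, dotProduct_smul, smul_eq_mul,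
    smul_eq_mul, smul_eq_mul, ← hq] at h
  have h2 : 2 * (u ⬝ᵥ v / q * (u ⬝ᵥ v)) - u ⬝ᵥ v / q * (u ⬝ᵥ v / q * q) = (u ⬝ᵥ v) ^ 2 / q := by
    field_simp; ring
  rw [h2, div_le_iff₀ hpos] at h
  linarith

/-- Apply t ≤ exp(t - 1) to each eigenvalue and multiply. -/
theorem det_le_exp_trace_sub {P : Matrix (Fin d) (Fin d) ℝ} (hP : P.PosSemidef) :
    P.det ≤ Real.exp (P.trace - d) := by
  rw [hP.isHermitian.det_eq_prod_eigenvalues, hP.isHermitian.trace_eq_sum_eigenvalues]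
  have h : ∑ i, ((hP.isHermitian.eigenvalues i : ℝ)) - d =
      ∑ i, (hP.isHermitian.eigenvalues i - 1) := by simp
  simp only [RCLike.ofReal_real_eq_id, id]
  rw [h, Real.exp_sum]
  refine Finset.prod_le_prod (fun i _ => hP.eigenvalues_nonneg i) fun i _ => ?_
  linarith [Real.add_one_le_exp (hP.isHermitian.eigenvalues i - 1)]

/-- The first-order bound behind the elliptical potential argument. -/
theorem trace_inv_mul_le_log_det {S A : Matrix (Fin d) (Fin d) ℝ} (hS : S.PosDef)
    (hA : A.PosSemidef) :
    ((S + A)⁻¹ * A).trace ≤ Real.log (S + A).det - Real.log S.det := by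
  have hT : (S + A).PosDef := hS.add_posSemidef hA
  have hdet : IsUnit (S + A).det := hT.det_pos.ne'.isUnit
  -- With this factorization, B S Bᴴ is positive semidefinite with determinant det S / det(S + A)
  -- and trace d - tr((S + A)⁻¹A). The claim is then the logarithm of `det_le_exp_trace_sub`.
  obtain ⟨B, hB⟩ : ∃ B, (S + A)⁻¹ = Bᴴ * B := by
    refine ⟨CFC.sqrt (S + A)⁻¹, ?_⟩
    have h1 : (CFC.sqrt (S + A)⁻¹)ᴴ = CFC.sqrt (S + A)⁻¹ :=
      (CFC.sqrt_nonneg (S + A)⁻¹).isSelfAdjoint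
    rw [h1, CFC.sqrt_mul_sqrt_self _ hT.inv.posSemidef.nonneg]
  have hP : (B * S * Bᴴ).PosSemidef := hS.posSemidef.mul_mul_conjTranspose_same B
  have h1 : (B * S * Bᴴ).det = S.det / (S + A).det := by
    have h3 : ((S + A)⁻¹).det = B.det * Bᴴ.det := by rw [hB, Matrix.det_mul, mul_comm]
    have h4 : ((S + A)⁻¹).det * (S + A).det = 1 := by
      rw [← Matrix.det_mul, Matrix.nonsing_inv_mul _ hdet, Matrix.det_one]
    rw [Matrix.det_mul, Matrix.det_mul, eq_div_iff hT.det_pos.ne']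
    calc _ = S.det * (B.det * Bᴴ.det * (S + A).det) := by ring
      _ = S.det := by rw [← h3, h4, mul_one]
  have h2 : (B * S * Bᴴ).trace = d - ((S + A)⁻¹ * A).trace := by
    rw [Matrix.trace_mul_comm, ← mul_assoc, ← hB]
    have : (S + A)⁻¹ * S = 1 - (S + A)⁻¹ * A := by
      rw [eq_sub_iff_add_eq, ← mul_add, Matrix.nonsing_inv_mul _ hdet]
    rw [this, Matrix.trace_sub, Matrix.trace_one, Fintype.card_fin]
  have h5 := det_le_exp_trace_sub hP
  rw [h1, h2] at h5
  have h6 := Real.log_le_log (div_pos hS.det_pos hT.det_pos) h5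
  rw [Real.log_exp, Real.log_div hS.det_pos.ne' hT.det_pos.ne'] at h6
  linarith

/-- A form of the arithmetic–geometric mean inequality: T/c has trace at most d, hence determinant
at most 1. -/
theorem log_det_le {T : Matrix (Fin d) (Fin d) ℝ} (hT : T.PosDef) {c : ℝ} (hc : 0 < c)
    (h : T.trace ≤ d * c) : Real.log T.det ≤ d * Real.log c := by
  have hP : (c⁻¹ • T).PosSemidef := hT.posSemidef.smul (inv_nonneg.2 hc.le)
  have h1 := det_le_exp_trace_sub hP
  rw [Matrix.det_smul, Matrix.trace_smul, Fintype.card_fin, smul_eq_mul] at h1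
  have h2 : c⁻¹ * T.trace - d ≤ 0 := by
    rw [sub_nonpos, inv_mul_le_iff₀ hc]; linarith
  have h3 : T.det ≤ c ^ d := by
    have h4 := h1.trans (Real.exp_le_one_iff.2 h2)
    rw [inv_pow, inv_mul_le_iff₀ (by positivity), mul_one] at h4
    exact h4
  have := Real.log_le_log hT.det_pos h3
  rwa [Real.log_pow] at this

/-! ### Feature covariances -/

variable {X : Type*}

theorem abs_feat_le {φ : X → Feat d} (h1 : ∀ y, ‖φ y‖ ≤ 1) (x : X) (i : Fin d) : |φ x i| ≤ 1 :=
  (PiLp.norm_apply_le (φ x) i).trans (h1 x)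

theorem dotProduct_feat_self (φ : X → Feat d) (x : X) :
    (φ x).ofLp ⬝ᵥ (φ x).ofLp = ‖φ x‖ ^ 2 := by
  rw [EuclideanSpace.real_norm_sq_eq]
  simp [dotProduct, sq]

theorem dotProduct_feat_sq_le {φ : X → Feat d} (h1 : ∀ y, ‖φ y‖ ≤ 1) (v : Fin d → ℝ) (x : X) :
    (v ⬝ᵥ (φ x).ofLp) ^ 2 ≤ v ⬝ᵥ v := by
  have h2 : (φ x).ofLp ⬝ᵥ (φ x).ofLp ≤ 1 := by
    rw [dotProduct_feat_self]
    exact pow_le_one₀ (norm_nonneg _) (h1 x)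
  have h3 := dotProduct_sq_le (Matrix.PosDef.one (n := Fin d) (R := ℝ)) v (φ x).ofLp
  simp only [inv_one, Matrix.one_mulVec] at h3
  have h0 : 0 ≤ v ⬝ᵥ v := by simpa using dotProduct_star_self_nonneg v
  nlinarith

variable [MeasurableSpace X]

/-- The second-moment matrix of a feature map. -/
noncomputable def featCov (φ : X → Feat d) (ν : Measure X) : Matrix (Fin d) (Fin d) ℝ :=
  Matrix.of fun i j => ∫ x, φ x i * φ x j ∂ν

theorem integrable_feat_mul {φ : X → Feat d} (hφ : Measurable φ) (h1 : ∀ y, ‖φ y‖ ≤ 1)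
    (ν : Measure X) [IsFiniteMeasure ν] (i j : Fin d) :
    Integrable (fun x => φ x i * φ x j) ν := by
  refine Integrable.of_bound (by fun_prop) 1 (ae_of_all _ fun x => ?_)
  rw [norm_mul]
  exact mul_le_one₀ (abs_feat_le h1 x i) (norm_nonneg _) (abs_feat_le h1 x j)

theorem quadForm_feat_eq (M : Matrix (Fin d) (Fin d) ℝ) (v : Fin d → ℝ) :
    v ⬝ᵥ (M *ᵥ v) = ∑ i, ∑ j, M i j * (v j * v i) := by
  simp only [dotProduct, Matrix.mulVec, Finset.mul_sum]
  exact Finset.sum_congr rfl fun i _ => Finset.sum_congr rfl fun j _ => by ring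

theorem integrable_quadForm {φ : X → Feat d} (hφ : Measurable φ) (h1 : ∀ y, ‖φ y‖ ≤ 1)
    (ν : Measure X) [IsFiniteMeasure ν] (M : Matrix (Fin d) (Fin d) ℝ) :
    Integrable (fun x => (φ x).ofLp ⬝ᵥ (M *ᵥ (φ x).ofLp)) ν := by
  simp_rw [quadForm_feat_eq]
  exact integrable_finsetSum _ fun i _ => integrable_finsetSum _ fun j _ =>
    (integrable_feat_mul hφ h1 ν j i).const_mul _

theorem integral_quadForm {φ : X → Feat d} (hφ : Measurable φ) (h1 : ∀ y, ‖φ y‖ ≤ 1)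
    (ν : Measure X) [IsFiniteMeasure ν] (M : Matrix (Fin d) (Fin d) ℝ) :
    ∫ x, (φ x).ofLp ⬝ᵥ (M *ᵥ (φ x).ofLp) ∂ν = (M * featCov φ ν).trace := by
  simp_rw [quadForm_feat_eq]
  refine (integral_finsetSum _ fun i _ => integrable_finsetSum _ fun j _ =>
    (integrable_feat_mul hφ h1 ν j i).const_mul _).trans ?_
  simp only [Matrix.trace, Matrix.diag, Matrix.mul_apply]
  refine Finset.sum_congr rfl fun i _ => ?_
  refine (integral_finsetSum _ fun j _ =>
    (integrable_feat_mul hφ h1 ν j i).const_mul _).trans ?_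
  refine Finset.sum_congr rfl fun j _ => ?_
  rw [integral_const_mul]
  rfl

theorem quadForm_featCov {φ : X → Feat d} (hφ : Measurable φ) (h1 : ∀ y, ‖φ y‖ ≤ 1)
    (ν : Measure X) [IsFiniteMeasure ν] (v : Fin d → ℝ) :
    v ⬝ᵥ (featCov φ ν *ᵥ v) = ∫ x, (v ⬝ᵥ (φ x).ofLp) ^ 2 ∂ν := by
  have h : ∀ x, (v ⬝ᵥ (φ x).ofLp) ^ 2 =
      (φ x).ofLp ⬝ᵥ (Matrix.vecMulVec v v *ᵥ (φ x).ofLp) := by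
    intro x
    rw [Matrix.vecMulVec_mulVec, dotProduct_smul, dotProduct_comm (φ x).ofLp v]
    simp [sq]
  simp_rw [h]
  rw [integral_quadForm hφ h1, Matrix.vecMulVec_mul, Matrix.trace_vecMulVec,
    Matrix.dotProduct_mulVec, dotProduct_comm]

theorem featCov_posSemidef {φ : X → Feat d} (hφ : Measurable φ) (h1 : ∀ y, ‖φ y‖ ≤ 1)
    (ν : Measure X) [IsFiniteMeasure ν] : (featCov φ ν).PosSemidef := by
  refine .of_dotProduct_mulVec_nonneg ?_ fun v => ?_
  · ext i j
    simp [featCov, mul_comm]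
  · rw [star_trivial, quadForm_featCov hφ h1]
    exact integral_nonneg fun x => sq_nonneg _

theorem quadForm_featCov_le {φ : X → Feat d} (hφ : Measurable φ) (h1 : ∀ y, ‖φ y‖ ≤ 1)
    (ν : Measure X) [IsProbabilityMeasure ν] (v : Fin d → ℝ) :
    v ⬝ᵥ (featCov φ ν *ᵥ v) ≤ v ⬝ᵥ v := by
  rw [quadForm_featCov hφ h1]
  refine (integral_mem_of_bounded ν ?_ fun x =>
    ⟨sq_nonneg _, dotProduct_feat_sq_le h1 v x⟩).2
  simp only [dotProduct]
  fun_prop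

theorem trace_featCov_le {φ : X → Feat d} (hφ : Measurable φ) (h1 : ∀ y, ‖φ y‖ ≤ 1)
    (ν : Measure X) [IsProbabilityMeasure ν] : (featCov φ ν).trace ≤ 1 := by
  have h := integral_quadForm hφ h1 ν 1
  rw [one_mul] at h
  rw [← h]
  refine (integral_mem_of_bounded ν (b := 1) ?_ fun x => ?_).2
  · simp only [Matrix.one_mulVec, dotProduct]
    fun_prop
  · rw [Matrix.one_mulVec]
    rw [dotProduct_feat_self]
    exact ⟨by positivity, pow_le_one₀ (norm_nonneg _) (h1 x)⟩

/-- The regularized sum of the covariances of the first `n` distributions. -/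
noncomputable def regCov (φ : X → Feat d) (ν : ℕ → Measure X) (n : ℕ) :
    Matrix (Fin d) (Fin d) ℝ :=
  1 + ∑ i ∈ Finset.range n, featCov φ (ν i)

theorem regCov_posDef {φ : X → Feat d} (hφ : Measurable φ) (h1 : ∀ y, ‖φ y‖ ≤ 1)
    (ν : ℕ → Measure X) [∀ i, IsProbabilityMeasure (ν i)] (n : ℕ) : (regCov φ ν n).PosDef :=
  Matrix.PosDef.one.add_posSemidef
    (Matrix.posSemidef_sum _ fun i _ => featCov_posSemidef hφ h1 (ν i))

theorem quadForm_regCov {φ : X → Feat d} (ν : ℕ → Measure X) (n : ℕ) (v : Fin d → ℝ) :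
    v ⬝ᵥ (regCov φ ν n *ᵥ v) = v ⬝ᵥ v +
      ∑ i ∈ Finset.range n, v ⬝ᵥ (featCov φ (ν i) *ᵥ v) := by
  rw [regCov, Matrix.add_mulVec, dotProduct_add, Matrix.one_mulVec, Matrix.sum_mulVec,
    dotProduct_sum]

theorem dotProduct_self_le_quadForm_regCov {φ : X → Feat d} (hφ : Measurable φ)
    (h1 : ∀ y, ‖φ y‖ ≤ 1) (ν : ℕ → Measure X) [∀ i, IsProbabilityMeasure (ν i)] (n : ℕ)
    (v : Fin d → ℝ) : v ⬝ᵥ v ≤ v ⬝ᵥ (regCov φ ν n *ᵥ v) := by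
  rw [quadForm_regCov]
  have : 0 ≤ ∑ i ∈ Finset.range n, v ⬝ᵥ (featCov φ (ν i) *ᵥ v) :=
    Finset.sum_nonneg fun i _ => quadForm_nonneg (featCov_posSemidef hφ h1 (ν i)) v
  linarith

theorem log_det_regCov_le {φ : X → Feat d} (hφ : Measurable φ) (h1 : ∀ y, ‖φ y‖ ≤ 1) (hd : 1 ≤ d)
    (ν : ℕ → Measure X) [∀ i, IsProbabilityMeasure (ν i)] (n : ℕ) :
    Real.log (regCov φ ν n).det ≤ d * Real.log (n + 1) := by
  refine log_det_le (regCov_posDef hφ h1 ν n) (by positivity) ?_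
  rw [regCov, Matrix.trace_add, Matrix.trace_one, Fintype.card_fin, Matrix.trace_sum]
  have h2 : ∑ i ∈ Finset.range n, (featCov φ (ν i)).trace ≤ n := by
    refine (Finset.sum_le_sum fun i _ => trace_featCov_le hφ h1 (ν i)).trans ?_
    simp
  have hd' : (1 : ℝ) ≤ d := by exact_mod_cast hd
  have hn : (0 : ℝ) ≤ n := by positivity
  nlinarith

/-- The elliptical potential lemma, for expected features. -/
theorem sum_integral_quadForm_inv_le {φ : X → Feat d} (hφ : Measurable φ) (h1 : ∀ y, ‖φ y‖ ≤ 1)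
    (hd : 1 ≤ d) (ν : ℕ → Measure X) [∀ i, IsProbabilityMeasure (ν i)] (n : ℕ) :
    ∑ i ∈ Finset.range n, ∫ x, (φ x).ofLp ⬝ᵥ ((regCov φ ν i)⁻¹ *ᵥ (φ x).ofLp) ∂(ν i) ≤
      2 * (d * Real.log (n + 1)) := by
  have h2 : ∀ i, ∫ x, (φ x).ofLp ⬝ᵥ ((regCov φ ν i)⁻¹ *ᵥ (φ x).ofLp) ∂(ν i) ≤
      2 * (Real.log (regCov φ ν (i + 1)).det - Real.log (regCov φ ν i).det) := by
    intro i
    have hsucc : regCov φ ν (i + 1) = regCov φ ν i + featCov φ (ν i) := by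
      rw [regCov, Finset.sum_range_succ, ← add_assoc]
      rfl
    -- The potential uses the covariance before distribution i is added, whereas the log-determinant
    -- bound needs the one after. Since `featCov` is at most the identity, hence at most `regCov`,
    -- the update at most doubles the form, which costs the factor 2.
    have h3 : ∀ x, (φ x).ofLp ⬝ᵥ ((regCov φ ν i)⁻¹ *ᵥ (φ x).ofLp) ≤
        2 * ((φ x).ofLp ⬝ᵥ ((regCov φ ν (i + 1))⁻¹ *ᵥ (φ x).ofLp)) := fun x => by
      refine quadForm_inv_le (regCov_posDef hφ h1 ν i) (regCov_posDef hφ h1 ν (i + 1)) two_pos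
        (fun v => ?_) _
      rw [hsucc, Matrix.add_mulVec, dotProduct_add]
      have h4 := quadForm_featCov_le hφ h1 (ν i) v
      have h5 := dotProduct_self_le_quadForm_regCov hφ h1 ν i v
      linarith
    have h4 := integral_mono (integrable_quadForm hφ h1 (ν i) (regCov φ ν i)⁻¹)
      ((integrable_quadForm hφ h1 (ν i) (regCov φ ν (i + 1))⁻¹).const_mul 2) h3
    refine h4.trans ?_
    rw [integral_const_mul, integral_quadForm hφ h1, hsucc]
    exact mul_le_mul_of_nonneg_left
      (trace_inv_mul_le_log_det (regCov_posDef hφ h1 ν i) (featCov_posSemidef hφ h1 (ν i)))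
      zero_le_two
  refine (Finset.sum_le_sum fun i _ => h2 i).trans ?_
  rw [← Finset.mul_sum, Finset.sum_range_sub (fun i => Real.log (regCov φ ν i).det)]
  have h6 : Real.log (regCov φ ν 0).det = 0 := by simp [regCov]
  have h7 := log_det_regCov_le hφ h1 hd ν n
  rw [h6]
  linarith

end LinearAlgebra

/-! ### Concentration for sums of bounded Hilbert space valued increments -/

section Concentration

/-- The function cosh u is a power series in u² with nonnegative coefficients, hence convex in u².
Here u² is the convex combination of (a + r)² and (a - r)² with weights (1 ± q)/2, where q = τ/(ar).
-/
theorem cosh_le_interpolation {a r τ : ℝ} (ha : 0 < a) (hr : 0 < r) (hτ : |τ| ≤ a * r) {u : ℝ}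
    (hu : u ^ 2 = a ^ 2 + r ^ 2 + 2 * τ) :
    Real.cosh u ≤ Real.cosh a * Real.cosh r + τ / (a * r) * (Real.sinh a * Real.sinh r) := by
  have har : 0 < a * r := mul_pos ha hr
  set q := τ / (a * r) with hq
  have hτq : τ = q * (a * r) := by rw [hq]; field_simp
  have hq1 : -1 ≤ q ∧ q ≤ 1 := by
    rw [hq, ← abs_le, abs_div, abs_of_pos har, div_le_one har]; exact hτ
  have h1 := Real.hasSum_cosh u
  have h2 := ((Real.hasSum_cosh (a + r)).mul_left ((1 + q) / 2)).add
    ((Real.hasSum_cosh (a - r)).mul_left ((1 - q) / 2))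
  have h3 : Real.cosh u ≤ (1 + q) / 2 * Real.cosh (a + r) + (1 - q) / 2 * Real.cosh (a - r) := by
    refine hasSum_le (fun n => ?_) h1 h2
    rw [← mul_div_assoc, ← mul_div_assoc, ← add_div]
    refine div_le_div_of_nonneg_right ?_ (by positivity)
    have h4 := (convexOn_pow n).2 (Set.mem_Ici.2 (sq_nonneg (a + r)))
      (Set.mem_Ici.2 (sq_nonneg (a - r))) (by linarith [hq1.1] : 0 ≤ (1 + q) / 2)
      (by linarith [hq1.2] : 0 ≤ (1 - q) / 2) (by ring)
    simp only [smul_eq_mul] at h4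
    rw [pow_mul, pow_mul, pow_mul, hu]
    refine le_trans (le_of_eq ?_) h4
    congr 1
    rw [hτq]
    ring
  refine h3.trans (le_of_eq ?_)
  rw [Real.cosh_add, Real.cosh_sub]
  ring

theorem exp_sub_self_mono {r b : ℝ} (hr : 0 ≤ r) (hb : r ≤ b) :
    Real.exp r - r ≤ Real.exp b - b := by
  have h1 := Real.add_one_le_exp (b - r)
  have h2 : Real.exp b = Real.exp r * Real.exp (b - r) := by rw [← Real.exp_add]; ring_nf
  have h3 := Real.one_le_exp hr
  nlinarith

/-- The pointwise inequality behind exponential bounds for Hilbert space valued martingales. -/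
theorem cosh_norm_add_le {E : Type*} [NormedAddCommGroup E] [InnerProductSpace ℝ E] (s x : E)
    {b : ℝ} (hx : ‖x‖ ≤ b) :
    Real.cosh ‖s + x‖ ≤ Real.cosh ‖s‖ * (Real.exp b - b) +
      Real.sinh ‖s‖ / ‖s‖ * inner ℝ s x := by
  have hmono := exp_sub_self_mono (norm_nonneg x) hx
  have hsr : ‖x‖ ≤ Real.sinh ‖x‖ := Real.self_le_sinh_iff.2 (norm_nonneg x)
  have hexp : Real.exp ‖x‖ = Real.cosh ‖x‖ + Real.sinh ‖x‖ := (Real.cosh_add_sinh _).symm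
  have hc : 0 < Real.cosh ‖s‖ := Real.cosh_pos _
  have hmul := mul_le_mul_of_nonneg_left hmono hc.le
  by_cases hs : s = 0
  · simp only [hs, norm_zero, zero_add, Real.cosh_zero, inner_zero_left, mul_zero, add_zero]
    linarith
  by_cases hx0 : x = 0
  · simp only [hx0, norm_zero, add_zero, inner_zero_right, mul_zero, Real.exp_zero, sub_zero,
      mul_one] at hmul ⊢
    exact hmul
  have ha : 0 < ‖s‖ := norm_pos_iff.2 hs
  have hr : 0 < ‖x‖ := norm_pos_iff.2 hx0
  set τ : ℝ := inner ℝ s x with hτ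
  have hτa : |τ| ≤ ‖s‖ * ‖x‖ := abs_real_inner_le_norm s x
  have h1 := cosh_le_interpolation ha hr hτa (u := ‖s + x‖)
    (by rw [norm_add_sq_real]; ring)
  -- The part linear in x is split off because it averages to zero for a centred increment. The rest
  -- is at most cosh ‖s‖ · (sinh ‖x‖ - ‖x‖), and cosh r + sinh r - r = exp r - r.
  have h2 : τ / (‖s‖ * ‖x‖) * (Real.sinh ‖s‖ * Real.sinh ‖x‖) =
      Real.sinh ‖s‖ / ‖s‖ * τ +
        τ / (‖s‖ * ‖x‖) * (Real.sinh ‖s‖ * (Real.sinh ‖x‖ - ‖x‖)) := by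
    field_simp
    ring
  have h3 : τ / (‖s‖ * ‖x‖) * (Real.sinh ‖s‖ * (Real.sinh ‖x‖ - ‖x‖)) ≤
      Real.cosh ‖s‖ * (Real.sinh ‖x‖ - ‖x‖) := by
    have h4 : τ / (‖s‖ * ‖x‖) ≤ 1 := by
      rw [div_le_one (mul_pos ha hr)]; exact (le_abs_self _).trans hτa
    have h5 : 0 ≤ Real.sinh ‖s‖ := Real.sinh_nonneg_iff.2 ha.le
    have h6 : Real.sinh ‖s‖ ≤ Real.cosh ‖s‖ := (Real.sinh_lt_cosh _).le
    calc _ ≤ 1 * (Real.sinh ‖s‖ * (Real.sinh ‖x‖ - ‖x‖)) :=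
          mul_le_mul_of_nonneg_right h4 (mul_nonneg h5 (by linarith))
      _ ≤ _ := by rw [one_mul]; exact mul_le_mul_of_nonneg_right h6 (by linarith)
  nlinarith

variable {ι : Type*} [Fintype ι] {Y : Type*} [MeasurableSpace Y]

/-- The coordinatewise mean of a vector-valued function. -/
noncomputable def vecMean (f : Y → EuclideanSpace ℝ ι) (ν : Measure Y) : EuclideanSpace ℝ ι :=
  WithLp.toLp 2 fun i => ∫ y, f y i ∂ν

theorem integrable_coord {f : Y → EuclideanSpace ℝ ι} (hf : Measurable f) (h1 : ∀ y, ‖f y‖ ≤ 1)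
    (ν : Measure Y) [IsFiniteMeasure ν] (i : ι) : Integrable (fun y => f y i) ν :=
  Integrable.of_bound (by fun_prop) 1
    (ae_of_all _ fun y => (PiLp.norm_apply_le (f y) i).trans (h1 y))

theorem integral_inner_eq {f : Y → EuclideanSpace ℝ ι} (hf : Measurable f) (h1 : ∀ y, ‖f y‖ ≤ 1)
    (ν : Measure Y) [IsFiniteMeasure ν] (s : EuclideanSpace ℝ ι) :
    Integrable (fun y => inner ℝ s (f y)) ν ∧
      ∫ y, inner ℝ s (f y) ∂ν = inner ℝ s (vecMean f ν) := by
  have h : ∀ y, inner ℝ s (f y) = ∑ i, f y i * s i := fun y => by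
    simp [PiLp.inner_apply]
  simp_rw [h]
  refine ⟨integrable_finsetSum _ fun i _ => (integrable_coord hf h1 ν i).mul_const _, ?_⟩
  rw [integral_finsetSum _ fun i _ => (integrable_coord hf h1 ν i).mul_const _]
  simp [PiLp.inner_apply, vecMean, integral_mul_const]

theorem norm_vecMean_le {f : Y → EuclideanSpace ℝ ι} (hf : Measurable f) (h1 : ∀ y, ‖f y‖ ≤ 1)
    (ν : Measure Y) [IsProbabilityMeasure ν] : ‖vecMean f ν‖ ≤ 1 := by
  set m := vecMean f ν with hm
  obtain ⟨hi, he⟩ := integral_inner_eq hf h1 ν m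
  -- The mean is tested against itself.
  have h2 : ‖m‖ ^ 2 ≤ ‖m‖ := by
    rw [← real_inner_self_eq_norm_sq]
    calc inner ℝ m m = ∫ y, inner ℝ m (f y) ∂ν := he.symm
      _ ≤ ∫ _, ‖m‖ ∂ν := integral_mono hi (integrable_const _) fun y =>
          (real_inner_le_norm m (f y)).trans
            (mul_le_of_le_one_right (norm_nonneg _) (h1 y))
      _ = ‖m‖ := by simp
  by_contra! h
  nlinarith

theorem exp_sub_le_exp_sq {y : ℝ} (h0 : 0 ≤ y) (h1 : y ≤ 1) :
    Real.exp y - y ≤ Real.exp (y ^ 2) := by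
  have h2 := (abs_le.1 (Real.abs_exp_sub_one_sub_id_le (abs_le.2 ⟨by linarith, h1⟩))).2
  have h3 := Real.add_one_le_exp (y ^ 2)
  linarith

/-- The centred increment has norm at most 2, so after scaling by `l` the pointwise inequality
applies with b = 2l. Its linear term integrates to zero, leaving the factor exp(2l) - 2l ≤ exp(4l²),
which uses 2l ≤ 1. -/
theorem lintegral_cosh_step {f : Y → EuclideanSpace ℝ ι} (hf : Measurable f)
    (h1 : ∀ y, ‖f y‖ ≤ 1) (ν : Measure Y) [IsProbabilityMeasure ν] {l : ℝ} (hl : 0 ≤ l)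
    (hl2 : l ≤ 1 / 2) (s : EuclideanSpace ℝ ι) :
    ∫⁻ y, ENNReal.ofReal (Real.cosh (l * ‖s + (f y - vecMean f ν)‖)) ∂ν ≤
      ENNReal.ofReal (Real.exp (4 * l ^ 2)) * ENNReal.ofReal (Real.cosh (l * ‖s‖)) := by
  set m := vecMean f ν with hm
  obtain ⟨hi, he⟩ := integral_inner_eq hf h1 ν (l • s)
  have hnorm : ∀ v : EuclideanSpace ℝ ι, l * ‖v‖ = ‖l • v‖ := fun v => by
    rw [norm_smul, Real.norm_of_nonneg hl]
  set c := Real.sinh ‖l • s‖ / ‖l • s‖ with hc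
  have hpt : ∀ y, Real.cosh (l * ‖s + (f y - m)‖) ≤
      Real.cosh ‖l • s‖ * (Real.exp (2 * l) - 2 * l) +
        c * (l * (inner ℝ (l • s) (f y) - inner ℝ (l • s) m)) := by
    intro y
    rw [hnorm, smul_add]
    have h2 : ‖l • (f y - m)‖ ≤ 2 * l := by
      rw [norm_smul, Real.norm_of_nonneg hl]
      have := norm_sub_le (f y) m
      have := norm_vecMean_le hf h1 ν
      have := h1 y
      nlinarith
    refine (cosh_norm_add_le (l • s) (l • (f y - m)) h2).trans (le_of_eq ?_)
    rw [inner_smul_right, inner_sub_right]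
  have hlin : Integrable (fun y => c * (l * (inner ℝ (l • s) (f y) - inner ℝ (l • s) m))) ν :=
    ((hi.sub (integrable_const _)).const_mul _).const_mul _
  have hint : Integrable (fun y => Real.cosh ‖l • s‖ * (Real.exp (2 * l) - 2 * l) +
        c * (l * (inner ℝ (l • s) (f y) - inner ℝ (l • s) m))) ν :=
    (integrable_const _).add hlin
  calc _ ≤ ∫⁻ y, ENNReal.ofReal (Real.cosh ‖l • s‖ * (Real.exp (2 * l) - 2 * l) +
        c * (l * (inner ℝ (l • s) (f y) - inner ℝ (l • s) m))) ∂ν :=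
      lintegral_mono fun y => ENNReal.ofReal_le_ofReal (hpt y)
    _ = ENNReal.ofReal (∫ y, (Real.cosh ‖l • s‖ * (Real.exp (2 * l) - 2 * l) +
        c * (l * (inner ℝ (l • s) (f y) - inner ℝ (l • s) m))) ∂ν) :=
      (ofReal_integral_eq_lintegral_ofReal hint (ae_of_all _ fun y =>
        (Real.cosh_pos _).le.trans (hpt y))).symm
    _ = ENNReal.ofReal (Real.cosh ‖l • s‖ * (Real.exp (2 * l) - 2 * l)) := by
      rw [integral_add (integrable_const _) hlin, integral_const, integral_const_mul,
        integral_const_mul, integral_sub hi (integrable_const _), he, ← hm]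
      simp
    _ ≤ _ := by
      rw [← ENNReal.ofReal_mul (Real.exp_pos _).le, hnorm]
      refine ENNReal.ofReal_le_ofReal ?_
      rw [mul_comm]
      refine mul_le_mul_of_nonneg_right ?_ (Real.cosh_pos _).le
      have := exp_sub_le_exp_sq (y := 2 * l) (by linarith) (by linarith)
      rwa [show (2 * l) ^ 2 = 4 * l ^ 2 by ring] at this

theorem measurable_toLp_of {Ω ι : Type*} {m : MeasurableSpace Ω} {g : ι → Ω → ℝ}
    (hg : ∀ i, Measurable (g i)) :
    Measurable fun ω => (WithLp.toLp 2 fun i => g i ω : EuclideanSpace ℝ ι) := by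
  fun_prop

/-- Exponential concentration of the empirical mean of a bounded vector-valued function along
draws with a prescribed conditional law. -/
theorem vecMean_concentration {Ω : Type*} {mΩ : MeasurableSpace Ω} {μ : Measure Ω}
    [IsProbabilityMeasure μ] (ℱ : Filtration ℕ mΩ) (a K : ℕ) (hK : 0 < K) (x : ℕ → Ω → Y)
    (κ : Ω → Measure Y) [∀ ω, IsProbabilityMeasure (κ ω)] {f : Y → EuclideanSpace ℝ ι}
    (hf : Measurable f) (h1 : ∀ y, ‖f y‖ ≤ 1)
    (hx : ∀ k < K, Measurable[ℱ (a + k + 1)] (x k))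
    (hlaw : ∀ k < K, ∀ B, MeasurableSet B →
      μ⟦x k ⁻¹' B | ℱ (a + k)⟧ =ᵐ[μ] fun ω => (κ ω).real B)
    {l : ℝ} (hl : 0 ≤ l) (hl2 : l ≤ 1 / 2) (t : ℝ) :
    μ {ω | t ≤ ‖∑ k ∈ Finset.range K, (f (x k ω) - vecMean f (κ ω))‖} ≤
      ENNReal.ofReal (2 * Real.exp (4 * l ^ 2 * K - l * t)) := by
  -- The conditional mean need not be measurable in ω. Replacing it by a version `G` known at time
  -- `a` makes the partial sums `S` adapted.
  have hver : ∀ i, ∃ g : Ω → ℝ, Measurable[ℱ a] g ∧ (fun ω => ∫ y, f y i ∂κ ω) =ᵐ[μ] g :=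
    fun i => condLaw_integral_version (m := ℱ a) (z := x 0) (fun B hB => hlaw 0 hK B hB)
      (f := fun y => f y i) (by fun_prop) (b := 1)
      fun y => (PiLp.norm_apply_le (f y) i).trans (h1 y)
  choose g hg hgeq using hver
  let G : Ω → EuclideanSpace ℝ ι := fun ω => WithLp.toLp 2 fun i => g i ω
  have hG : Measurable[ℱ a] G := measurable_toLp_of hg
  have hGeq : ∀ᵐ ω ∂μ, vecMean f (κ ω) = G ω := by
    filter_upwards [ae_all_iff.2 hgeq] with ω hω
    ext i
    exact hω i
  let S : ℕ → Ω → EuclideanSpace ℝ ι := fun k ω => ∑ j ∈ Finset.range k, (f (x j ω) - G ω)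
  have hS : ∀ k ≤ K, Measurable[ℱ (a + k)] (S k) := by
    intro k hk
    refine Finset.measurable_sum _ fun j hj => ?_
    have hj' := Finset.mem_range.1 hj
    refine Measurable.sub ?_ (hG.mono (ℱ.mono (by omega)) le_rfl)
    exact hf.comp ((hx j (by omega)).mono (ℱ.mono (by omega)) le_rfl)
  -- Discounted by exp(4l²) per draw, cosh(l‖S‖) is a supermartingale. Markov's inequality with cosh
  -- y ≥ exp(y)/2 then accounts for the prefactor 2 of the final bound.
  have hmgf : ∀ k ≤ K, ∫⁻ ω, ENNReal.ofReal (Real.cosh (l * ‖S k ω‖)) ∂μ ≤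
      ENNReal.ofReal (Real.exp (4 * l ^ 2)) ^ k := by
    intro k
    induction k with
    | zero => simp [S]
    | succ k ih =>
      intro hk
      have hU : Measurable[ℱ (a + k)] fun ω => (S k ω, G ω) :=
        (hS k (by omega)).prodMk (hG.mono (ℱ.mono (by omega)) le_rfl)
      have hGm : Measurable fun p : (EuclideanSpace ℝ ι × EuclideanSpace ℝ ι) × Y =>
          ENNReal.ofReal (Real.cosh (l * ‖p.1.1 + (f p.2 - p.1.2)‖)) := by
        fun_prop
      have hstep := (condLaw_lintegral (ℱ.le _) ((hx k (by omega)).mono (ℱ.le _) le_rfl)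
        (hlaw k (by omega)) hU hGm).2
      calc ∫⁻ ω, ENNReal.ofReal (Real.cosh (l * ‖S (k + 1) ω‖)) ∂μ
          = ∫⁻ ω, ENNReal.ofReal (Real.cosh (l * ‖S k ω + (f (x k ω) - G ω)‖)) ∂μ := by
            simp only [S, Finset.sum_range_succ]
        _ = ∫⁻ ω, ∫⁻ y, ENNReal.ofReal (Real.cosh (l * ‖S k ω + (f y - G ω)‖)) ∂κ ω ∂μ := hstep
        _ ≤ ∫⁻ ω, ENNReal.ofReal (Real.exp (4 * l ^ 2)) *
              ENNReal.ofReal (Real.cosh (l * ‖S k ω‖)) ∂μ := by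
            refine lintegral_mono_ae ?_
            filter_upwards [hGeq] with ω hω
            rw [← hω]
            exact lintegral_cosh_step hf h1 (κ ω) hl hl2 _
        _ = ENNReal.ofReal (Real.exp (4 * l ^ 2)) *
              ∫⁻ ω, ENNReal.ofReal (Real.cosh (l * ‖S k ω‖)) ∂μ :=
            lintegral_const_mul' _ _ ENNReal.ofReal_ne_top
        _ ≤ _ := by
            rw [pow_succ' _ k]
            exact mul_le_mul' le_rfl (ih (by omega))
  have hfin := hmgf K le_rfl
  have hpow : ENNReal.ofReal (Real.exp (4 * l ^ 2)) ^ K =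
      ENNReal.ofReal (Real.exp (4 * l ^ 2 * K)) := by
    rw [← ENNReal.ofReal_pow (Real.exp_pos _).le, ← Real.exp_nat_mul, mul_comm]
  rw [hpow] at hfin
  have hSm : Measurable (S K) := (hS K le_rfl).mono (ℱ.le _) le_rfl
  have hmeas : Measurable fun ω => ENNReal.ofReal (Real.cosh (l * ‖S K ω‖)) := by fun_prop
  have hmarkov := mul_meas_ge_le_lintegral (μ := μ) hmeas (ENNReal.ofReal (Real.exp (l * t) / 2))
  have hsub : μ {ω | t ≤ ‖∑ k ∈ Finset.range K, (f (x k ω) - vecMean f (κ ω))‖} ≤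
      μ {ω | ENNReal.ofReal (Real.exp (l * t) / 2) ≤
        ENNReal.ofReal (Real.cosh (l * ‖S K ω‖))} := by
    refine measure_mono_ae ?_
    filter_upwards [hGeq] with ω hω hmem
    have hmem' : t ≤ ‖S K ω‖ := by
      change t ≤ ‖∑ k ∈ Finset.range K, (f (x k ω) - vecMean f (κ ω))‖ at hmem
      rwa [hω] at hmem
    refine ENNReal.ofReal_le_ofReal ?_
    rw [Real.cosh_eq]
    have := Real.exp_le_exp.2 (mul_le_mul_of_nonneg_left hmem' hl)
    have := Real.exp_pos (-(l * ‖S K ω‖))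
    linarith
  refine hsub.trans ?_
  have hpos : (0 : ℝ) < Real.exp (l * t) / 2 := by positivity
  have h5 : (2 * Real.exp (4 * l ^ 2 * K - l * t)) =
      Real.exp (4 * l ^ 2 * K) / (Real.exp (l * t) / 2) := by
    rw [Real.exp_sub]; field_simp
  rw [h5, ENNReal.ofReal_div_of_pos hpos, ENNReal.le_div_iff_mul_le
    (Or.inl (ENNReal.ofReal_pos.2 hpos).ne') (Or.inl ENNReal.ofReal_ne_top), mul_comm]
  exact hmarkov.trans hfin

end Concentration

/-! ### Spectral and Frobenius norms, and the projection onto the spectral ball -/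

section MatrixNorms

variable {m n : ℕ}

theorem specNorm_nonneg (W : Matrix (Fin m) (Fin n) ℝ) : 0 ≤ specNorm W := norm_nonneg _

theorem specNorm_zero : specNorm (0 : Matrix (Fin m) (Fin n) ℝ) = 0 := by simp [specNorm]

theorem specNorm_add_le (U V : Matrix (Fin m) (Fin n) ℝ) :
    specNorm (U + V) ≤ specNorm U + specNorm V := by
  unfold specNorm
  rw [map_add, map_add]
  exact norm_add_le _ _

theorem specNorm_smul (c : ℝ) (U : Matrix (Fin m) (Fin n) ℝ) :
    specNorm (c • U) = |c| * specNorm U := by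
  unfold specNorm
  rw [map_smul, map_smul, norm_smul, Real.norm_eq_abs]

theorem specNorm_sub_le (U V : Matrix (Fin m) (Fin n) ℝ) :
    specNorm (U - V) ≤ specNorm U + specNorm V := by
  unfold specNorm
  rw [map_sub, map_sub]
  exact norm_sub_le _ _

theorem norm_toEuclideanLin_le (W : Matrix (Fin m) (Fin n) ℝ) (v : EuclideanSpace ℝ (Fin n)) :
    ‖Matrix.toEuclideanLin W v‖ ≤ specNorm W * ‖v‖ :=
  (Matrix.toEuclideanLin W).toContinuousLinearMap.le_opNorm v

theorem norm_sq_toEuclideanLin (W : Matrix (Fin m) (Fin n) ℝ) (v : EuclideanSpace ℝ (Fin n)) :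
    ‖Matrix.toEuclideanLin W v‖ ^ 2 = ∑ i, (W i ⬝ᵥ v.ofLp) ^ 2 := by
  rw [EuclideanSpace.real_norm_sq_eq]
  rfl

/-- The squared Frobenius norm is at most the number of rows times the squared spectral norm. -/
theorem frobSq_le (W : Matrix (Fin m) (Fin n) ℝ) : frobSq W ≤ m * specNorm W ^ 2 := by
  have hrow : ∀ i, ∑ j, W i j ^ 2 ≤ specNorm W ^ 2 := by
    intro i
    -- The matrix is tested on its own row: the i-th coordinate of Wv is ‖v‖², so ‖v‖² ≤ ‖W‖₂ ‖v‖.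
    set v : EuclideanSpace ℝ (Fin n) := WithLp.toLp 2 (W i) with hv
    have h1 : ‖v‖ ^ 2 = ∑ j, W i j ^ 2 := by rw [EuclideanSpace.real_norm_sq_eq]
    have h2 := (PiLp.norm_apply_le (Matrix.toEuclideanLin W v) i).trans
      (norm_toEuclideanLin_le W v)
    have h3 : (Matrix.toEuclideanLin W v) i = ∑ j, W i j ^ 2 := by
      change W i ⬝ᵥ W i = _
      simp [dotProduct, sq]
    rw [h3, ← h1, Real.norm_of_nonneg (by positivity)] at h2
    rw [← h1]
    by_cases h0 : ‖v‖ = 0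
    · rw [h0]; simpa using sq_nonneg (specNorm W)
    · have h4 : ‖v‖ ≤ specNorm W := by
        have : 0 < ‖v‖ := lt_of_le_of_ne (norm_nonneg _) (Ne.symm h0)
        nlinarith
      exact pow_le_pow_left₀ (norm_nonneg _) h4 2
  unfold frobSq
  refine (Finset.sum_le_sum fun i _ => hrow i).trans ?_
  simp

/-- The Frobenius inner product. -/
def frobInner (U V : Matrix (Fin m) (Fin n) ℝ) : ℝ := ∑ i, ∑ j, U i j * V i j

theorem frobSq_nonneg (U : Matrix (Fin m) (Fin n) ℝ) : 0 ≤ frobSq U :=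
  Finset.sum_nonneg fun _ _ => Finset.sum_nonneg fun _ _ => sq_nonneg _

theorem frobSq_add_smul (U V : Matrix (Fin m) (Fin n) ℝ) (t : ℝ) :
    frobSq (U + t • V) = frobSq U + 2 * t * frobInner U V + t ^ 2 * frobSq V := by
  simp only [frobSq, frobInner, Finset.mul_sum, ← Finset.sum_add_distrib]
  refine Finset.sum_congr rfl fun i _ => Finset.sum_congr rfl fun j _ => ?_
  simp
  ring

/-- First-order optimality: by convexity U can be moved a fraction t towards X inside the ball
without coming closer to V. Dividing the resulting inequality by t and taking t small leaves only
the inner product. -/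
theorem frobInner_nonpos_of_isBallProj {F : ℝ} {V U X : Matrix (Fin m) (Fin n) ℝ}
    (h : IsBallProj F V U) (hX : specNorm X ≤ F) : frobInner (V - U) (X - U) ≤ 0 := by
  have key : ∀ t : ℝ, 0 < t → t ≤ 1 → 2 * frobInner (V - U) (X - U) ≤ t * frobSq (X - U) := by
    intro t ht ht1
    have hb : specNorm (U + t • (X - U)) ≤ F := by
      have h1 : U + t • (X - U) = (1 - t) • U + t • X := by
        rw [smul_sub, sub_smul, one_smul]; abel
      rw [h1]
      refine (specNorm_add_le _ _).trans ?_
      rw [specNorm_smul, specNorm_smul, abs_of_nonneg (by linarith), abs_of_pos ht]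
      have := h.1
      nlinarith
    have h2 := h.2 _ hb
    have h3 : V - (U + t • (X - U)) = (V - U) + (-t) • (X - U) := by
      rw [neg_smul]; abel
    rw [h3, frobSq_add_smul] at h2
    have h4 : t * (2 * frobInner (V - U) (X - U)) ≤ t * (t * frobSq (X - U)) := by nlinarith
    exact le_of_mul_le_mul_left h4 ht
  by_contra! hpos
  set a := frobInner (V - U) (X - U)
  set b := frobSq (X - U)
  have hb : 0 ≤ b := frobSq_nonneg _
  -- For this t one has tb ≤ a, while the comparison says 2a ≤ tb, which is impossible for a > 0.
  have h1 := key (min 1 (a / (b + 1))) (by positivity) (min_le_left _ _)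
  have h2 : min 1 (a / (b + 1)) * b ≤ a := by
    calc _ ≤ a / (b + 1) * b := mul_le_mul_of_nonneg_right (min_le_right _ _) hb
      _ ≤ a := by
        rw [div_mul_eq_mul_div, div_le_iff₀ (by positivity)]
        nlinarith
  linarith

theorem frobSq_sub (U V : Matrix (Fin m) (Fin n) ℝ) :
    frobSq (U - V) = frobSq U - 2 * frobInner U V + frobSq V := by
  have := frobSq_add_smul U V (-1)
  rw [neg_one_smul, ← sub_eq_add_neg] at this
  rw [this]
  ring

theorem frobInner_sub_left (U V W : Matrix (Fin m) (Fin n) ℝ) :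
    frobInner (U - V) W = frobInner U W - frobInner V W := by
  simp only [frobInner, ← Finset.sum_sub_distrib, Matrix.sub_apply, sub_mul]

/-- The ball projection is nonexpansive for the Frobenius norm. -/
theorem frobSq_sub_le_of_isBallProj {F : ℝ} {V V' U U' : Matrix (Fin m) (Fin n) ℝ}
    (h : IsBallProj F V U) (h' : IsBallProj F V' U') : frobSq (U - U') ≤ frobSq (V - V') := by
  have h1 := frobInner_nonpos_of_isBallProj h h'.1
  have h2 := frobInner_nonpos_of_isBallProj h' h.1
  set D := U - U' with hD
  have hD' : U' - U = -D := by rw [hD]; abel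
  have hneg : ∀ Z : Matrix (Fin m) (Fin n) ℝ, frobInner Z (-D) = -frobInner Z D := fun Z => by
    simp [frobInner]
  rw [hD', hneg] at h1
  have h3 : frobInner D D = frobSq D := by simp [frobInner, frobSq, sq]
  -- With the two optimality conditions this gives ⟨V - V', D⟩ ≥ ‖D‖², and nonnegativity of ‖(V -
  -- V') - D‖² finishes the proof.
  have h4 : frobInner (V - V') D = frobInner (V - U) D - frobInner (V' - U') D + frobSq D := by
    rw [← h3, ← frobInner_sub_left, hD]
    simp only [frobInner, ← Finset.sum_add_distrib, Matrix.sub_apply]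
    exact Finset.sum_congr rfl fun _ _ => Finset.sum_congr rfl fun _ _ => by ring
  have h5 := frobSq_nonneg ((V - V') - D)
  rw [frobSq_sub] at h5
  linarith

theorem isBallProj_self {F : ℝ} {V : Matrix (Fin m) (Fin n) ℝ} (h : specNorm V ≤ F) :
    IsBallProj F V V :=
  ⟨h, fun U' _ => by rw [sub_self]; simpa [frobSq] using frobSq_nonneg (V - U')⟩

theorem frobSq_ballProj_sub_le {F : ℝ} (hF : 0 ≤ F) (V : Matrix (Fin m) (Fin n) ℝ)
    {X : Matrix (Fin m) (Fin n) ℝ} (hX : specNorm X ≤ F) :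
    frobSq (ballProj F V - X) ≤ frobSq (V - X) :=
  frobSq_sub_le_of_isBallProj (isBallProj_ballProj hF V) (isBallProj_self hX)

theorem continuous_frobSq : Continuous (frobSq : Matrix (Fin m) (Fin n) ℝ → ℝ) := by
  unfold frobSq
  exact continuous_finsetSum _ fun i _ => continuous_finsetSum _ fun j _ =>
    (continuous_apply_apply i j).pow 2

/-- The projection was picked by a choice operator, but it is 1-Lipschitz in the Frobenius distance.
This is what makes the SGD iterates measurable. -/
theorem continuous_ballProj {F : ℝ} (hF : 0 ≤ F) :
    Continuous (ballProj F : Matrix (Fin m) (Fin n) ℝ → Matrix (Fin m) (Fin n) ℝ) := by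
  rw [continuous_iff_continuousAt]
  intro V
  refine tendsto_pi_nhds.2 fun i => tendsto_pi_nhds.2 fun j => ?_
  rw [tendsto_iff_norm_sub_tendsto_zero]
  have hlim : Filter.Tendsto (fun V' => √(frobSq (V' - V))) (nhds V) (nhds 0) := by
    have hc : Continuous fun V' : Matrix (Fin m) (Fin n) ℝ => √(frobSq (V' - V)) :=
      (continuous_frobSq.comp (continuous_id.sub continuous_const)).sqrt
    have := hc.tendsto V
    simpa [frobSq] using this
  refine squeeze_zero (fun _ => norm_nonneg _) (fun V' => ?_) hlim
  refine Real.le_sqrt_of_sq_le ?_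
  refine le_trans ?_ (frobSq_sub_le_of_isBallProj (isBallProj_ballProj hF V')
    (isBallProj_ballProj hF V))
  rw [Real.norm_eq_abs, sq_abs]
  unfold frobSq
  refine le_trans ?_ (Finset.single_le_sum
    (f := fun i => ∑ j, (ballProj F V' - ballProj F V) i j ^ 2)
    (fun i _ => Finset.sum_nonneg fun j _ => sq_nonneg _) (Finset.mem_univ i))
  exact Finset.single_le_sum (f := fun j => (ballProj F V' - ballProj F V) i j ^ 2)
    (fun j _ => sq_nonneg _) (Finset.mem_univ j)

/-- One unprojected gradient step for the squared loss. -/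
theorem frobSq_sub_smul_vecMulVec (D : Matrix (Fin m) (Fin n) ℝ) (η : ℝ) (w : Fin m → ℝ)
    (v : Fin n → ℝ) : frobSq (D - η • Matrix.vecMulVec w v) =
      frobSq D - 2 * η * (w ⬝ᵥ (D *ᵥ v)) + η ^ 2 * ((w ⬝ᵥ w) * (v ⬝ᵥ v)) := by
  rw [sub_eq_add_neg, ← neg_smul, frobSq_add_smul]
  have h1 : frobInner D (Matrix.vecMulVec w v) = w ⬝ᵥ (D *ᵥ v) := by
    simp only [frobInner, dotProduct, Matrix.mulVec, Matrix.vecMulVec_apply, Finset.mul_sum]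
    exact Finset.sum_congr rfl fun _ _ => Finset.sum_congr rfl fun _ _ => by ring
  have h2 : frobSq (Matrix.vecMulVec w v) = (w ⬝ᵥ w) * (v ⬝ᵥ v) := by
    simp only [frobSq, dotProduct, Matrix.vecMulVec_apply, Finset.sum_mul_sum]
    exact Finset.sum_congr rfl fun _ _ => Finset.sum_congr rfl fun _ _ => by ring
  rw [h1, h2]
  ring

end MatrixNorms

/-! ### One step of projected SGD under Gaussian noise -/

section SGD

instance instMeasurableSpaceMatrix {m n : ℕ} : MeasurableSpace (Matrix (Fin m) (Fin n) ℝ) :=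
  inferInstanceAs (MeasurableSpace (Fin m → Fin n → ℝ))

instance instBorelSpaceMatrix {m n : ℕ} : BorelSpace (Matrix (Fin m) (Fin n) ℝ) :=
  inferInstanceAs (BorelSpace (Fin m → Fin n → ℝ))

instance instSecondCountableTopologyMatrix {m n : ℕ} :
    SecondCountableTopology (Matrix (Fin m) (Fin n) ℝ) :=
  inferInstanceAs (SecondCountableTopology (Fin m → Fin n → ℝ))

theorem measurable_matrix_of {Ω : Type*} {mΩ : MeasurableSpace Ω} {m n : ℕ}
    {f : Ω → Matrix (Fin m) (Fin n) ℝ} (hf : ∀ i j, Measurable fun ω => f ω i j) : Measurable f :=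
  measurable_pi_iff.2 fun i => measurable_pi_iff.2 fun j => hf i j

theorem measurable_matrix_apply {m n : ℕ} (i : Fin m) (j : Fin n) :
    Measurable fun W : Matrix (Fin m) (Fin n) ℝ => W i j :=
  (measurable_pi_apply j).comp (measurable_pi_apply i)

variable {ds d : ℕ} {A : Type*}

/-- The squared norm of `D φ(y)`. -/
noncomputable def resid (φ : State ds × A → Feat d) (D : Matrix (Fin ds) (Fin d) ℝ)
    (y : State ds × A) : ℝ := ‖Matrix.toEuclideanLin D (φ y)‖ ^ 2

theorem resid_eq (φ : State ds × A → Feat d) (D : Matrix (Fin ds) (Fin d) ℝ) (y : State ds × A) :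
    resid φ D y = ∑ i, (D i ⬝ᵥ (φ y).ofLp) ^ 2 := norm_sq_toEuclideanLin D (φ y)

theorem resid_nonneg (φ : State ds × A → Feat d) (D : Matrix (Fin ds) (Fin d) ℝ)
    (y : State ds × A) : 0 ≤ resid φ D y := sq_nonneg _

theorem resid_le {φ : State ds × A → Feat d} (h1 : ∀ y, ‖φ y‖ ≤ 1)
    (D : Matrix (Fin ds) (Fin d) ℝ) (y : State ds × A) : resid φ D y ≤ specNorm D ^ 2 := by
  refine pow_le_pow_left₀ (norm_nonneg _) ((norm_toEuclideanLin_le D (φ y)).trans ?_) 2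
  exact mul_le_of_le_one_right (specNorm_nonneg D) (h1 y)

/-- One step of projected SGD. -/
noncomputable def sgdStep (φ : State ds × A → Feat d) (F η : ℝ) (W : Matrix (Fin ds) (Fin d) ℝ)
    (p : (State ds × A) × State ds) : Matrix (Fin ds) (Fin d) ℝ :=
  ballProj F (W - η • Matrix.vecMulVec (W *ᵥ (φ p.1).ofLp - p.2.ofLp) (φ p.1).ofLp)

/-- Projecting does not increase the distance to V. With u = (W - V)φ(y), the gradient factor is u -
σξ, and its squared norm is at most 2‖u‖² + 2σ²‖ξ‖². Since η ≤ 1/4, the term 2η²‖u‖² costs at most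
η‖u‖²/2 of the drift -2η‖u‖², leaving 3/2. The noise remains as a linear plus a quadratic form in ξ.
-/
theorem frobSq_sgdStep_sub_le {φ : State ds × A → Feat d} (h1 : ∀ y, ‖φ y‖ ≤ 1) {F : ℝ}
    (hF : 0 ≤ F) {η : ℝ} (hη : 0 ≤ η) (hη4 : η ≤ 1 / 4) (σ : ℝ)
    (W : Matrix (Fin ds) (Fin d) ℝ) {V : Matrix (Fin ds) (Fin d) ℝ} (hV : specNorm V ≤ F)
    (y : State ds × A) (ξ : State ds) :
    frobSq (sgdStep φ F η W (y, Matrix.toEuclideanLin V (φ y) + σ • ξ) - V) ≤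
      frobSq (W - V) - 3 / 2 * η * resid φ (W - V) y +
        2 * η * σ * ∑ i, ((W - V) *ᵥ (φ y).ofLp) i * ξ i + 2 * η ^ 2 * σ ^ 2 * ∑ i, ξ i ^ 2 := by
  set u := (W - V) *ᵥ (φ y).ofLp with hu
  have hw : W *ᵥ (φ y).ofLp - (Matrix.toEuclideanLin V (φ y) + σ • ξ).ofLp = u - σ • ξ.ofLp := by
    rw [hu, Matrix.sub_mulVec]
    ext i
    simp [Matrix.toLpLin_apply]
    ring
  refine (frobSq_ballProj_sub_le hF _ hV).trans ?_
  have h2 : W - η • Matrix.vecMulVec (W *ᵥ (φ y).ofLp -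
      (Matrix.toEuclideanLin V (φ y) + σ • ξ).ofLp) (φ y).ofLp - V =
      (W - V) - η • Matrix.vecMulVec (u - σ • ξ.ofLp) (φ y).ofLp := by
    rw [hw]; abel
  rw [h2, frobSq_sub_smul_vecMulVec, ← hu]
  have hr : resid φ (W - V) y = u ⬝ᵥ u := by
    rw [resid_eq]
    simp only [dotProduct, hu, Matrix.mulVec, sq]
  set c := ∑ i, u i * ξ i with hc
  have hcr : u ⬝ᵥ ξ.ofLp = c := by rw [hc, dotProduct]
  have hcl : ξ.ofLp ⬝ᵥ u = c := by rw [dotProduct_comm, hcr]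
  set e := ∑ i, ξ i ^ 2 with he
  have hee : ξ.ofLp ⬝ᵥ ξ.ofLp = e := by simp [dotProduct, he, sq]
  rw [hr]
  have h3 : (u - σ • ξ.ofLp) ⬝ᵥ u = u ⬝ᵥ u - σ * c := by
    rw [sub_dotProduct, smul_dotProduct, hcl, smul_eq_mul]
  have h4 : (u - σ • ξ.ofLp) ⬝ᵥ (u - σ • ξ.ofLp) = u ⬝ᵥ u - 2 * σ * c + σ ^ 2 * e := by
    rw [dotProduct_sub, h3, dotProduct_smul, sub_dotProduct, smul_dotProduct, hcr, hee,
      smul_eq_mul, smul_eq_mul]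
    ring
  have h5 : 0 ≤ u ⬝ᵥ u + 2 * σ * c + σ ^ 2 * e := by
    have h6 : 0 ≤ (u + σ • ξ.ofLp) ⬝ᵥ (u + σ • ξ.ofLp) := by
      simpa using dotProduct_star_self_nonneg (u + σ • ξ.ofLp)
    rw [dotProduct_add, add_dotProduct, add_dotProduct, dotProduct_smul, dotProduct_smul,
      smul_dotProduct, smul_dotProduct, hcl, hcr, hee, smul_eq_mul, smul_eq_mul, smul_eq_mul] at h6
    linarith
  have h40 : 0 ≤ u ⬝ᵥ u - 2 * σ * c + σ ^ 2 * e := by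
    rw [← h4]; simpa using dotProduct_star_self_nonneg (u - σ • ξ.ofLp)
  have hφ1 : (φ y).ofLp ⬝ᵥ (φ y).ofLp ≤ 1 := by
    rw [dotProduct_feat_self]
    exact pow_le_one₀ (norm_nonneg _) (h1 y)
  have hu0 : 0 ≤ u ⬝ᵥ u := by simpa using dotProduct_star_self_nonneg u
  rw [h3, h4]
  have h7 : η ^ 2 * ((u ⬝ᵥ u - 2 * σ * c + σ ^ 2 * e) * ((φ y).ofLp ⬝ᵥ (φ y).ofLp)) ≤
      η ^ 2 * (u ⬝ᵥ u - 2 * σ * c + σ ^ 2 * e) :=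
    mul_le_mul_of_nonneg_left (mul_le_of_le_one_right h40 hφ1) (sq_nonneg _)
  have h8 : 0 ≤ η ^ 2 * (u ⬝ᵥ u + 2 * σ * c + σ ^ 2 * e) := mul_nonneg (sq_nonneg _) h5
  have h9 : η ^ 2 * (u ⬝ᵥ u) ≤ 1 / 4 * η * (u ⬝ᵥ u) :=
    mul_le_mul_of_nonneg_right (by nlinarith) hu0
  nlinarith

variable [MeasurableSpace A]

theorem measurable_resid {φ : State ds × A → Feat d} (hφ : Measurable φ)
    (D : Matrix (Fin ds) (Fin d) ℝ) : Measurable (resid φ D) := by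
  have : Measurable fun y => Matrix.toEuclideanLin D (φ y) :=
    (Matrix.toEuclideanLin D).continuous_of_finiteDimensional.measurable.comp hφ
  exact this.norm.pow_const 2

theorem integrable_resid {φ : State ds × A → Feat d} (hφ : Measurable φ) (h1 : ∀ y, ‖φ y‖ ≤ 1)
    (D : Matrix (Fin ds) (Fin d) ℝ) (ν : Measure (State ds × A)) [IsFiniteMeasure ν] :
    Integrable (resid φ D) ν :=
  integrable_of_bounded ν (measurable_resid hφ D) fun y => ⟨resid_nonneg φ D y, resid_le h1 D y⟩

/-- The trace of `D C Dᵀ`. -/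
noncomputable def residCov (D : Matrix (Fin ds) (Fin d) ℝ) (C : Matrix (Fin d) (Fin d) ℝ) : ℝ :=
  ∑ i, D i ⬝ᵥ (C *ᵥ D i)

theorem integral_resid {φ : State ds × A → Feat d} (hφ : Measurable φ) (h1 : ∀ y, ‖φ y‖ ≤ 1)
    (D : Matrix (Fin ds) (Fin d) ℝ) (ν : Measure (State ds × A)) [IsProbabilityMeasure ν] :
    ∫ y, resid φ D y ∂ν = residCov D (featCov φ ν) := by
  simp_rw [resid_eq]
  rw [integral_finsetSum]
  · exact Finset.sum_congr rfl fun i _ => (quadForm_featCov hφ h1 ν (D i)).symm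
  · intro i _
    refine integrable_of_bounded ν ?_ fun y =>
      ⟨sq_nonneg _, dotProduct_feat_sq_le h1 (D i) y⟩
    simp only [dotProduct]
    fun_prop

theorem measurable_sgdStep {φ : State ds × A → Feat d} (hφ : Measurable φ) {F : ℝ} (hF : 0 ≤ F)
    (η : ℝ) : Measurable fun q : Matrix (Fin ds) (Fin d) ℝ × ((State ds × A) × State ds) =>
      sgdStep φ F η q.1 q.2 := by
  refine (continuous_ballProj hF).measurable.comp (measurable_matrix_of fun i j => ?_)
  have hW : ∀ k, Measurable fun q : Matrix (Fin ds) (Fin d) ℝ × ((State ds × A) × State ds) =>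
      q.1 i k := fun k => (measurable_matrix_apply i k).comp measurable_fst
  have hWj := hW j
  simp only [Matrix.sub_apply, Matrix.smul_apply, Matrix.vecMulVec_apply, Pi.sub_apply,
    Matrix.mulVec, dotProduct]
  fun_prop

theorem exp_neg_le_one_sub_half {y : ℝ} (h0 : 0 ≤ y) (h1 : y ≤ 1) :
    Real.exp (-y) ≤ 1 - y / 2 := by
  have h2 : Real.exp (-y) * Real.exp y = 1 := by rw [← Real.exp_add]; simp
  have h3 := Real.add_one_le_exp y
  have h4 := Real.exp_pos (-y)
  nlinarith [mul_nonneg h0 (sub_nonneg.2 h1)]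

/-- The conditional exponential moment of one step of projected SGD. -/
theorem lintegral_exp_sgdStep_le {φ : State ds × A → Feat d} (hφ : Measurable φ)
    (h1 : ∀ y, ‖φ y‖ ≤ 1) {F : ℝ} (hF : 0 ≤ F) {η σ θ : ℝ} (hη : 0 ≤ η) (hη4 : η ≤ 1 / 4)
    (hσ : 0 ≤ σ) (hθ : 0 ≤ θ) (hθσ : θ * η * σ ^ 2 ≤ 1 / 8) (hθF : θ * η * (4 * F ^ 2) ≤ 1)
    {W V : Matrix (Fin ds) (Fin d) ℝ} (hW : specNorm W ≤ F) (hV : specNorm V ≤ F)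
    (ν : Measure (State ds × A)) [IsProbabilityMeasure ν] :
    ∫⁻ p, ENNReal.ofReal (Real.exp (θ * frobSq (sgdStep φ F η W p - V)))
        ∂(ν ⊗ₘ dynamics φ hφ σ V) ≤
      ENNReal.ofReal (Real.exp (θ * frobSq (W - V) + 4 * θ * η ^ 2 * σ ^ 2 * ds -
        1 / 2 * θ * η * ∫ y, resid φ (W - V) y ∂ν)) := by
  have hstep : Measurable fun p => sgdStep φ F η W p - V :=
    measurable_matrix_of fun i j => by
      have h2 := (measurable_matrix_apply i j).comp
        ((measurable_sgdStep hφ hF η).comp (measurable_prodMk_left (x := W)))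
      exact h2.sub_const (V i j)
  have hmeas : Measurable fun p => ENNReal.ofReal (Real.exp (θ *
      frobSq (sgdStep φ F η W p - V))) :=
    (((continuous_frobSq.measurable.comp hstep).const_mul θ).exp).ennreal_ofReal
  rw [Measure.lintegral_compProd hmeas]
  set a := θ * frobSq (W - V) + 4 * θ * η ^ 2 * σ ^ 2 * ds with ha
  have hrF : ∀ y, resid φ (W - V) y ≤ 4 * F ^ 2 := fun y => by
    refine (resid_le h1 _ y).trans ?_
    have h2 := specNorm_sub_le W V
    have h3 := specNorm_nonneg (W - V)
    nlinarith
  have hη0 : 0 ≤ θ * η := mul_nonneg hθ hη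
  have hinner : ∀ y, ∫⁻ s, ENNReal.ofReal (Real.exp (θ *
      frobSq (sgdStep φ F η W (y, s) - V))) ∂(dynamics φ hφ σ V y) ≤
      ENNReal.ofReal (Real.exp a * (1 - 1 / 2 * (θ * η) * resid φ (W - V) y)) := by
    intro y
    have hdyn : dynamics φ hφ σ V y = (stdGaussian (State ds)).map
        fun ξ => Matrix.toEuclideanLin V (φ y) + σ • ξ :=
      multivariateGaussian_smul_one _ hσ
    have hmy : Measurable fun s => ENNReal.ofReal (Real.exp (θ *
        frobSq (sgdStep φ F η W (y, s) - V))) := hmeas.comp measurable_prodMk_left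
    rw [hdyn, lintegral_map hmy (by fun_prop)]
    set u : State ds := WithLp.toLp 2 ((W - V) *ᵥ (φ y).ofLp) with hu
    set r := resid φ (W - V) y with hr
    have hr0 : 0 ≤ r := resid_nonneg _ _ _
    have hur : ∑ i, u i ^ 2 = r := by rw [hr, resid_eq]; rfl
    have hb : 2 * θ * η ^ 2 * σ ^ 2 ≤ 1 / 4 := by
      have : 2 * θ * η ^ 2 * σ ^ 2 = 2 * η * (θ * η * σ ^ 2) := by ring
      rw [this]
      have : 0 ≤ θ * η * σ ^ 2 := by positivity
      nlinarith
    calc _ ≤ ∫⁻ ξ, ENNReal.ofReal (Real.exp (θ * frobSq (W - V) - 3 / 2 * θ * η * r)) *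
          ENNReal.ofReal (Real.exp (∑ i, ((2 * θ * η * σ) • u) i * ξ i +
            2 * θ * η ^ 2 * σ ^ 2 * ∑ i, ξ i ^ 2)) ∂(stdGaussian (State ds)) := by
          refine lintegral_mono fun ξ => ?_
          rw [← ENNReal.ofReal_mul (Real.exp_pos _).le, ← Real.exp_add]
          refine ENNReal.ofReal_le_ofReal (Real.exp_le_exp.2 ?_)
          have h2 := mul_le_mul_of_nonneg_left
            (frobSq_sgdStep_sub_le h1 hF hη hη4 σ W hV y ξ) hθ
          refine h2.trans (le_of_eq ?_)
          have h3 : ∑ i, ((2 * θ * η * σ) • u) i * ξ i =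
              2 * θ * η * σ * ∑ i, ((W - V) *ᵥ (φ y).ofLp) i * ξ i := by
            rw [Finset.mul_sum]
            refine Finset.sum_congr rfl fun i _ => ?_
            simp only [PiLp.smul_apply, smul_eq_mul, hu]
            ring
          rw [h3, ← hr]
          ring
      _ ≤ ENNReal.ofReal (Real.exp (θ * frobSq (W - V) - 3 / 2 * θ * η * r)) *
          ENNReal.ofReal (Real.exp (∑ i, ((2 * θ * η * σ) • u) i ^ 2 +
            2 * (2 * θ * η ^ 2 * σ ^ 2) * ds)) := by
          rw [lintegral_const_mul _ (by fun_prop)]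
          exact mul_le_mul' le_rfl
            (lintegral_exp_quadratic_stdGaussian (by positivity) hb _)
      _ ≤ ENNReal.ofReal (Real.exp a * Real.exp (-(θ * η * r))) := by
          rw [← ENNReal.ofReal_mul (Real.exp_pos _).le, ← Real.exp_add, ← Real.exp_add]
          refine ENNReal.ofReal_le_ofReal (Real.exp_le_exp.2 ?_)
          have h3 : ∑ i, ((2 * θ * η * σ) • u) i ^ 2 = 4 * (θ * η * σ ^ 2) * (θ * η * r) := by
            rw [← hur, Finset.mul_sum, Finset.mul_sum]
            refine Finset.sum_congr rfl fun i _ => ?_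
            simp only [PiLp.smul_apply, smul_eq_mul]
            ring
          rw [h3, ha]
          -- The linear noise term contributes its squared coefficient to the exponent. The bound on
          -- θησ² keeps this below a third of the drift 3θηr/2, so that -θηr survives.
          have h4 : 4 * (θ * η * σ ^ 2) * (θ * η * r) ≤ 1 / 2 * (θ * η * r) :=
            mul_le_mul_of_nonneg_right (by linarith) (by positivity)
          linarith
      _ ≤ _ := by
          refine ENNReal.ofReal_le_ofReal (mul_le_mul_of_nonneg_left ?_ (Real.exp_pos _).le)
          have h5 : θ * η * r ≤ 1 := (mul_le_mul_of_nonneg_left (hrF y) hη0).trans hθF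
          -- Bounding the exponential by an affine function of the residual lets `ν` be integrated;
          -- afterwards 1 - t ≤ exp(-t) restores the exponential. This exchange costs a factor 2,
          -- hence the 1/2 in front of the excess risk.
          refine (exp_neg_le_one_sub_half (by positivity) h5).trans (le_of_eq ?_)
          ring
  refine (lintegral_mono hinner).trans ?_
  have hint := integrable_resid hφ h1 (W - V) ν
  have hint2 : Integrable (fun y => 1 - 1 / 2 * (θ * η) * resid φ (W - V) y) ν :=
    (integrable_const _).sub (hint.const_mul _)
  have hpos : ∀ y, 0 ≤ Real.exp a * (1 - 1 / 2 * (θ * η) * resid φ (W - V) y) := fun y => by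
    refine mul_nonneg (Real.exp_pos _).le ?_
    have := mul_le_mul_of_nonneg_left (hrF y) hη0
    linarith
  rw [← ofReal_integral_eq_lintegral_ofReal (hint2.const_mul _) (ae_of_all _ hpos),
    integral_const_mul, integral_sub (integrable_const _) (hint.const_mul _), integral_const_mul]
  refine ENNReal.ofReal_le_ofReal ?_
  rw [sub_eq_add_neg a, Real.exp_add a]
  refine mul_le_mul_of_nonneg_left ?_ (Real.exp_pos _).le
  have h6 := Real.add_one_le_exp (-(1 / 2 * θ * η * ∫ y, resid φ (W - V) y ∂ν))
  refine le_trans (le_of_eq ?_) h6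
  simp
  ring

end SGD

/-! ### High-probability excess risk of averaged SGD -/

section SGDConcentration

variable {ds d : ℕ} {A : Type*}

theorem specNorm_sgdIter_le (φ : State ds × A → Feat d) {F : ℝ} (hF : 0 ≤ F) (η : ℝ)
    (z : ℕ → (State ds × A) × State ds) (i : ℕ) : specNorm (sgdIter φ F η z i) ≤ F := by
  cases i with
  | zero => rw [sgdIter, specNorm_zero]; exact hF
  | succ i => exact (isBallProj_ballProj hF _).1

theorem specNorm_sgdFit_le (φ : State ds × A → Feat d) {F : ℝ} (hF : 0 ≤ F) (η : ℝ)
    (z : ℕ → (State ds × A) × State ds) (M : ℕ) : specNorm (sgdFit φ F η M z) ≤ F := by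
  have hsum : ∀ k : ℕ, specNorm (∑ i ∈ Finset.range k, sgdIter φ F η z i) ≤ k * F := by
    intro k
    induction k with
    | zero => simp [specNorm_zero]
    | succ k ih =>
      rw [Finset.sum_range_succ]
      refine (specNorm_add_le _ _).trans ?_
      have := specNorm_sgdIter_le φ hF η z k
      push_cast
      linarith
  rw [sgdFit, specNorm_smul, abs_of_nonneg (by positivity)]
  rcases Nat.eq_zero_or_pos M with h0 | hpos
  · simp [h0, hF]
  · have hM : (0 : ℝ) < M := by exact_mod_cast hpos
    rw [inv_mul_le_iff₀ hM]
    exact hsum M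

/-- Convexity of the squared norm, so that a bound on the summed risk of the iterates controls their
average. -/
theorem resid_sgdFit_le (φ : State ds × A → Feat d) {F : ℝ} (η : ℝ) {M : ℕ} (hM : 0 < M)
    (z : ℕ → (State ds × A) × State ds) (V : Matrix (Fin ds) (Fin d) ℝ) (y : State ds × A) :
    resid φ (sgdFit φ F η M z - V) y ≤
      (M : ℝ)⁻¹ * ∑ i ∈ Finset.range M, resid φ (sgdIter φ F η z i - V) y := by
  have hM0 : (0 : ℝ) < M := by exact_mod_cast hM
  have h1 : sgdFit φ F η M z - V =
      (M : ℝ)⁻¹ • ∑ i ∈ Finset.range M, (sgdIter φ F η z i - V) := by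
    rw [sgdFit, Finset.sum_sub_distrib, smul_sub]
    congr 1
    rw [Finset.sum_const, Finset.card_range, ← Nat.cast_smul_eq_nsmul ℝ, smul_smul,
      inv_mul_cancel₀ hM0.ne', one_smul]
  have h2 : ‖Matrix.toEuclideanLin (sgdFit φ F η M z - V) (φ y)‖ ≤
      (M : ℝ)⁻¹ * ∑ i ∈ Finset.range M,
        ‖Matrix.toEuclideanLin (sgdIter φ F η z i - V) (φ y)‖ := by
    rw [h1, map_smul, map_sum, LinearMap.smul_apply, LinearMap.sum_apply, norm_smul,
      Real.norm_of_nonneg (by positivity)]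
    exact mul_le_mul_of_nonneg_left (norm_sum_le _ _) (by positivity)
  unfold resid
  refine (pow_le_pow_left₀ (norm_nonneg _) h2 2).trans ?_
  rw [mul_pow]
  have h3 := sq_sum_le_card_mul_sum_sq (s := Finset.range M)
    (f := fun i => ‖Matrix.toEuclideanLin (sgdIter φ F η z i - V) (φ y)‖)
  rw [Finset.card_range] at h3
  calc _ ≤ ((M : ℝ)⁻¹) ^ 2 * (M * ∑ i ∈ Finset.range M,
        ‖Matrix.toEuclideanLin (sgdIter φ F η z i - V) (φ y)‖ ^ 2) :=
        mul_le_mul_of_nonneg_left h3 (by positivity)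
    _ = _ := by field_simp

theorem continuous_residCov : Continuous fun q : Matrix (Fin ds) (Fin d) ℝ ×
    Matrix (Fin d) (Fin d) ℝ => residCov q.1 q.2 := by
  have h1 : ∀ i j, Continuous fun q : Matrix (Fin ds) (Fin d) ℝ ×
    Matrix (Fin d) (Fin d) ℝ => q.1 i j := fun i j =>
      (continuous_apply_apply i j).comp continuous_fst
  have h2 : ∀ i j, Continuous fun q : Matrix (Fin ds) (Fin d) ℝ ×
    Matrix (Fin d) (Fin d) ℝ => q.2 i j := fun i j =>
      (continuous_apply_apply i j).comp continuous_snd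
  simp only [residCov, dotProduct, Matrix.mulVec]
  exact continuous_finsetSum _ fun i _ => continuous_finsetSum _ fun j _ =>
    (h1 i j).mul (continuous_finsetSum _ fun k _ => (h2 j k).mul (h1 i k))

theorem measurable_residCov {Ω : Type*} {mΩ : MeasurableSpace Ω}
    {D : Ω → Matrix (Fin ds) (Fin d) ℝ} {C : Ω → Matrix (Fin d) (Fin d) ℝ} (hD : Measurable D)
    (hC : Measurable C) : Measurable fun ω => residCov (D ω) (C ω) := by
  exact continuous_residCov.measurable.comp (hD.prodMk hC)

variable [MeasurableSpace A]

theorem measurable_sgdIter {φ : State ds × A → Feat d} (hφ : Measurable φ) {F : ℝ} (hF : 0 ≤ F)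
    (η : ℝ) {Ω : Type*} {mΩ : MeasurableSpace Ω} (ℱ : Filtration ℕ mΩ) (a M : ℕ)
    {z : ℕ → Ω → (State ds × A) × State ds} (hz : ∀ m < M, Measurable[ℱ (a + m + 1)] (z m)) :
    ∀ i ≤ M, Measurable[ℱ (a + i)] fun ω => sgdIter φ F η (fun m => z m ω) i := by
  intro i
  induction i with
  | zero => intro _; exact measurable_const
  | succ i ih =>
    intro hi
    have h2 : Measurable[ℱ (a + (i + 1))] fun ω =>
        (sgdIter φ F η (fun m => z m ω) i, z i ω) :=
      ((ih (by omega)).mono (ℱ.mono (by omega)) le_rfl).prodMk (hz i (by omega))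
    have h3 := (measurable_sgdStep hφ hF η).comp h2
    exact h3

theorem measurable_sub_const_matrix {Ω : Type*} {mΩ : MeasurableSpace Ω} {m n : ℕ}
    {f : Ω → Matrix (Fin m) (Fin n) ℝ} (hf : Measurable f) (V : Matrix (Fin m) (Fin n) ℝ) :
    Measurable fun ω => f ω - V :=
  measurable_matrix_of fun i j => ((measurable_matrix_apply i j).comp hf).sub_const (V i j)

theorem measurable_sgd_potential {φ : State ds × A → Feat d} (hφ : Measurable φ) {F : ℝ}
    (hF : 0 ≤ F) (η θ c : ℝ) (V : Matrix (Fin ds) (Fin d) ℝ) :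
    Measurable fun p : ((Matrix (Fin ds) (Fin d) ℝ × ℝ) ×
      Matrix (Fin d) (Fin d) ℝ) × ((State ds × A) × State ds) =>
        ENNReal.ofReal (Real.exp (θ * frobSq (sgdStep φ F η p.1.1.1 p.2 - V) +
          c * (p.1.1.2 + residCov (p.1.1.1 - V) p.1.2))) := by
  have hW : Measurable fun p : ((Matrix (Fin ds) (Fin d) ℝ × ℝ) ×
      Matrix (Fin d) (Fin d) ℝ) × ((State ds × A) × State ds) => p.1.1.1 :=
    measurable_fst.comp (measurable_fst.comp measurable_fst)
  have h2 := continuous_frobSq.measurable.comp (measurable_sub_const_matrix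
    ((measurable_sgdStep hφ hF η).comp (hW.prodMk measurable_snd)) V)
  have h5 := measurable_residCov (measurable_sub_const_matrix hW V)
    (measurable_snd.comp measurable_fst)
  have h6 : Measurable fun p : ((Matrix (Fin ds) (Fin d) ℝ × ℝ) ×
      Matrix (Fin d) (Fin d) ℝ) × ((State ds × A) × State ds) => p.1.1.2 :=
    measurable_snd.comp (measurable_fst.comp measurable_fst)
  exact (((h2.const_mul θ).add ((h6.add h5).const_mul c)).exp).ennreal_ofReal

/-- The exponential deviation bound for the cumulative excess risk of the SGD iterates. -/
theorem sgdIter_concentration {φ : State ds × A → Feat d} (hφ : Measurable φ)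
    (h1 : ∀ y, ‖φ y‖ ≤ 1) {F : ℝ} (hF : 0 ≤ F) {η σ θ : ℝ} (hη : 0 ≤ η) (hη4 : η ≤ 1 / 4)
    (hσ : 0 ≤ σ) (hθ : 0 ≤ θ) (hθσ : θ * η * σ ^ 2 ≤ 1 / 8) (hθF : θ * η * (4 * F ^ 2) ≤ 1)
    {V : Matrix (Fin ds) (Fin d) ℝ} (hV : specNorm V ≤ F)
    {Ω : Type*} {mΩ : MeasurableSpace Ω} {μ : Measure Ω} [IsProbabilityMeasure μ]
    (ℱ : Filtration ℕ mΩ) (a M : ℕ) (hM : 0 < M) (z : ℕ → Ω → (State ds × A) × State ds)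
    (κ : Ω → Measure (State ds × A)) [∀ ω, IsProbabilityMeasure (κ ω)]
    (hz : ∀ m < M, Measurable[ℱ (a + m + 1)] (z m))
    (hlaw : ∀ m < M, ∀ B, MeasurableSet B →
      μ⟦z m ⁻¹' B | ℱ (a + m)⟧ =ᵐ[μ] fun ω => (κ ω ⊗ₘ dynamics φ hφ σ V).real B) (L : ℝ) :
    μ {ω | θ * frobSq V + M * (4 * θ * η ^ 2 * σ ^ 2 * ds) + L ≤ 1 / 2 * θ * η *
        ∑ i ∈ Finset.range M, ∫ y, resid φ (sgdIter φ F η (fun m => z m ω) i - V) y ∂(κ ω)} ≤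
      ENNReal.ofReal (Real.exp (-L)) := by
  -- The excess risk of an iterate depends on the sampling law only through its feature covariance.
  -- Finitely many entries suffice, each with a version known at time `a`, and these are assembled
  -- into the matrix `C`.
  have hver : ∀ i j, ∃ g : Ω → ℝ, Measurable[ℱ a] g ∧ (fun ω => featCov φ (κ ω) i j) =ᵐ[μ] g := by
    intro i j
    obtain ⟨g, hg, hge⟩ := condLaw_integral_version (m := ℱ a) (z := z 0)
      (fun B hB => hlaw 0 hM B hB) (f := fun p => φ p.1 i * φ p.1 j) (by fun_prop) (b := 1)
      fun p => by
        rw [abs_mul]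
        exact mul_le_one₀ (abs_feat_le h1 p.1 i) (abs_nonneg _) (abs_feat_le h1 p.1 j)
    refine ⟨g, hg, ?_⟩
    filter_upwards [hge] with ω hω
    rw [← hω]
    have h2 : featCov φ (κ ω) i j = ∫ x, φ x i * φ x j ∂((κ ω ⊗ₘ dynamics φ hφ σ V).fst) := by
      rw [Measure.fst_compProd]; rfl
    rw [h2, Measure.fst, integral_map measurable_fst.aemeasurable (by fun_prop)]
  choose g hg hgeq using hver
  let C : Ω → Matrix (Fin d) (Fin d) ℝ := fun ω => Matrix.of fun i j => g i j ω
  have hC : Measurable[ℱ a] C := measurable_matrix_of fun i j => hg i j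
  have hCeq : ∀ᵐ ω ∂μ, featCov φ (κ ω) = C ω := by
    filter_upwards [ae_all_iff.2 fun i => ae_all_iff.2 (hgeq i)] with ω hω
    ext i j
    exact hω i j
  let W : ℕ → Ω → Matrix (Fin ds) (Fin d) ℝ := fun i ω => sgdIter φ F η (fun m => z m ω) i
  have hWs : ∀ i ω, W (i + 1) ω = sgdStep φ F η (W i ω) (z i ω) := fun i ω => rfl
  have hW : ∀ i ≤ M, Measurable[ℱ (a + i)] (W i) := measurable_sgdIter hφ hF η ℱ a M hz
  let T : ℕ → Ω → ℝ := fun i ω => ∑ j ∈ Finset.range i, residCov (W j ω - V) (C ω)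
  have hT : ∀ i ≤ M, Measurable[ℱ (a + i)] (T i) := by
    intro i hi
    refine Finset.measurable_sum _ fun j hj => ?_
    have hj' := Finset.mem_range.1 hj
    exact measurable_residCov (measurable_sub_const_matrix
      ((hW j (by omega)).mono (ℱ.mono (by omega)) le_rfl) V)
      (hC.mono (ℱ.mono (by omega)) le_rfl)
  set e := 4 * θ * η ^ 2 * σ ^ 2 * ds with he
  -- Each step lowers the expected potential by the excess risk, which is accumulated in `T`, and
  -- raises it by at most the deterministic amount `e`. At the start W⁰ = 0, so the potential is
  -- θ‖V‖².
  have hmgf : ∀ i ≤ M, ∫⁻ ω, ENNReal.ofReal (Real.exp (θ * frobSq (W i ω - V) +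
      1 / 2 * θ * η * T i ω)) ∂μ ≤ ENNReal.ofReal (Real.exp (θ * frobSq V + i * e)) := by
    intro i
    induction i with
    | zero =>
      intro _
      have : frobSq (-V) = frobSq V := by simp [frobSq]
      simp [W, T, sgdIter, this]
    | succ i ih =>
      intro hi
      have hU : Measurable[ℱ (a + i)] fun ω => ((W i ω, T i ω), C ω) :=
        ((hW i (by omega)).prodMk (hT i (by omega))).prodMk (hC.mono (ℱ.mono (by omega)) le_rfl)
      have hGm := measurable_sgd_potential hφ hF η θ (1 / 2 * θ * η) V
      have hstep := (condLaw_lintegral (ℱ.le _) ((hz i (by omega)).mono (ℱ.le _) le_rfl)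
        (hlaw i (by omega)) hU hGm).2
      calc _ = ∫⁻ ω, ENNReal.ofReal (Real.exp (θ * frobSq (sgdStep φ F η (W i ω) (z i ω) - V) +
            1 / 2 * θ * η * (T i ω + residCov (W i ω - V) (C ω)))) ∂μ := by
            simp only [T, Finset.sum_range_succ, hWs]
        _ = ∫⁻ ω, ∫⁻ p, ENNReal.ofReal (Real.exp (θ * frobSq (sgdStep φ F η (W i ω) p - V) +
            1 / 2 * θ * η * (T i ω + residCov (W i ω - V) (C ω))))
              ∂(κ ω ⊗ₘ dynamics φ hφ σ V) ∂μ := hstep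
        _ ≤ ∫⁻ ω, ENNReal.ofReal (Real.exp e) * ENNReal.ofReal (Real.exp
            (θ * frobSq (W i ω - V) + 1 / 2 * θ * η * T i ω)) ∂μ := by
            refine lintegral_mono_ae ?_
            filter_upwards [hCeq] with ω hω
            have h6 := lintegral_exp_sgdStep_le hφ h1 hF hη hη4 hσ hθ hθσ hθF
              (specNorm_sgdIter_le φ hF η (fun m => z m ω) i) hV (κ ω)
            rw [integral_resid hφ h1, hω] at h6
            simp_rw [Real.exp_add, ENNReal.ofReal_mul (Real.exp_pos _).le]
            rw [lintegral_mul_const' _ _ ENNReal.ofReal_ne_top]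
            refine (mul_le_mul' h6 le_rfl).trans ?_
            rw [← ENNReal.ofReal_mul (Real.exp_pos _).le, ← ENNReal.ofReal_mul (Real.exp_pos _).le,
              ← ENNReal.ofReal_mul (Real.exp_pos _).le, ← Real.exp_add, ← Real.exp_add,
              ← Real.exp_add]
            refine ENNReal.ofReal_le_ofReal (Real.exp_le_exp.2 (le_of_eq ?_))
            simp only [W, he]
            ring
        _ = ENNReal.ofReal (Real.exp e) * ∫⁻ ω, ENNReal.ofReal (Real.exp
            (θ * frobSq (W i ω - V) + 1 / 2 * θ * η * T i ω)) ∂μ :=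
            lintegral_const_mul' _ _ ENNReal.ofReal_ne_top
        _ ≤ ENNReal.ofReal (Real.exp e) *
            ENNReal.ofReal (Real.exp (θ * frobSq V + i * e)) := mul_le_mul' le_rfl (ih (by omega))
        _ = _ := by
            rw [← ENNReal.ofReal_mul (Real.exp_pos _).le, ← Real.exp_add]
            congr 2
            push_cast
            ring
  have hfin := hmgf M le_rfl
  have hWm : Measurable fun ω => frobSq (W M ω - V) :=
    continuous_frobSq.measurable.comp (measurable_sub_const_matrix
      ((hW M le_rfl).mono (ℱ.le _) le_rfl) V)
  have hTm : Measurable (T M) := (hT M le_rfl).mono (ℱ.le _) le_rfl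
  have hmeas : Measurable fun ω => ENNReal.ofReal (Real.exp (θ * frobSq (W M ω - V) +
      1 / 2 * θ * η * T M ω)) := by fun_prop
  have hmarkov := mul_meas_ge_le_lintegral (μ := μ) hmeas
    (ENNReal.ofReal (Real.exp (θ * frobSq V + M * e + L)))
  refine (measure_mono_ae (t := {ω | ENNReal.ofReal (Real.exp (θ * frobSq V + M * e + L)) ≤
    ENNReal.ofReal (Real.exp (θ * frobSq (W M ω - V) + 1 / 2 * θ * η * T M ω))}) ?_).trans ?_
  · filter_upwards [hCeq] with ω hω hmem
    have hmem' : θ * frobSq V + M * e + L ≤ 1 / 2 * θ * η * T M ω := by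
      refine le_trans (show _ ≤ _ from hmem) (le_of_eq ?_)
      simp only [T, integral_resid hφ h1, hω, W]
    refine ENNReal.ofReal_le_ofReal (Real.exp_le_exp.2 ?_)
    -- The final distance to V is nonnegative, so dropping it only lowers the exponent that Markov's
    -- inequality controls.
    have := mul_nonneg hθ (frobSq_nonneg (W M ω - V))
    linarith
  · have h5 : Real.exp (-L) = Real.exp (θ * frobSq V + M * e) /
        Real.exp (θ * frobSq V + M * e + L) := by
      rw [← Real.exp_sub]; ring_nf
    rw [h5, ENNReal.ofReal_div_of_pos (Real.exp_pos _), ENNReal.le_div_iff_mul_le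
      (Or.inl (ENNReal.ofReal_pos.2 (Real.exp_pos _)).ne') (Or.inl ENNReal.ofReal_ne_top),
      mul_comm]
    exact hmarkov.trans hfin

/-- High-probability excess risk bound for averaged projected SGD. -/
theorem sgdFit_concentration {φ : State ds × A → Feat d} (hφ : Measurable φ)
    (h1 : ∀ y, ‖φ y‖ ≤ 1) {F : ℝ} (hF : 0 ≤ F) {η σ θ : ℝ} (hη : 0 < η) (hη4 : η ≤ 1 / 4)
    (hσ : 0 ≤ σ) (hθ : 0 < θ) (hθσ : θ * η * σ ^ 2 ≤ 1 / 8) (hθF : θ * η * (4 * F ^ 2) ≤ 1)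
    {V : Matrix (Fin ds) (Fin d) ℝ} (hV : specNorm V ≤ F)
    {Ω : Type*} {mΩ : MeasurableSpace Ω} {μ : Measure Ω} [IsProbabilityMeasure μ]
    (ℱ : Filtration ℕ mΩ) (a M : ℕ) (hM : 0 < M) (z : ℕ → Ω → (State ds × A) × State ds)
    (κ : Ω → Measure (State ds × A)) [∀ ω, IsProbabilityMeasure (κ ω)]
    (hz : ∀ m < M, Measurable[ℱ (a + m + 1)] (z m))
    (hlaw : ∀ m < M, ∀ B, MeasurableSet B →
      μ⟦z m ⁻¹' B | ℱ (a + m)⟧ =ᵐ[μ] fun ω => (κ ω ⊗ₘ dynamics φ hφ σ V).real B) (L : ℝ) :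
    μ {ω | 2 * (ds * F ^ 2) / (η * M) + 8 * η * σ ^ 2 * ds + 2 * L / (θ * η * M) <
        ∫ y, resid φ (sgdFit φ F η M (fun m => z m ω) - V) y ∂(κ ω)} ≤
      ENNReal.ofReal (Real.exp (-L)) := by
  refine (measure_mono fun ω hω => ?_).trans
    (sgdIter_concentration hφ h1 hF hη.le hη4 hσ hθ.le hθσ hθF hV ℱ a M hM z κ hz hlaw L)
  have hM0 : (0 : ℝ) < M := by exact_mod_cast hM
  have hω' : 2 * (ds * F ^ 2) / (η * M) + 8 * η * σ ^ 2 * ds + 2 * L / (θ * η * M) <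
    ∫ y, resid φ (sgdFit φ F η M (fun m => z m ω) - V) y ∂(κ ω) := hω
  have hsum : Integrable (fun y => ∑ i ∈ Finset.range M,
      resid φ (sgdIter φ F η (fun m => z m ω) i - V) y) (κ ω) :=
    integrable_finsetSum _ fun i _ => integrable_resid hφ h1 _ _
  have h2 := integral_mono (integrable_resid hφ h1 (sgdFit φ F η M (fun m => z m ω) - V) (κ ω))
    (hsum.const_mul (M : ℝ)⁻¹) fun y => resid_sgdFit_le φ η hM _ V y
  rw [integral_const_mul, integral_finsetSum _ fun i _ => integrable_resid hφ h1 _ _] at h2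
  set S := ∑ i ∈ Finset.range M, ∫ y, resid φ (sgdIter φ F η (fun m => z m ω) i - V) y ∂(κ ω)
  change θ * frobSq V + M * (4 * θ * η ^ 2 * σ ^ 2 * ds) + L ≤ 1 / 2 * θ * η * S
  have h3 := hω'.le.trans h2
  have h4 : frobSq V ≤ ds * F ^ 2 := (frobSq_le V).trans
    (mul_le_mul_of_nonneg_left (pow_le_pow_left₀ (specNorm_nonneg V) hV 2) (by positivity))
  have h5 := mul_le_mul_of_nonneg_left h3 (by positivity : (0 : ℝ) ≤ 1 / 2 * θ * η * M)
  -- The threshold in the statement is the exponential threshold divided by θηM/2, with ‖V‖² in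
  -- Frobenius norm replaced by its bound d_s F².
  have h6 : 1 / 2 * θ * η * M * (2 * (ds * F ^ 2) / (η * M) + 8 * η * σ ^ 2 * ds +
      2 * L / (θ * η * M)) = θ * (ds * F ^ 2) + M * (4 * θ * η ^ 2 * σ ^ 2 * ds) + L := by
    field_simp
    ring
  have h7 : 1 / 2 * θ * η * M * ((M : ℝ)⁻¹ * S) = 1 / 2 * θ * η * S := by field_simp
  rw [h6, h7] at h5
  have h8 := mul_le_mul_of_nonneg_left h4 hθ.le
  linarith

end SGDConcentration

/-! ### Uniform mixtures of measures -/

section Mixtures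

variable {X : Type*} [MeasurableSpace X]

theorem isProbabilityMeasure_mixture {n : ℕ} (hn : 0 < n) (ν : ℕ → Measure X)
    [∀ i, IsProbabilityMeasure (ν i)] :
    IsProbabilityMeasure ((n : ℝ≥0∞)⁻¹ • ∑ i ∈ Finset.range n, ν i) := by
  refine ⟨?_⟩
  have h0 : (n : ℝ≥0∞) ≠ 0 := by exact_mod_cast hn.ne'
  simp [ENNReal.inv_mul_cancel h0 (ENNReal.natCast_ne_top n)]

theorem integral_mixture {n : ℕ} (ν : ℕ → Measure X) {f : X → ℝ}
    (hf : ∀ i < n, Integrable f (ν i)) :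
    ∫ x, f x ∂((n : ℝ≥0∞)⁻¹ • ∑ i ∈ Finset.range n, ν i) =
      (n : ℝ)⁻¹ * ∑ i ∈ Finset.range n, ∫ x, f x ∂(ν i) := by
  rw [integral_smul_measure, integral_finsetSum_measure fun i hi => hf i (Finset.mem_range.1 hi)]
  simp

end Mixtures

/-! ### Occupancy measures and values -/

section Occupancy

variable {ds d : ℕ} {A : Type*} [MeasurableSpace A]

theorem isProbabilityMeasure_avgDist {H : ℕ} (hH : 0 < H)
    (P : Kernel (State ds × A) (State ds)) [IsMarkovKernel P] (s₀ : State ds) (π : Policy ds A) :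
    IsProbabilityMeasure (avgDist H P s₀ π) :=
  isProbabilityMeasure_mixture hH _

theorem isProbabilityMeasure_coverDist {H : ℕ} (hH : 0 < H)
    (P : Kernel (State ds × A) (State ds)) [IsMarkovKernel P] (s₀ : State ds)
    (π : ℕ → Policy ds A) (n : ℕ) : IsProbabilityMeasure (coverDist H P s₀ π n) :=
  have := fun i => isProbabilityMeasure_avgDist hH P s₀ (π i)
  isProbabilityMeasure_mixture (Nat.succ_pos n) _

theorem value_eq_mul_integral_avgDist {H : ℕ} (hH : 0 < H)
    (P : Kernel (State ds × A) (State ds)) [IsMarkovKernel P] (s₀ : State ds) (π : Policy ds A)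
    {f : State ds × A → ℝ} (hf : Measurable f) {b : ℝ} (hb : ∀ x, 0 ≤ f x ∧ f x ≤ b) :
    value H P s₀ f π = H * ∫ x, f x ∂(avgDist H P s₀ π) := by
  have hH0 : (H : ℝ) ≠ 0 := by exact_mod_cast hH.ne'
  rw [avgDist, integral_mixture _ fun i _ => integrable_of_bounded _ hf hb, value]
  field_simp

theorem sum_integral_avgDist_eq {H : ℕ} (hH : 0 < H)
    (P : Kernel (State ds × A) (State ds)) [IsMarkovKernel P] (s₀ : State ds)
    (π : ℕ → Policy ds A) (n : ℕ) {f : State ds × A → ℝ} (hf : Measurable f) {b : ℝ}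
    (hb : ∀ x, 0 ≤ f x ∧ f x ≤ b) :
    ∑ i ∈ Finset.range (n + 1), ∫ x, f x ∂(avgDist H P s₀ (π i)) =
      (n + 1 : ℕ) * ∫ x, f x ∂(coverDist H P s₀ π n) := by
  have := fun i => isProbabilityMeasure_avgDist hH P s₀ (π i)
  have hn0 : ((n + 1 : ℕ) : ℝ) ≠ 0 := by positivity
  rw [coverDist, integral_mixture _ fun i _ => integrable_of_bounded _ hf hb]
  field_simp

end Occupancy

/-! ### Covariances as vectors of products -/

section Covariance

variable {d : ℕ} {X : Type*}

/-- The vector of the products `v i * v j`. -/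
noncomputable def outerVec (v : Fin d → ℝ) : EuclideanSpace ℝ (Fin d × Fin d) :=
  WithLp.toLp 2 fun p => v p.1 * v p.2

theorem inner_outerVec (v w : Fin d → ℝ) : inner ℝ (outerVec v) (outerVec w) = (v ⬝ᵥ w) ^ 2 := by
  simp only [outerVec, PiLp.inner_apply, dotProduct, sq, Finset.sum_mul_sum, Fintype.sum_prod_type]
  refine Finset.sum_congr rfl fun i _ => Finset.sum_congr rfl fun j _ => ?_
  simp
  ring

theorem norm_outerVec (v : Fin d → ℝ) : ‖outerVec v‖ = v ⬝ᵥ v := by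
  have h0 : 0 ≤ v ⬝ᵥ v := by simpa using dotProduct_star_self_nonneg v
  rw [← sq_eq_sq₀ (norm_nonneg _) h0, ← real_inner_self_eq_norm_sq, inner_outerVec]

theorem norm_outerVec_feat_le {φ : X → Feat d} (h1 : ∀ y, ‖φ y‖ ≤ 1) (y : X) :
    ‖outerVec (φ y).ofLp‖ ≤ 1 := by
  rw [norm_outerVec, dotProduct_feat_self]
  exact pow_le_one₀ (norm_nonneg _) (h1 y)

variable [MeasurableSpace X]

theorem measurable_outerVec_feat {φ : X → Feat d} (hφ : Measurable φ) :
    Measurable fun y => outerVec (φ y).ofLp :=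
  measurable_toLp_of fun p => by fun_prop

/-- The square (v ⬝ᵥ w)² is the inner product of the outer products of v and w, so the error of the
quadratic form is a linear functional of the vector error. One norm bound thus serves all v
simultaneously, without a covering argument. -/
theorem abs_sum_sq_sub_le {φ : X → Feat d} (hφ : Measurable φ) (h1 : ∀ y, ‖φ y‖ ≤ 1)
    (ν : Measure X) [IsFiniteMeasure ν] (K : ℕ) (x : ℕ → X) {t : ℝ}
    (h : ‖∑ k ∈ Finset.range K, (outerVec (φ (x k)).ofLp -
      vecMean (fun y => outerVec (φ y).ofLp) ν)‖ ≤ t) (v : Fin d → ℝ) :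
    |∑ k ∈ Finset.range K, (v ⬝ᵥ (φ (x k)).ofLp) ^ 2 - K * (v ⬝ᵥ (featCov φ ν *ᵥ v))| ≤
      t * (v ⬝ᵥ v) := by
  have h2 := (integral_inner_eq (measurable_outerVec_feat hφ) (norm_outerVec_feat_le h1) ν
    (outerVec v)).2
  simp_rw [inner_outerVec] at h2
  rw [← quadForm_featCov hφ h1] at h2
  have h3 := (abs_real_inner_le_norm (outerVec v) (∑ k ∈ Finset.range K,
    (outerVec (φ (x k)).ofLp - vecMean (fun y => outerVec (φ y).ofLp) ν))).trans
      (mul_le_mul_of_nonneg_left h (norm_nonneg _))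
  rw [inner_sum, norm_outerVec, mul_comm _ t] at h3
  simp only [inner_sub_right, inner_outerVec, ← h2] at h3
  rw [Finset.sum_sub_distrib] at h3
  simpa using h3

end Covariance

/-! ### Empirical versus expected regularized covariance -/

section EmpiricalCovariance

variable {ds d : ℕ} {A : Type*}

theorem quadForm_empCov (φ : State ds × A → Feat d) (K : ℕ) (x : ℕ → ℕ → State ds × A) (n : ℕ)
    (v : Fin d → ℝ) : v ⬝ᵥ (empCov φ 1 K x n *ᵥ v) = v ⬝ᵥ v + ∑ i ∈ Finset.range (n + 1),
      (K : ℝ)⁻¹ * ∑ k ∈ Finset.range K, (v ⬝ᵥ (φ (x i k)).ofLp) ^ 2 := by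
  rw [empCov, one_smul, Matrix.add_mulVec, dotProduct_add, Matrix.one_mulVec, Matrix.sum_mulVec,
    dotProduct_sum]
  congr 1
  refine Finset.sum_congr rfl fun i _ => ?_
  rw [Matrix.smul_mulVec, dotProduct_smul, Matrix.sum_mulVec, dotProduct_sum, smul_eq_mul]
  congr 1
  refine Finset.sum_congr rfl fun k _ => ?_
  rw [Matrix.vecMulVec_mulVec, dotProduct_smul]
  rw [dotProduct_comm (φ (x i k)).ofLp v]
  simp [sq]

theorem empCov_posDef (φ : State ds × A → Feat d) (K : ℕ) (x : ℕ → ℕ → State ds × A) (n : ℕ) :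
    (empCov φ 1 K x n).PosDef := by
  rw [empCov, one_smul]
  refine Matrix.PosDef.one.add_posSemidef (Matrix.posSemidef_sum _ fun i _ => ?_)
  refine Matrix.PosSemidef.smul (Matrix.posSemidef_sum _ fun k _ => ?_) (by positivity)
  simpa using Matrix.posSemidef_vecMulVec_self_star (φ (x i k)).ofLp

variable [MeasurableSpace A]

/-- The regularized empirical covariance is equivalent to its expectation, up to constants. -/
theorem quadForm_empCov_bounds {φ : State ds × A → Feat d} (hφ : Measurable φ)
    (h1 : ∀ y, ‖φ y‖ ≤ 1) (ν : ℕ → Measure (State ds × A)) [∀ i, IsProbabilityMeasure (ν i)]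
    {N K : ℕ} (hK : 0 < K) (x : ℕ → ℕ → State ds × A)
    (h : ∀ n < N, ‖∑ k ∈ Finset.range K, (outerVec (φ (x n k)).ofLp -
      vecMean (fun y => outerVec (φ y).ofLp) (ν n))‖ ≤ 3 * K / (4 * N)) {n : ℕ} (hn : n < N)
    (v : Fin d → ℝ) :
    v ⬝ᵥ (empCov φ 1 K x n *ᵥ v) ≤ 2 * (v ⬝ᵥ (regCov φ ν (n + 1) *ᵥ v)) ∧
      v ⬝ᵥ (regCov φ ν (n + 1) *ᵥ v) ≤ 4 * (v ⬝ᵥ (empCov φ 1 K x n *ᵥ v)) := by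
  have hK0 : (0 : ℝ) < K := by exact_mod_cast hK
  have hN0 : (0 : ℝ) < N := by exact_mod_cast (by omega : 0 < N)
  have h0 : 0 ≤ v ⬝ᵥ v := by simpa using dotProduct_star_self_nonneg v
  have h2 : ∀ i ∈ Finset.range (n + 1), |(K : ℝ)⁻¹ * ∑ k ∈ Finset.range K,
      (v ⬝ᵥ (φ (x i k)).ofLp) ^ 2 - v ⬝ᵥ (featCov φ (ν i) *ᵥ v)| ≤ 3 / (4 * N) * (v ⬝ᵥ v) := by
    intro i hi
    have hi' := Finset.mem_range.1 hi
    have h3 := abs_sum_sq_sub_le hφ h1 (ν i) K (x i) (h i (by omega)) v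
    have h4 := mul_le_mul_of_nonneg_left h3 (inv_nonneg.2 hK0.le)
    rw [← abs_of_pos (inv_pos.2 hK0), ← abs_mul, abs_of_pos (inv_pos.2 hK0), mul_sub,
      inv_mul_cancel_left₀ hK0.ne'] at h4
    refine h4.trans (le_of_eq ?_)
    field_simp
  -- At most N rounds contribute 3/(4N) each, so the total error is at most 3/4 of the identity,
  -- which is part of both matrices. The constants 2 and 4 of the statement leave slack.
  have h5 : |∑ i ∈ Finset.range (n + 1), ((K : ℝ)⁻¹ * ∑ k ∈ Finset.range K,
      (v ⬝ᵥ (φ (x i k)).ofLp) ^ 2 - v ⬝ᵥ (featCov φ (ν i) *ᵥ v))| ≤ 3 / 4 * (v ⬝ᵥ v) := by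
    refine (Finset.abs_sum_le_sum_abs _ _).trans ((Finset.sum_le_sum h2).trans ?_)
    rw [Finset.sum_const, Finset.card_range, nsmul_eq_mul, ← mul_assoc]
    refine mul_le_mul_of_nonneg_right ?_ h0
    have : ((n + 1 : ℕ) : ℝ) ≤ N := by exact_mod_cast hn
    rw [mul_div_assoc', div_le_iff₀ (by positivity)]
    linarith
  rw [Finset.sum_sub_distrib] at h5
  have h6 := quadForm_empCov φ K x n v
  have h7 := quadForm_regCov (φ := φ) ν (n + 1) v
  have h8 := dotProduct_self_le_quadForm_regCov hφ h1 ν (n + 1) v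
  have h9 : v ⬝ᵥ v ≤ v ⬝ᵥ (empCov φ 1 K x n *ᵥ v) := by
    rw [h6]
    have : 0 ≤ ∑ i ∈ Finset.range (n + 1), (K : ℝ)⁻¹ *
        ∑ k ∈ Finset.range K, (v ⬝ᵥ (φ (x i k)).ofLp) ^ 2 :=
      Finset.sum_nonneg fun i _ => mul_nonneg (inv_nonneg.2 hK0.le)
        (Finset.sum_nonneg fun k _ => sq_nonneg _)
    linarith
  rw [abs_le] at h5
  constructor <;> linarith [h5.1, h5.2]

end EmpiricalCovariance

/-! ### Bonus, model error and optimism -/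

section Regret

variable {ds d : ℕ} {A : Type*}

theorem bonus_bounds (φ : State ds × A → Feat d) {c : ℝ} (hc : 0 ≤ c) (H : ℕ)
    (S : Matrix (Fin d) (Fin d) ℝ) (y : State ds × A) :
    0 ≤ bonus φ c H S y ∧ bonus φ c H S y ≤ 2 * H := by
  unfold bonus
  refine ⟨by positivity, ?_⟩
  have := min_le_right (c * √(1 / 2 * ((φ y).ofLp ⬝ᵥ (S⁻¹ *ᵥ (φ y).ofLp)))) (H : ℝ)
  linarith

/-- Cauchy–Schwarz for `S` and its dual, applied to each row of `D`. -/
theorem resid_le_residCov_mul (φ : State ds × A → Feat d) {S : Matrix (Fin d) (Fin d) ℝ}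
    (hS : S.PosDef) (D : Matrix (Fin ds) (Fin d) ℝ) (y : State ds × A) :
    resid φ D y ≤ residCov D S * ((φ y).ofLp ⬝ᵥ (S⁻¹ *ᵥ (φ y).ofLp)) := by
  rw [resid_eq, residCov, Finset.sum_mul]
  exact Finset.sum_le_sum fun i _ => dotProduct_sq_le hS (D i) (φ y).ofLp

variable [MeasurableSpace A]

theorem measurable_quadForm_feat {φ : State ds × A → Feat d} (hφ : Measurable φ)
    (S : Matrix (Fin d) (Fin d) ℝ) : Measurable fun y => (φ y).ofLp ⬝ᵥ (S *ᵥ (φ y).ofLp) := by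
  simp_rw [quadForm_feat_eq]
  fun_prop

theorem measurable_bonus {φ : State ds × A → Feat d} (hφ : Measurable φ) (c : ℝ) (H : ℕ)
    (S : Matrix (Fin d) (Fin d) ℝ) : Measurable (bonus φ c H S) := by
  have h := measurable_quadForm_feat hφ S⁻¹
  unfold bonus
  fun_prop

/-- The identity in `regCov` yields the Frobenius norm and each covariance yields an expected
squared residual. This converts a prediction error under past policies into an ellipsoidal bound on
the parameter error. -/
theorem residCov_regCov {φ : State ds × A → Feat d} (hφ : Measurable φ) (h1 : ∀ y, ‖φ y‖ ≤ 1)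
    (ν : ℕ → Measure (State ds × A)) [∀ i, IsProbabilityMeasure (ν i)] (n : ℕ)
    (D : Matrix (Fin ds) (Fin d) ℝ) :
    residCov D (regCov φ ν n) = frobSq D + ∑ i ∈ Finset.range n, ∫ y, resid φ D y ∂(ν i) := by
  simp_rw [integral_resid hφ h1, residCov, quadForm_regCov]
  rw [Finset.sum_add_distrib, Finset.sum_comm]
  congr 1
  simp [frobSq, dotProduct, sq]

/-- The one-step model error of a fitted parameter, tested on a bounded function. -/
theorem abs_integral_dynamics_sub_le {φ : State ds × A → Feat d} (hφ : Measurable φ) {σ : ℝ}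
    (hσ : 0 < σ) (W V : Matrix (Fin ds) (Fin d) ℝ) (y : State ds × A) {f : State ds → ℝ}
    (hf : Measurable f) {R : ℝ} (hR : ∀ s, 0 ≤ f s ∧ f s ≤ R) :
    |∫ s, f s ∂(dynamics φ hφ σ W y) - ∫ s, f s ∂(dynamics φ hφ σ V y)| ≤
      R * min 1 (2 / σ * √(resid φ (W - V) y)) := by
  refine (abs_integral_gaussian_sub_le hσ (Matrix.toEuclideanLin W (φ y))
    (Matrix.toEuclideanLin V (φ y)) hf hR).trans (le_of_eq ?_)
  rw [← LinearMap.sub_apply, ← map_sub, resid, Real.sqrt_sq (norm_nonneg _)]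
  congr 2
  ring

/-- The optimistic planning argument for one round: if the bonus dominates the model error, the
regret of the planned policy is controlled by its expected bonus in the true dynamics. -/
theorem value_sub_value_le_of_bonus {φ : State ds × A → Feat d} (hφ : Measurable φ) {σ : ℝ}
    (hσ : 0 < σ) {H : ℕ} (hH : 0 < H) (W V : Matrix (Fin ds) (Fin d) ℝ)
    {r b : State ds × A → ℝ} (hr : Measurable r) (hr1 : ∀ y, 0 ≤ r y ∧ r y ≤ 1)
    (hb : Measurable b) (hb1 : ∀ y, 0 ≤ b y ∧ b y ≤ 2 * H)
    (hdom : ∀ y, 2 * (H * min 1 (2 / σ * √(resid φ (W - V) y))) ≤ b y)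
    (s₀ : State ds) (π π' : Policy ds A)
    (hplan : value H (dynamics φ hφ σ W) s₀ (fun y => r y + b y) π' ≤
      value H (dynamics φ hφ σ W) s₀ (fun y => r y + b y) π) :
    value H (dynamics φ hφ σ V) s₀ r π' - value H (dynamics φ hφ σ V) s₀ r π ≤
      H * ∫ y, 5 / 2 * H * b y ∂(avgDist H (dynamics φ hφ σ V) s₀ π) := by
  have hH1 : (1 : ℝ) ≤ H := by exact_mod_cast hH
  have hrb : Measurable fun y => r y + b y := hr.add hb
  have hrb1 : ∀ y, 0 ≤ r y + b y ∧ r y + b y ≤ 3 * H := fun y =>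
    ⟨add_nonneg (hr1 y).1 (hb1 y).1, by linarith [(hr1 y).2, (hb1 y).2]⟩
  have hu : Measurable fun y => 5 / 2 * H * b y := hb.const_mul _
  have hu1 : ∀ y, 0 ≤ 5 / 2 * H * b y ∧ 5 / 2 * H * b y ≤ 5 / 2 * H * (2 * H) := fun y =>
    ⟨mul_nonneg (by positivity) (hb1 y).1,
      mul_le_mul_of_nonneg_left (hb1 y).2 (by positivity)⟩
  set m : State ds × A → ℝ := fun y => min 1 (2 / σ * √(resid φ (W - V) y)) with hm
  have hm0 : ∀ y, 0 ≤ m y := fun y => le_min zero_le_one (by positivity)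
  -- Optimism: value functions of `r` alone are at most H, so the model error is at most half the
  -- bonus and no remainder is needed (u = 0).
  have hopt : value H (dynamics φ hφ σ V) s₀ r π' ≤
      value H (dynamics φ hφ σ W) s₀ (fun y => r y + b y) π' := by
    have h2 := value_le_value_add_sum (dynamics φ hφ σ V) (dynamics φ hφ σ W) hr hrb
      (measurable_const (a := (0 : ℝ))) hr1 hrb1 (e := 0) (fun _ => ⟨le_rfl, le_rfl⟩) s₀ π' H
      (fun k hk y => by
        obtain ⟨hVm, hVb⟩ := valueFn_spec (dynamics φ hφ σ V) hr hr1 π' k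
        have h3 := abs_le.1 (abs_integral_dynamics_sub_le hφ hσ W V y hVm hVb)
        have h4 : (k : ℝ) * 1 * m y ≤ H * m y := by
          have : (k : ℝ) ≤ H := by exact_mod_cast hk.le
          rw [mul_one]
          exact mul_le_mul_of_nonneg_right this (hm0 y)
        have h5 := hdom y
        have h6 : 0 ≤ (H : ℝ) * m y := mul_nonneg (by positivity) (hm0 y)
        have h7 := h3.1
        simp only [hm] at h4 h6
        linarith)
    have h3 : value H (dynamics φ hφ σ W) s₀ (fun _ => (0 : ℝ)) π' = 0 := by simp [value]
    rw [h3, add_zero] at h2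
    exact h2
  -- Here the value functions include the bonus and are at most H · 3H, so the model error is at
  -- most (3/2)H times the bonus. The bonus itself, at most H times itself, raises the factor to
  -- 5/2.
  have hreg : value H (dynamics φ hφ σ W) s₀ (fun y => r y + b y) π ≤
      value H (dynamics φ hφ σ V) s₀ r π +
        value H (dynamics φ hφ σ V) s₀ (fun y => 5 / 2 * H * b y) π := by
    refine value_le_value_add_sum (dynamics φ hφ σ W) (dynamics φ hφ σ V) hrb hr hu hrb1 hr1 hu1
      s₀ π H fun k hk y => ?_
    obtain ⟨hVm, hVb⟩ := valueFn_spec (dynamics φ hφ σ W) hrb hrb1 π k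
    have h3 := abs_le.1 (abs_integral_dynamics_sub_le hφ hσ W V y hVm hVb)
    have h4 : (k : ℝ) * (3 * H) * m y ≤ H * (3 * H) * m y := by
      have : (k : ℝ) ≤ H := by exact_mod_cast hk.le
      exact mul_le_mul_of_nonneg_right
        (mul_le_mul_of_nonneg_right this (by positivity)) (hm0 y)
    have h5 : 3 / 2 * H * (2 * (H * m y)) ≤ 3 / 2 * H * b y :=
      mul_le_mul_of_nonneg_left (hdom y) (by positivity)
    have h6 : b y ≤ H * b y := le_mul_of_one_le_left (hb1 y).1 hH1
    have h7 := h3.2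
    simp only [hm] at h4 h5
    linarith
  rw [← value_eq_mul_integral_avgDist hH _ s₀ π hu hu1]
  linarith

end Regret

/-! ### Regret of the planned policies and of their mixture -/

section MixtureRegret

variable {ds d : ℕ} {A : Type*} [MeasurableSpace A]

theorem integral_sqrt_le {Ω : Type*} [MeasurableSpace Ω] {μ : Measure Ω} [IsProbabilityMeasure μ]
    {q : Ω → ℝ} (hqm : Measurable q) (hqi : Integrable q μ) (hq0 : ∀ y, 0 ≤ q y) :
    Integrable (fun y => √(q y)) μ ∧ ∫ y, √(q y) ∂μ ≤ √(∫ y, q y ∂μ) := by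
  have hsq : ∀ y, √(q y) ^ 2 = q y := fun y => Real.sq_sqrt (hq0 y)
  have hm : AEStronglyMeasurable (fun y => √(q y)) μ := hqm.sqrt.aestronglyMeasurable
  have hi2 : Integrable (fun y => √(q y) ^ 2) μ := by simpa only [hsq] using hqi
  refine ⟨((memLp_two_iff_integrable_sq hm).2 hi2).integrable one_le_two, ?_⟩
  have h := sq_integral_abs_le hm hi2
  simp only [hsq, abs_of_nonneg (Real.sqrt_nonneg _)] at h
  exact Real.le_sqrt_of_sq_le h

/-- The regret of a planned policy in terms of the expected elliptical norm of its features. -/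
theorem value_sub_value_le_of_fit {φ : State ds × A → Feat d} (hφ : Measurable φ)
    (h1 : ∀ y, ‖φ y‖ ≤ 1) {σ F : ℝ} (hσ : 0 < σ) {H : ℕ} (hH : 0 < H)
    {W V : Matrix (Fin ds) (Fin d) ℝ} (hW : specNorm W ≤ F) (hV : specNorm V ≤ F)
    {r : State ds × A → ℝ} (hr : Measurable r) (hr1 : ∀ y, 0 ≤ r y ∧ r y ≤ 1)
    (s₀ : State ds) (π : ℕ → Policy ds A) (π' : Policy ds A) (n : ℕ)
    {S : Matrix (Fin d) (Fin d) ℝ} (hS : S.PosDef)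
    (hS1 : ∀ v, v ⬝ᵥ (S *ᵥ v) ≤ 2 * (v ⬝ᵥ
      (regCov φ (fun i => avgDist H (dynamics φ hφ σ V) s₀ (π i)) (n + 1) *ᵥ v)))
    (hS2 : ∀ v, v ⬝ᵥ (regCov φ (fun i => avgDist H (dynamics φ hφ σ V) s₀ (π i)) (n + 1) *ᵥ v) ≤
      4 * (v ⬝ᵥ (S *ᵥ v)))
    (hfit : (n + 1 : ℕ) * ∫ y, resid φ (W - V) y ∂(coverDist H (dynamics φ hφ σ V) s₀ π n) ≤
      3 * (ds * F ^ 2))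
    (hplan : value H (dynamics φ hφ σ W) s₀
        (fun y => r y + bonus φ (11 * (H / σ * √(F ^ 2 * ds))) H S y) π' ≤
      value H (dynamics φ hφ σ W) s₀
        (fun y => r y + bonus φ (11 * (H / σ * √(F ^ 2 * ds))) H S y) (π (n + 1))) :
    value H (dynamics φ hφ σ V) s₀ r π' - value H (dynamics φ hφ σ V) s₀ r (π (n + 1)) ≤
      55 * √2 * (H ^ 3 / σ * √(F ^ 2 * ds)) *
        √(∫ y, (φ y).ofLp ⬝ᵥ ((regCov φ (fun i => avgDist H (dynamics φ hφ σ V) s₀ (π i))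
          (n + 1))⁻¹ *ᵥ (φ y).ofLp) ∂(avgDist H (dynamics φ hφ σ V) s₀ (π (n + 1)))) := by
  set ν : ℕ → Measure (State ds × A) := fun i => avgDist H (dynamics φ hφ σ V) s₀ (π i) with hν
  have hνp : ∀ i, IsProbabilityMeasure (ν i) := fun i =>
    isProbabilityMeasure_avgDist hH _ s₀ (π i)
  set T := regCov φ ν (n + 1) with hT
  have hTpd : T.PosDef := regCov_posDef hφ h1 ν (n + 1)
  set c : ℝ := 11 * (H / σ * √(F ^ 2 * ds)) with hc
  have hc0 : 0 ≤ c := by positivity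
  set q : State ds × A → ℝ := fun y => (φ y).ofLp ⬝ᵥ (T⁻¹ *ᵥ (φ y).ofLp) with hq
  set q' : State ds × A → ℝ := fun y => (φ y).ofLp ⬝ᵥ (S⁻¹ *ᵥ (φ y).ofLp) with hq'
  have hq0 : ∀ y, 0 ≤ q y := fun y => quadForm_nonneg hTpd.inv.posSemidef _
  have hq'0 : ∀ y, 0 ≤ q' y := fun y => quadForm_nonneg hS.inv.posSemidef _
  have hqq' : ∀ y, q y ≤ 2 * q' y := fun y => quadForm_inv_le hTpd hS two_pos hS1 _
  have hq'q : ∀ y, q' y ≤ 4 * q y := fun y => quadForm_inv_le hS hTpd four_pos hS2 _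
  have hres : ∀ y, 0 ≤ resid φ (W - V) y ∧ resid φ (W - V) y ≤ specNorm (W - V) ^ 2 :=
    fun y => ⟨resid_nonneg φ _ y, resid_le h1 _ y⟩
  have hfrob : frobSq (W - V) ≤ 4 * (ds * F ^ 2) := by
    have h2 := specNorm_sub_le W V
    have h3 : specNorm (W - V) ^ 2 ≤ (2 * F) ^ 2 :=
      pow_le_pow_left₀ (specNorm_nonneg _) (by linarith) 2
    have h4 := mul_le_mul_of_nonneg_left h3 (Nat.cast_nonneg (α := ℝ) ds)
    have h5 := frobSq_le (W - V)
    linarith [mul_pow 2 F 2]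
  -- The constant 7 is 4 from the two spectral balls plus 3 from the fit.
  have hcov : residCov (W - V) T ≤ 7 * (ds * F ^ 2) := by
    rw [hT, residCov_regCov hφ h1, sum_integral_avgDist_eq hH _ s₀ π n
      (measurable_resid hφ _) hres]
    linarith
  have hresq : ∀ y, resid φ (W - V) y ≤ 14 * (ds * F ^ 2) * q' y := fun y => by
    have h2 := resid_le_residCov_mul φ hTpd (W - V) y
    have h3 := mul_le_mul_of_nonneg_right hcov (hq0 y)
    have h4 := mul_le_mul_of_nonneg_left (hqq' y)
      (by positivity : (0 : ℝ) ≤ 7 * (ds * F ^ 2))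
    simp only [hq] at h2 h3 h4 ⊢
    linarith
  have hdom : ∀ y, 2 * (H * min 1 (2 / σ * √(resid φ (W - V) y))) ≤ bonus φ c H S y := by
    intro y
    unfold bonus
    refine mul_le_mul_of_nonneg_left (le_min ?_ ?_) zero_le_two
    · have h2 : √(resid φ (W - V) y) ≤ 11 / 2 * √(F ^ 2 * ds) * √(1 / 2 * q' y) := by
        refine Real.sqrt_le_iff.2 ⟨by positivity, ?_⟩
        rw [mul_pow, mul_pow, Real.sq_sqrt (by positivity),
          Real.sq_sqrt (mul_nonneg (by norm_num) (hq'0 y))]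
        refine (hresq y).trans ?_
        have : 0 ≤ (ds * F ^ 2) * q' y := mul_nonneg (by positivity) (hq'0 y)
        nlinarith
      calc (H : ℝ) * min 1 (2 / σ * √(resid φ (W - V) y))
          ≤ H * (2 / σ * (11 / 2 * √(F ^ 2 * ds) * √(1 / 2 * q' y))) :=
            mul_le_mul_of_nonneg_left ((min_le_right _ _).trans
              (mul_le_mul_of_nonneg_left h2 (by positivity))) (by positivity)
        _ = c * √(1 / 2 * q' y) := by rw [hc]; field_simp
    · exact mul_le_of_le_one_right (by positivity) (min_le_left _ _)
  have hreg := value_sub_value_le_of_bonus hφ hσ hH W V hr hr1 (measurable_bonus hφ c H S)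
    (bonus_bounds φ hc0 H S) hdom s₀ (π (n + 1)) π' hplan
  refine hreg.trans ?_
  have hqm : Measurable q := measurable_quadForm_feat hφ T⁻¹
  have hqi : Integrable q (ν (n + 1)) := integrable_quadForm hφ h1 _ _
  obtain ⟨hsi, hsle⟩ := integral_sqrt_le hqm hqi hq0
  have hbq : ∀ y, 5 / 2 * H * bonus φ c H S y ≤ 5 * √2 * H * c * √(q y) := by
    intro y
    have h2 : bonus φ c H S y ≤ 2 * (c * (√2 * √(q y))) := by
      unfold bonus
      refine mul_le_mul_of_nonneg_left ((min_le_left _ _).trans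
        (mul_le_mul_of_nonneg_left ?_ hc0)) zero_le_two
      rw [← Real.sqrt_mul zero_le_two]
      refine Real.sqrt_le_sqrt ?_
      have := hq'q y
      change 1 / 2 * q' y ≤ 2 * q y
      linarith
    calc _ ≤ 5 / 2 * H * (2 * (c * (√2 * √(q y)))) :=
          mul_le_mul_of_nonneg_left h2 (by positivity)
      _ = _ := by ring
  have hbm : Measurable fun y => 5 / 2 * H * bonus φ c H S y :=
    (measurable_bonus hφ c H S).const_mul _
  have hbi : Integrable (fun y => 5 / 2 * H * bonus φ c H S y) (ν (n + 1)) :=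
    integrable_of_bounded (ν (n + 1)) hbm (b := 5 / 2 * H * (2 * H)) fun y =>
      ⟨mul_nonneg (by positivity) (bonus_bounds φ hc0 H S y).1,
        mul_le_mul_of_nonneg_left (bonus_bounds φ hc0 H S y).2 (by positivity)⟩
  have h3 := integral_mono hbi (hsi.const_mul _) hbq
  rw [integral_const_mul (5 * √2 * H * c)] at h3
  calc H * ∫ y, 5 / 2 * H * bonus φ c H S y ∂(ν (n + 1))
      ≤ H * (5 * √2 * H * c * √(∫ y, q y ∂(ν (n + 1)))) :=
        mul_le_mul_of_nonneg_left (h3.trans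
          (mul_le_mul_of_nonneg_left hsle (by positivity))) (by positivity)
    _ = _ := by rw [hc]; ring

/-- On the event that the covariance estimates and the model fits are accurate, the uniform mixture
of the planned policies is nearly optimal. -/
theorem mixture_optimal {φ : State ds × A → Feat d} (hφ : Measurable φ)
    (h1 : ∀ y, ‖φ y‖ ≤ 1) {σ F ε : ℝ} (hσ : 0 < σ) (hε : 0 < ε) {H : ℕ} (hH : 0 < H) (hd : 1 ≤ d)
    {V : Matrix (Fin ds) (Fin d) ℝ} (hV : specNorm V ≤ F) {W : ℕ → Matrix (Fin ds) (Fin d) ℝ}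
    (hW : ∀ n, specNorm (W n) ≤ F)
    {r : State ds × A → ℝ} (hr : Measurable r) (hr1 : ∀ y, 0 ≤ r y ∧ r y ≤ 1)
    (s₀ : State ds) (π : ℕ → Policy ds A) (π' : Policy ds A) {N K : ℕ} (hN : 2 ≤ N) (hK : 0 < K)
    (x : ℕ → ℕ → State ds × A)
    (hcov : ∀ n < N, ‖∑ k ∈ Finset.range K, (outerVec (φ (x n k)).ofLp -
      vecMean (fun y => outerVec (φ y).ofLp) (avgDist H (dynamics φ hφ σ V) s₀ (π n)))‖ ≤
        3 * K / (4 * N))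
    (hfit : ∀ n < N, N * ∫ y, resid φ (W n - V) y
      ∂(coverDist H (dynamics φ hφ σ V) s₀ π n) ≤ 3 * (ds * F ^ 2))
    (hplan : ∀ n, n + 1 < N → value H (dynamics φ hφ σ (W n)) s₀
        (fun y => r y + bonus φ (11 * (H / σ * √(F ^ 2 * ds))) H (empCov φ 1 K x n) y) π' ≤
      value H (dynamics φ hφ σ (W n)) s₀
        (fun y => r y + bonus φ (11 * (H / σ * √(F ^ 2 * ds))) H (empCov φ 1 K x n) y) (π (n + 1)))
    (hNX : 12100 * cplx H d ds F σ ε * Real.log (N + 1) ≤ N - 1) :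
    value H (dynamics φ hφ σ V) s₀ r π' - ε ≤
      (∑ n ∈ Finset.Ico 1 N, value H (dynamics φ hφ σ V) s₀ r (π n)) / ((N : ℝ) - 1) := by
  -- There are k = N - 1 planned policies; π 0 is the arbitrary initial one and carries no
  -- guarantee.
  obtain ⟨k, rfl⟩ : ∃ k, N = k + 1 := ⟨N - 1, by omega⟩
  have hk : 0 < k := by omega
  have hk0 : (0 : ℝ) < k := by exact_mod_cast hk
  set ν : ℕ → Measure (State ds × A) := fun i => avgDist H (dynamics φ hφ σ V) s₀ (π i) with hν
  have hνp : ∀ i, IsProbabilityMeasure (ν i) := fun i =>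
    isProbabilityMeasure_avgDist hH _ s₀ (π i)
  set J := value H (dynamics φ hφ σ V) s₀ r with hJ
  set a : ℕ → ℝ := fun i => ∫ y, (φ y).ofLp ⬝ᵥ ((regCov φ ν i)⁻¹ *ᵥ (φ y).ofLp) ∂(ν i) with ha
  have ha0 : ∀ i, 0 ≤ a i := fun i => integral_nonneg fun y =>
    quadForm_nonneg (regCov_posDef hφ h1 ν i).inv.posSemidef _
  set κ : ℝ := 55 * √2 * (H ^ 3 / σ * √(F ^ 2 * ds)) with hκ
  have hκ0 : 0 ≤ κ := by positivity
  have hround : ∀ n ∈ Finset.range k, J π' - J (π (n + 1)) ≤ κ * √(a (n + 1)) := by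
    intro n hn
    have hn' := Finset.mem_range.1 hn
    have hb := fun v => quadForm_empCov_bounds hφ h1 ν hK x hcov (by omega : n < k + 1) v
    refine value_sub_value_le_of_fit hφ h1 hσ hH (hW n) hV hr hr1 s₀ π π' n
      (empCov_posDef φ K x n) (fun v => (hb v).1) (fun v => (hb v).2) ?_ (hplan n (by omega))
    refine le_trans (mul_le_mul_of_nonneg_right ?_ (integral_nonneg fun y => resid_nonneg φ _ y))
      (hfit n (by omega))
    exact_mod_cast (by omega : n + 1 ≤ k + 1)
  have hsum := Finset.sum_le_sum hround
  rw [← Finset.mul_sum, Finset.sum_sub_distrib, Finset.sum_const, Finset.card_range,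
    nsmul_eq_mul] at hsum
  have hcs : (∑ n ∈ Finset.range k, √(a (n + 1))) ^ 2 ≤ k * ∑ n ∈ Finset.range k, a (n + 1) := by
    have h2 := sq_sum_le_card_mul_sum_sq (s := Finset.range k) (f := fun n => √(a (n + 1)))
    simpa only [Real.sq_sqrt (ha0 _), Finset.card_range] using h2
  -- The potential lemma covers k + 1 = N distributions; the nonnegative term of the initial policy
  -- is discarded, which leaves ln(N + 1).
  have hpot : ∑ n ∈ Finset.range k, a (n + 1) ≤ 2 * (d * Real.log ((k + 1 : ℕ) + 1)) := by
    have h2 := sum_integral_quadForm_inv_le hφ h1 hd ν (k + 1)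
    rw [Finset.sum_range_succ'] at h2
    have h3 := ha0 0
    simp only [ha] at h3 ⊢
    linarith
  -- Here 6050 = 55² · 2. With the 2 of the potential lemma it becomes the 12100 in the condition on
  -- N.
  have hκ2 : κ ^ 2 = 6050 * (H ^ 6 / σ ^ 2 * (F ^ 2 * ds)) := by
    rw [hκ, mul_pow, mul_pow, mul_pow, Real.sq_sqrt zero_le_two, Real.sq_sqrt (by positivity)]
    ring
  have htot : κ * ∑ n ∈ Finset.range k, √(a (n + 1)) ≤ k * ε := by
    refine abs_le_of_sq_le_sq' ?_ (by positivity) |>.2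
    rw [mul_pow, hκ2]
    have h2 : (∑ n ∈ Finset.range k, √(a (n + 1))) ^ 2 ≤
        k * (2 * (d * Real.log ((k + 1 : ℕ) + 1))) :=
      hcs.trans (mul_le_mul_of_nonneg_left hpot hk0.le)
    have h3 : 12100 * cplx H d ds F σ ε * Real.log ((k + 1 : ℕ) + 1) ≤ k := by
      refine hNX.trans (le_of_eq ?_)
      push_cast
      ring
    calc _ ≤ 6050 * (H ^ 6 / σ ^ 2 * (F ^ 2 * ds)) *
          (k * (2 * (d * Real.log ((k + 1 : ℕ) + 1)))) :=
          mul_le_mul_of_nonneg_left h2 (by positivity)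
      _ = k * ε ^ 2 * (12100 * cplx H d ds F σ ε * Real.log ((k + 1 : ℕ) + 1)) := by
          unfold cplx
          field_simp
          ring
      _ ≤ k * ε ^ 2 * k := mul_le_mul_of_nonneg_left h3 (by positivity)
      _ = _ := by ring
  have hIco : ∑ n ∈ Finset.Ico 1 (k + 1), J (π n) = ∑ n ∈ Finset.range k, J (π (n + 1)) := by
    rw [Finset.sum_Ico_eq_sum_range]
    simp [add_comm]
  have hk1 : ((k + 1 : ℕ) : ℝ) - 1 = k := by push_cast; ring
  rw [hIco, hk1, le_div_iff₀ hk0]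
  linarith

/-- The best among finitely many policies is at least as good as the mixture of some of them. -/
theorem exists_best_policy {Γ : Type*} (J : Γ → ℝ) (π : ℕ → Γ) {N : ℕ} (hN : 2 ≤ N) :
    ∃ n < N, (∀ m < N, J (π m) ≤ J (π n)) ∧
      (∑ n ∈ Finset.Ico 1 N, J (π n)) / ((N : ℝ) - 1) ≤ J (π n) := by
  obtain ⟨n, hn, hmax⟩ := Finset.exists_max_image (Finset.range N) (fun m => J (π m))
    ⟨0, Finset.mem_range.2 (by omega)⟩
  refine ⟨n, Finset.mem_range.1 hn, fun m hm => hmax m (Finset.mem_range.2 hm), ?_⟩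
  have hN1 : (0 : ℝ) < (N : ℝ) - 1 := by
    have : (2 : ℝ) ≤ N := by exact_mod_cast hN
    linarith
  rw [div_le_iff₀ hN1]
  refine (Finset.sum_le_card_nsmul _ _ (J (π n)) fun m hm =>
    hmax m (Finset.mem_range.2 (Finset.mem_Ico.1 hm).2)).trans (le_of_eq ?_)
  rw [Nat.card_Ico, nsmul_eq_mul, Nat.cast_sub (by omega)]
  push_cast
  ring

end MixtureRegret

/-! ### Choice of the hyper-parameters and the sample count -/

section HyperParameters

theorem one_le_log {x : ℝ} (hx : 3 ≤ x) : 1 ≤ Real.log x := by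
  rw [Real.le_log_iff_exp_le (by linarith)]
  linarith [Real.exp_one_lt_d9]

/-- A number of rounds of order `X ln X` is large compared with `X` times its own logarithm. -/
theorem rounds_bounds {X : ℝ} (hX : 2 ≤ X) {N : ℕ} (hN : N = ⌈2 ^ 20 * (X * Real.log X)⌉₊) :
    3 ≤ N ∧ X * Real.log X ≤ N ∧ N ≤ (2 ^ 20 + 1) * (X * Real.log X) ∧
      12100 * X * Real.log (N + 1) ≤ N - 1 := by
  have hl2 : Real.log 2 ≤ Real.log X := Real.log_le_log two_pos hX
  have hl : 0.69 ≤ Real.log X := by linarith [Real.log_two_gt_d9]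
  have hXl : 1 ≤ X * Real.log X := by nlinarith
  have hlo : 2 ^ 20 * (X * Real.log X) ≤ N := hN ▸ Nat.le_ceil _
  have hhi : (N : ℝ) < 2 ^ 20 * (X * Real.log X) + 1 :=
    hN ▸ Nat.ceil_lt_add_one (by positivity)
  refine ⟨?_, by linarith, by linarith, ?_⟩
  · have : (3 : ℝ) ≤ N := by linarith
    exact_mod_cast this
  have h1 : Real.log X ≤ X - 1 := Real.log_le_sub_one_of_pos (by linarith)
  -- From ln X ≤ X - 1. Hence ln(N + 1) ≤ 20 ln 2 + 2 ln X ≤ 22 ln X, and 2^20 exceeds 12100 · 22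
  -- with room for the subtracted 1.
  have h2 : (N : ℝ) + 1 ≤ 2 ^ 20 * X ^ 2 := by nlinarith
  have h3 : Real.log (N + 1) ≤ 22 * Real.log X := by
    refine (Real.log_le_log (by positivity) h2).trans ?_
    rw [Real.log_mul (by positivity) (by positivity), Real.log_pow, Real.log_pow]
    push_cast
    linarith
  have h4 : 12100 * X * Real.log (N + 1) ≤ 12100 * X * (22 * Real.log X) :=
    mul_le_mul_of_nonneg_left h3 (by linarith)
  linarith

/-- The order of magnitude `N² (F² + F B)² ln²(N / δ)` of the number of samples that are used to
fit the model in each round. -/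
noncomputable def fitScale (ds N M : ℕ) (F σ δ : ℝ) : ℝ :=
  (N : ℝ) ^ 2 * (F ^ 2 + F * stateBound ds N M F σ δ) ^ 2 * Real.log (N / δ) ^ 2

variable {ds N : ℕ} {F σ δ : ℝ}

theorem three_le_div (hN : 2 ≤ N) (hδ : 0 < δ) (hδ2 : δ < 1 / 2) : 3 ≤ (N : ℝ) / δ := by
  have : (2 : ℝ) ≤ N := by exact_mod_cast hN
  rw [le_div_iff₀ hδ]
  linarith

theorem three_le_mul_div (hds : 1 ≤ ds) (hN : 2 ≤ N) (hδ : 0 < δ) (hδ2 : δ < 1 / 2) :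
    3 ≤ 2 * (ds : ℝ) * N / δ := by
  have h1 : (1 : ℝ) ≤ ds := by exact_mod_cast hds
  have h2 := three_le_div hN hδ hδ2
  rw [mul_div_assoc]
  nlinarith

theorem log_mul_natCast_div (hds : 1 ≤ ds) (hN : 2 ≤ N) (hδ : 0 < δ) (hδ2 : δ < 1 / 2) {M : ℕ}
    (hM : 1 ≤ M) :
    Real.log (2 * ds * N * M / δ) = Real.log (2 * ds * N / δ) + Real.log M := by
  have h := three_le_mul_div hds hN hδ hδ2
  have hM0 : (M : ℝ) ≠ 0 := by positivity
  rw [← Real.log_mul (by positivity) hM0]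
  congr 1
  ring

theorem add_le_stateBound (hσ : 0 < σ) (hds : 1 ≤ ds) (hN : 2 ≤ N) (hδ : 0 < δ) (hδ2 : δ < 1 / 2)
    {M : ℕ} (hM : 1 ≤ M) : F + σ ≤ stateBound ds N M F σ δ := by
  unfold stateBound
  have h1 : (1 : ℝ) ≤ ds := by exact_mod_cast hds
  have h2 := one_le_log (three_le_mul_div hds hN hδ hδ2)
  have h3 : 0 ≤ Real.log (M : ℝ) := Real.log_natCast_nonneg M
  have h4 : 1 ≤ √(ds * Real.log (2 * ds * N * M / δ)) := by
    rw [Real.one_le_sqrt, log_mul_natCast_div hds hN hδ hδ2 hM]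
    nlinarith
  nlinarith

theorem stateBound_mono (hσ : 0 < σ) (hds : 1 ≤ ds) (hN : 2 ≤ N) (hδ : 0 < δ) (hδ2 : δ < 1 / 2)
    {M M' : ℕ} (hM : 1 ≤ M) (hMM : M ≤ M') :
    stateBound ds N M F σ δ ≤ stateBound ds N M' F σ δ := by
  unfold stateBound
  rw [log_mul_natCast_div hds hN hδ hδ2 hM, log_mul_natCast_div hds hN hδ hδ2 (hM.trans hMM)]
  have h1 : Real.log (M : ℝ) ≤ Real.log (M' : ℝ) :=
    Real.log_le_log (by exact_mod_cast hM) (by exact_mod_cast hMM)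
  gcongr

theorem fitScale_mono (hF : 1 ≤ F) (hσ : 0 < σ) (hds : 1 ≤ ds) (hN : 2 ≤ N) (hδ : 0 < δ)
    (hδ2 : δ < 1 / 2) {M M' : ℕ} (hM : 1 ≤ M) (hMM : M ≤ M') :
    fitScale ds N M F σ δ ≤ fitScale ds N M' F σ δ := by
  unfold fitScale
  have h1 := add_le_stateBound (F := F) hσ hds hN hδ hδ2 hM
  have h2 := stateBound_mono (F := F) hσ hds hN hδ hδ2 hM hMM
  have h3 : 0 ≤ stateBound ds N M F σ δ := by linarith
  gcongr

/-- A lower bound for the scale of the sample size. -/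
theorem le_fitScale (hF : 1 ≤ F) (hσ : 0 < σ) (hds : 1 ≤ ds) (hN : 2 ≤ N) (hδ : 0 < δ)
    (hδ2 : δ < 1 / 2) {M : ℕ} (hM : 1 ≤ M) :
    (N : ℝ) ^ 2 * (F ^ 2 * (F ^ 2 + σ ^ 2)) * Real.log (N / δ) ^ 2 ≤ fitScale ds N M F σ δ := by
  unfold fitScale
  have h1 := add_le_stateBound (F := F) hσ hds hN hδ hδ2 hM
  have h2 : F ^ 2 * (F ^ 2 + σ ^ 2) ≤ (F ^ 2 + F * stateBound ds N M F σ δ) ^ 2 := by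
    have h3 : F * (F + σ) ≤ F ^ 2 + F * stateBound ds N M F σ δ := by nlinarith
    refine le_trans ?_ (pow_le_pow_left₀ (by positivity) h3 2)
    rw [mul_pow]
    gcongr
    nlinarith
  gcongr

/-- An upper bound for the scale of the sample size. -/
theorem fitScale_le (hds : 1 ≤ ds) (hN : 2 ≤ N) (hδ : 0 < δ)
    (hδ2 : δ < 1 / 2) {M : ℕ} (hM : 1 ≤ M) :
    fitScale ds N M F σ δ ≤ (N : ℝ) ^ 2 * (8 * F ^ 4 + 2 * (σ ^ 2 * F ^ 2 * ds) *
      (Real.log (2 * ds * N / δ) + Real.log M)) * Real.log (N / δ) ^ 2 := by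
  unfold fitScale stateBound
  have h2 := one_le_log (three_le_mul_div hds hN hδ hδ2)
  have h3 : 0 ≤ Real.log (M : ℝ) := Real.log_natCast_nonneg M
  rw [log_mul_natCast_div hds hN hδ hδ2 hM]
  set Λ := Real.log (2 * ds * N / δ) + Real.log (M : ℝ)
  have hΛ : 0 ≤ ds * Λ := mul_nonneg (by positivity) (by linarith)
  have h4 : (F ^ 2 + F * (F + σ * √(ds * Λ))) ^ 2 ≤ 8 * F ^ 4 + 2 * (σ ^ 2 * F ^ 2 * ds) * Λ := by
    have h5 := Real.sq_sqrt hΛ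
    have h6 := sq_nonneg (2 * F ^ 2 - F * σ * √(ds * Λ))
    calc _ = 4 * F ^ 4 + 4 * F ^ 2 * (F * σ * √(ds * Λ)) + F ^ 2 * σ ^ 2 * √(ds * Λ) ^ 2 := by ring
      _ ≤ 8 * F ^ 4 + 2 * (F ^ 2 * σ ^ 2 * √(ds * Λ) ^ 2) := by nlinarith
      _ = _ := by rw [h5]; ring
  gcongr

theorem one_le_fitScale (hF : 1 ≤ F) (hσ : 0 < σ) (hds : 1 ≤ ds) (hN : 2 ≤ N) (hδ : 0 < δ)
    (hδ2 : δ < 1 / 2) {M : ℕ} (hM : 1 ≤ M) : 1 ≤ fitScale ds N M F σ δ := by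
  refine le_trans ?_ (le_fitScale hF hσ hds hN hδ hδ2 hM)
  have h1 := one_le_log (three_le_div hN hδ hδ2)
  have h2 : (1 : ℝ) ≤ N := by exact_mod_cast (by omega : 1 ≤ N)
  have h3 : 1 ≤ F ^ 2 * (F ^ 2 + σ ^ 2) :=
    one_le_mul_of_one_le_of_one_le (one_le_pow₀ hF)
      (le_add_of_le_of_nonneg (one_le_pow₀ hF) (sq_nonneg σ))
  exact one_le_mul_of_one_le_of_one_le
    (one_le_mul_of_one_le_of_one_le (one_le_pow₀ h2) h3) (one_le_pow₀ h1)

/-- The implicit equation for the sample size has a solution up to constants. -/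
theorem exists_sampleSize (hF : 1 ≤ F) (hσ : 0 < σ) (hds : 1 ≤ ds) (hN : 2 ≤ N) (hδ : 0 < δ)
    (hδ2 : δ < 1 / 2) :
    ∃ M : ℕ, 1 ≤ M ∧ 32 * fitScale ds N M F σ δ ≤ M ∧ M ≤ 33 * fitScale ds N M F σ δ := by
  have hex : ∃ M : ℕ, 1 ≤ M ∧ 32 * fitScale ds N M F σ δ ≤ M := by
    set a := 32 * ((N : ℝ) ^ 2 * (8 * F ^ 4 + 2 * (σ ^ 2 * F ^ 2 * ds) *
      Real.log (2 * ds * N / δ)) * Real.log (N / δ) ^ 2) with ha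
    set b := 32 * ((N : ℝ) ^ 2 * (2 * (σ ^ 2 * F ^ 2 * ds)) * Real.log (N / δ) ^ 2) with hb
    -- The scale depends on M only through ln M, so it grows more slowly than M and every large M is
    -- admissible.
    have hlim : (fun x : ℝ => a + b * Real.log x) =o[Filter.atTop] (id : ℝ → ℝ) :=
      (Asymptotics.isLittleO_const_id_atTop a).add (Real.isLittleO_log_id_atTop.const_mul_left b)
    have hev := (hlim.bound one_pos).and (Filter.eventually_ge_atTop 1)
    obtain ⟨M, hM, hM1⟩ := (tendsto_natCast_atTop_atTop.eventually hev).exists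
    have hM1' : 1 ≤ M := by exact_mod_cast hM1
    refine ⟨M, hM1', ?_⟩
    have h1 := fitScale_le (F := F) (σ := σ) hds hN hδ hδ2 hM1'
    have h2 : a + b * Real.log M ≤ M := by
      have := (le_abs_self _).trans hM
      simpa [abs_of_nonneg (Nat.cast_nonneg (α := ℝ) M)] using this
    calc _ ≤ _ := mul_le_mul_of_nonneg_left h1 (by norm_num)
      _ = a + b * Real.log M := by rw [ha, hb]; ring
      _ ≤ M := h2
  classical
  -- The least admissible M also obeys the upper bound: M - 1 fails the lower bound and the scale is
  -- monotone, so M < 32g + 1 ≤ 33g, where g ≥ 1 is the scale at M.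
  refine ⟨Nat.find hex, (Nat.find_spec hex).1, (Nat.find_spec hex).2, ?_⟩
  set M := Nat.find hex with hMdef
  have hM1 : 1 ≤ M := (Nat.find_spec hex).1
  have hg := one_le_fitScale hF hσ hds hN hδ hδ2 hM1
  -- Minimality says nothing when M = 1, but then g ≥ 1 suffices.
  rcases hM1.eq_or_lt with h | h
  · rw [← h] at hg ⊢
    push_cast
    linarith
  have hmin := Nat.find_min hex (m := M - 1) (by omega)
  have h2 : 1 ≤ M - 1 := by omega
  have h3 : ((M - 1 : ℕ) : ℝ) < 32 * fitScale ds N (M - 1) F σ δ :=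
    not_le.1 fun h4 => hmin ⟨h2, h4⟩
  have h5 := fitScale_mono hF hσ hds hN hδ hδ2 h2 (Nat.sub_le M 1)
  rw [Nat.cast_sub hM1] at h3
  push_cast at h3
  linarith

/-- The sample size is polynomial in the parameters. -/
theorem log_le_of_le_mul_one_add_log {M : ℕ} {Y : ℝ} (hM : 1 ≤ M) (hY : 66 ≤ Y)
    (h : M ≤ 33 * (Y * (1 + Real.log M))) : Real.log M ≤ 4 * Real.log Y := by
  have hM0 : (0 : ℝ) < M := by exact_mod_cast hM
  -- Inserted in the hypothesis, this gives M ≤ 66Y√M, so √M ≤ 66Y ≤ Y²; taking logarithms produces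
  -- the factor 4.
  have h1 : Real.log M ≤ 2 * √M - 2 := by
    have h2 := Real.log_le_sub_one_of_pos (Real.sqrt_pos.2 hM0)
    rw [Real.log_sqrt hM0.le] at h2
    linarith
  have hs := Real.sqrt_pos.2 hM0
  have h3 : √(M : ℝ) * √M ≤ 66 * Y * √M := by
    rw [Real.mul_self_sqrt hM0.le]
    nlinarith
  have h4 : √(M : ℝ) ≤ Y ^ 2 := by nlinarith [le_of_mul_le_mul_right h3 hs]
  have h5 := Real.log_le_log hs h4
  rw [Real.log_sqrt hM0.le, Real.log_pow] at h5
  push_cast at h5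
  linarith

/-- The step size for which projected SGD fits the model well enough. -/
theorem fit_error_le (hF : 1 ≤ F) (hσ : 0 < σ) (hds : 1 ≤ ds) (hN : 2 ≤ N) (hδ : 0 < δ)
    (hδ2 : δ < 1 / 2) {M : ℕ} (hM : 1 ≤ M) (hMg : 32 * fitScale ds N M F σ δ ≤ M)
    {η θ : ℝ} (hη : η = 1 / (8 * N * (1 + σ ^ 2))) (hθ : θ = 1 / (η * (8 * σ ^ 2 + 4 * F ^ 2))) :
    N * (2 * (ds * F ^ 2) / (η * M) + 8 * η * σ ^ 2 * ds + 2 * Real.log (N / δ) / (θ * η * M)) ≤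
      3 * (ds * F ^ 2) := by
  have hN0 : (2 : ℝ) ≤ N := by exact_mod_cast hN
  have hM0 : (0 : ℝ) < M := by exact_mod_cast hM
  have hds1 : (1 : ℝ) ≤ ds := by exact_mod_cast hds
  have hL := one_le_log (three_le_div hN hδ hδ2)
  have hlow := le_fitScale hF hσ hds hN hδ hδ2 hM
  set L := Real.log (N / δ) with hLdef
  have hF2 : 1 ≤ F ^ 2 := one_le_pow₀ hF
  have hη0 : 0 < η := by rw [hη]; positivity
  have hdsF : 1 ≤ ds * F ^ 2 := one_le_mul_of_one_le_of_one_le hds1 hF2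
  have hMN : 32 * ((N : ℝ) ^ 2 * (F ^ 2 + σ ^ 2) * L) ≤ M := by
    refine le_trans ?_ hMg
    refine mul_le_mul_of_nonneg_left (le_trans ?_ hlow) (by norm_num)
    have h1 : F ^ 2 + σ ^ 2 ≤ F ^ 2 * (F ^ 2 + σ ^ 2) := le_mul_of_one_le_left (by positivity) hF2
    have h2 : L ≤ L ^ 2 := by nlinarith
    gcongr
  -- The three terms come from the initial distance, the gradient noise and the deviation; each is
  -- shown to be at most d_s F². The step size makes the noise term small independently of M, and
  -- the other two are controlled by M.
  have e1 : N * (2 * (ds * F ^ 2) / (η * M)) = (16 * (N : ℝ) ^ 2 * (1 + σ ^ 2)) / M *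
      (ds * F ^ 2) := by
    rw [hη]
    field_simp
    ring
  have e2 : N * (8 * η * σ ^ 2 * ds) = σ ^ 2 / (1 + σ ^ 2) * ds := by
    rw [hη]
    field_simp
  have e3 : N * (2 * L / (θ * η * M)) = N * L * (16 * σ ^ 2 + 8 * F ^ 2) / M := by
    rw [hθ]
    field_simp
    ring
  have b1 : (16 * (N : ℝ) ^ 2 * (1 + σ ^ 2)) / M ≤ 1 := by
    rw [div_le_one hM0]
    refine le_trans ?_ hMN
    have : (N : ℝ) ^ 2 * (1 + σ ^ 2) ≤ (N : ℝ) ^ 2 * (F ^ 2 + σ ^ 2) * L :=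
      calc _ ≤ (N : ℝ) ^ 2 * (F ^ 2 + σ ^ 2) * 1 := by rw [mul_one]; gcongr
        _ ≤ _ := by gcongr
    have h0 : 0 ≤ (N : ℝ) ^ 2 * (1 + σ ^ 2) := by positivity
    linarith
  have b2 : σ ^ 2 / (1 + σ ^ 2) ≤ 1 := by
    rw [div_le_one (by positivity)]
    linarith
  have b3 : N * L * (16 * σ ^ 2 + 8 * F ^ 2) / M ≤ 1 := by
    rw [div_le_one hM0]
    refine le_trans ?_ hMN
    have h1 : N * L * (F ^ 2 + σ ^ 2) ≤ (N : ℝ) ^ 2 * (F ^ 2 + σ ^ 2) * L :=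
      calc N * L * (F ^ 2 + σ ^ 2) = N * (F ^ 2 + σ ^ 2) * L := by ring
        _ ≤ (N : ℝ) ^ 2 * (F ^ 2 + σ ^ 2) * L := by
          gcongr
          nlinarith
    have h2 : 0 ≤ N * L * σ ^ 2 := by positivity
    have h3 : 0 ≤ N * L * F ^ 2 := by positivity
    nlinarith
  rw [mul_add, mul_add, e1, e2, e3]
  have c1 := mul_le_mul_of_nonneg_right b1 (zero_le_one.trans hdsF)
  have c2 := mul_le_mul_of_nonneg_right b2 (zero_le_one.trans hds1)
  have c3 : (ds : ℝ) ≤ ds * F ^ 2 := le_mul_of_one_le_right (by linarith) hF2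
  linarith

/-- Since Λ ≥ 1, the factor Λ + ln M can be traded for Λ(1 + ln M). This puts the implicit
inequality for M into the form that `log_le_of_le_mul_one_add_log` inverts. -/
theorem log_sampleSize_le {D f G Λ Y : ℝ} {M : ℕ} (hM : 1 ≤ M) (hf : 1 ≤ f) (hG : 0 ≤ G)
    (hΛ : 1 ≤ Λ) (hD : 9 ≤ D) (hY : Y = (8 * f + 9 * G * Λ) * D + 18 * G)
    (h : M ≤ 33 * ((8 * f + 2 * G * (Λ + Real.log M)) * D)) :
    66 ≤ Y ∧ Real.log M ≤ 4 * Real.log Y := by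
  have hM' : 0 ≤ Real.log (M : ℝ) := Real.log_natCast_nonneg M
  have hGΛ : G ≤ G * Λ := le_mul_of_one_le_right hG hΛ
  have h0 : 0 ≤ G * Λ * D := by positivity
  have h2 : 8 * 9 ≤ 8 * f * D := by nlinarith
  have hY66 : 66 ≤ Y := by
    rw [hY]
    linarith
  refine ⟨hY66, log_le_of_le_mul_one_add_log hM hY66 (h.trans ?_)⟩
  refine mul_le_mul_of_nonneg_left ?_ (by norm_num)
  have h1 : 8 * f + 2 * G * (Λ + Real.log M) ≤ (8 * f + 9 * G * Λ) * (1 + Real.log M) := by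
    have h3 := mul_nonneg (sub_nonneg.2 hGΛ) hM'
    have h4 := mul_nonneg hG hM'
    have h5 := mul_nonneg (zero_le_one.trans hf) hM'
    linarith
  calc _ ≤ (8 * f + 9 * G * Λ) * (1 + Real.log M) * D :=
        mul_le_mul_of_nonneg_right h1 (by linarith)
    _ = (8 * f + 9 * G * Λ) * D * (1 + Real.log M) := by ring
    _ ≤ _ := mul_le_mul_of_nonneg_right (by linarith) (by linarith)

theorem three_le_mul_natCast_div {d : ℕ} (hd : 1 ≤ d) (hN : 2 ≤ N) (hδ : 0 < δ)
    (hδ2 : δ < 1 / 2) : 3 ≤ (N : ℝ) * d / δ := by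
  have hd1 : (1 : ℝ) ≤ d := by exact_mod_cast hd
  have hNδ := three_le_div hN hδ hδ2
  rw [mul_div_right_comm]
  exact hNδ.trans (le_mul_of_one_le_right (by linarith) hd1)

/-- The number of samples that are used to estimate the covariance in each round. -/
theorem covSampleSize_le {d : ℕ} (hd : 1 ≤ d) (hN : 2 ≤ N) (hδ : 0 < δ) (hδ2 : δ < 1 / 2) :
    (⌈32 * (N : ℝ) ^ 2 * Real.log (8 * N * d / δ)⌉₊ : ℝ) ≤
      129 * (N ^ 2 * Real.log (N * d / δ)) := by
  have h3 := three_le_mul_natCast_div hd hN hδ hδ2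
  have hP1 := one_le_log h3
  have h1 : 8 * (N : ℝ) * d / δ = 2 ^ 3 * (N * d / δ) := by ring
  have hN1 : (1 : ℝ) ≤ N := by exact_mod_cast (by omega : 1 ≤ N)
  have h2 : Real.log (8 * N * d / δ) = 3 * Real.log 2 + Real.log (N * d / δ) := by
    rw [h1, Real.log_mul (by norm_num) (by positivity), Real.log_pow]
    norm_num
  have hlog2 : 0 ≤ Real.log 2 := Real.log_nonneg one_le_two
  rw [h2]
  set P := Real.log (N * d / δ)
  refine (Nat.ceil_lt_add_one (by positivity)).le.trans ?_
  have h4 : 32 * (N : ℝ) ^ 2 * (3 * Real.log 2 + P) ≤ 32 * N ^ 2 * (4 * P) := by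
    gcongr
    linarith [Real.log_two_lt_d9]
  have h5 : 1 ≤ (N : ℝ) ^ 2 * P :=
    one_le_mul_of_one_le_of_one_le (one_le_pow₀ hN1) hP1
  linarith

/-- The number of samples that are used to fit the model in each round. -/
theorem sampleSize_le (hF : 1 ≤ F) (hds : 1 ≤ ds) (hN3 : 3 ≤ N) (hδ : 0 < δ) (hδ2 : δ < 1 / 2)
    {M : ℕ} (hM : 1 ≤ M) (hMg : M ≤ 33 * fitScale ds N M F σ δ) {Y : ℝ}
    (hY : Y = (8 * F ^ 4 + 9 * σ ^ 2 * F ^ 2 * ds * Real.log (2 * ds * N / δ)) *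
      Real.log (N / δ) ^ 2 * N ^ 2 + 18 * σ ^ 2 * F ^ 2 * ds) :
    0 ≤ Real.log Y ∧ M ≤ 264 * (N ^ 2 * ((F ^ 4 + σ ^ 2 * F ^ 2 * ds) *
      (Real.log (N / δ) ^ 2 * (Real.log (2 * ds * N / δ) + Real.log Y)))) := by
  have hN : 2 ≤ N := by omega
  have hN0 : (3 : ℝ) ≤ N := by exact_mod_cast hN3
  have hL := one_le_log (three_le_div hN hδ hδ2)
  have hΛ := one_le_log (three_le_mul_div hds hN hδ hδ2)
  have hMub := hMg.trans (mul_le_mul_of_nonneg_left (fitScale_le hds hN hδ hδ2 hM)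
    (by norm_num))
  set L := Real.log (N / δ)
  set Λ := Real.log (2 * ds * N / δ)
  have hF4 : 1 ≤ F ^ 4 := one_le_pow₀ hF
  set G := σ ^ 2 * F ^ 2 * ds with hG
  have hG0 : 0 ≤ G := by positivity
  have hD9 : 9 ≤ (N : ℝ) ^ 2 * L ^ 2 := by
    have h1 : (9 : ℝ) ≤ (N : ℝ) ^ 2 := by nlinarith
    exact h1.trans (le_mul_of_one_le_right (by positivity) (one_le_pow₀ hL))
  obtain ⟨hY66, hlogM⟩ := log_sampleSize_le (Y := Y) hM hF4 hG0 hΛ hD9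
    (by rw [hY, hG]; ring) (hMub.trans (le_of_eq (by ring)))
  have hlogY : 0 ≤ Real.log Y := Real.log_nonneg (by linarith)
  refine ⟨hlogY, hMub.trans ?_⟩
  have h1 : 8 * F ^ 4 + 2 * G * (Λ + Real.log M) ≤ 8 * ((F ^ 4 + G) * (Λ + Real.log Y)) := by
    have h2 : F ^ 4 ≤ F ^ 4 * (Λ + Real.log Y) :=
      le_mul_of_one_le_right (by linarith) (by linarith)
    have h3 : G * (Λ + Real.log M) ≤ G * (4 * (Λ + Real.log Y)) :=
      mul_le_mul_of_nonneg_left (by linarith) hG0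
    linarith
  calc _ ≤ 33 * ((N : ℝ) ^ 2 * (8 * ((F ^ 4 + G) * (Λ + Real.log Y))) * L ^ 2) := by gcongr
    _ = _ := by ring

/-- The total number of samples. -/
theorem card_samples_le {H d : ℕ} {ε : ℝ} (hF : 1 ≤ F) (hd : 1 ≤ d) (hds : 1 ≤ ds)
    (hN3 : 3 ≤ N) (hδ : 0 < δ) (hδ2 : δ < 1 / 2) {c : ℝ} {M : ℕ} (hM : 1 ≤ M)
    (hNX : N ≤ c * (cplx H d ds F σ ε * Real.log (cplx H d ds F σ ε)))
    (hMg : M ≤ 33 * fitScale ds N M F σ δ) :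
    (N * (⌈32 * (N : ℝ) ^ 2 * Real.log (8 * N * d / δ)⌉₊ + M) : ℝ) ≤
      264 * c ^ 3 * ((H : ℝ) ^ 18 * d ^ 3 * ds ^ 3 / (σ ^ 6 * ε ^ 6) *
        (F ^ 10 + σ ^ 2 * F ^ 8 * ds) * logFactor H d ds N F σ ε δ) := by
  have hN : 2 ≤ N := by omega
  have hK := covSampleSize_le hd hN hδ hδ2
  obtain ⟨hlogY, hMY⟩ := sampleSize_le (σ := σ) hF hds hN3 hδ hδ2 hM hMg rfl
  have hP1 := one_le_log (three_le_mul_natCast_div hd hN hδ hδ2)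
  have hΛ := one_le_log (three_le_mul_div hds hN hδ hδ2)
  -- The total is of order N³(F⁴ + σ²F²d_s) up to logarithms, with N of order X ln X; cubing X
  -- produces H¹⁸ and the extra F⁶.
  have hXeq : cplx H d ds F σ ε ^ 3 * (F ^ 4 + σ ^ 2 * F ^ 2 * ds) =
      (H : ℝ) ^ 18 * d ^ 3 * ds ^ 3 / (σ ^ 6 * ε ^ 6) * (F ^ 10 + σ ^ 2 * F ^ 8 * ds) := by
    unfold cplx
    rw [div_pow]
    ring
  unfold logFactor
  rw [← hXeq]
  have hFG : 1 ≤ F ^ 4 + σ ^ 2 * F ^ 2 * ds :=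
    le_add_of_le_of_nonneg (one_le_pow₀ hF) (by positivity)
  have hN3' := pow_le_pow_left₀ (Nat.cast_nonneg (α := ℝ) N) hNX 3
  set X := cplx H d ds F σ ε
  set Y := (8 * F ^ 4 + 9 * σ ^ 2 * F ^ 2 * ds * Real.log (2 * ds * N / δ)) *
      Real.log (N / δ) ^ 2 * N ^ 2 + 18 * σ ^ 2 * F ^ 2 * ds
  set Q := Real.log (N / δ) ^ 2 * (Real.log (2 * ds * N / δ) + Real.log Y)
  set P := Real.log (N * d / δ)
  set E := F ^ 4 + σ ^ 2 * F ^ 2 * ds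
  have hQ0 : 0 ≤ Q := mul_nonneg (sq_nonneg _) (by linarith)
  have hsum : (⌈32 * (N : ℝ) ^ 2 * Real.log (8 * N * d / δ)⌉₊ + M : ℝ) ≤
      264 * ((N : ℝ) ^ 2 * (E * (Q + P))) := by
    have h1 : (N : ℝ) ^ 2 * P ≤ N ^ 2 * (E * P) :=
      mul_le_mul_of_nonneg_left (le_mul_of_one_le_left (by linarith) hFG) (by positivity)
    have h2 : 0 ≤ (N : ℝ) ^ 2 * P := by positivity
    linarith
  calc _ ≤ N * (264 * ((N : ℝ) ^ 2 * (E * (Q + P)))) :=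
        mul_le_mul_of_nonneg_left hsum (by positivity)
    _ = 264 * (E * (Q + P)) * (N : ℝ) ^ 3 := by ring
    _ ≤ 264 * (E * (Q + P)) * (c * (X * Real.log X)) ^ 3 := by gcongr
    _ = _ := by ring

end HyperParameters

/-! ### Union bound over the rounds -/

section FailureProbability

variable {ds d : ℕ} {A : Type*} [MeasurableSpace A] {Ω : Type*} {mΩ : MeasurableSpace Ω}
  {μ : Measure Ω} [IsProbabilityMeasure μ] {ℱ : Filtration ℕ mΩ} {H : ℕ} {σ δ : ℝ}
  {p : HyperParams} {φ : State ds × A → Feat d} {hφ : Measurable φ}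
  {W : Matrix (Fin ds) (Fin d) ℝ} {r : State ds × A → ℝ} {s₀ : State ds}
  {Pol : Set (Policy ds A)} {x : ℕ → ℕ → Ω → State ds × A}
  {z : ℕ → ℕ → Ω → (State ds × A) × State ds} {π : ℕ → Ω → Policy ds A}

/-- The covariance estimate of a round of the algorithm is accurate with high probability. -/
theorem IsPCMLPRun.measure_cov_le
    (hrun : IsPCMLPRun H σ p φ hφ (dynamics φ hφ σ W) r s₀ Pol μ ℱ x z π)
    (h1 : ∀ y, ‖φ y‖ ≤ 1) (hH : 0 < H) (hd : 1 ≤ d) (hδ : 0 < δ) (hδ2 : δ < 1 / 2) (hN : 2 ≤ p.N)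
    (hK : p.K = ⌈32 * (p.N : ℝ) ^ 2 * Real.log (8 * p.N * d / δ)⌉₊) {n : ℕ} (hn : n < p.N) :
    μ {ω | 3 * p.K / (4 * p.N) ≤ ‖∑ k ∈ Finset.range p.K, (outerVec (φ (x n k ω)).ofLp -
      vecMean (fun y => outerVec (φ y).ofLp) (avgDist H (dynamics φ hφ σ W) s₀ (π n ω)))‖} ≤
      ENNReal.ofReal (δ / p.N) := by
  have hN0 : (2 : ℝ) ≤ p.N := by exact_mod_cast hN
  have hd1 : (1 : ℝ) ≤ d := by exact_mod_cast hd
  have h3 := three_le_mul_natCast_div hd hN hδ hδ2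
  have h8 : 8 * (p.N : ℝ) * d / δ = 8 * (p.N * d / δ) := by ring
  have hlog : 1 ≤ Real.log (8 * p.N * d / δ) := one_le_log (by rw [h8]; linarith)
  have hKle : 32 * (p.N : ℝ) ^ 2 * Real.log (8 * p.N * d / δ) ≤ p.K := hK ▸ Nat.le_ceil _
  have hK0 : (0 : ℝ) < p.K := lt_of_lt_of_le (by positivity) hKle
  have hprob : ∀ ω, IsProbabilityMeasure (avgDist H (dynamics φ hφ σ W) s₀ (π n ω)) :=
    fun ω => isProbabilityMeasure_avgDist hH _ s₀ _
  -- The value l = 3/(32N) minimizes the exponent 4l²K - 3lK/(4N). The minimum is -9K/(256N²), at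
  -- most -ln(8Nd/δ) by the choice of K.
  have hl2 : 3 / (32 * (p.N : ℝ)) ≤ 1 / 2 := by
    rw [div_le_iff₀ (by positivity)]
    linarith
  refine (vecMean_concentration ℱ (n * (p.K + p.M)) p.K (by exact_mod_cast hK0) (x n) _
    (measurable_outerVec_feat hφ) (norm_outerVec_feat_le h1) (hrun.cov_measurable n hn)
    (hrun.cov_law n hn) (by positivity) hl2 (3 * p.K / (4 * p.N))).trans ?_
  refine ENNReal.ofReal_le_ofReal ?_
  have hexp : 4 * (3 / (32 * (p.N : ℝ))) ^ 2 * p.K - 3 / (32 * p.N) * (3 * p.K / (4 * p.N)) ≤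
      -Real.log (8 * p.N * d / δ) := by
    have h4 : 4 * (3 / (32 * (p.N : ℝ))) ^ 2 * p.K - 3 / (32 * p.N) * (3 * p.K / (4 * p.N)) =
        -(9 * (p.K / (256 * (p.N : ℝ) ^ 2))) := by
      field_simp
      ring
    have h5 : Real.log (8 * p.N * d / δ) / 8 ≤ p.K / (256 * (p.N : ℝ) ^ 2) := by
      rw [le_div_iff₀ (by positivity)]
      linarith
    rw [h4]
    linarith
  calc _ ≤ 2 * Real.exp (-Real.log (8 * p.N * d / δ)) := by gcongr
    _ = δ / (4 * p.N * d) := by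
      rw [Real.exp_neg, Real.exp_log (by positivity)]
      field_simp
      norm_num
    _ ≤ δ / p.N := by
      gcongr
      nlinarith

/-- The model fit of a round of the algorithm is accurate with high probability. -/
theorem IsPCMLPRun.measure_fit_le
    (hrun : IsPCMLPRun H σ p φ hφ (dynamics φ hφ σ W) r s₀ Pol μ ℱ x z π)
    (h1 : ∀ y, ‖φ y‖ ≤ 1) (hH : 0 < H) (hσ : 0 < σ) (hF : 1 ≤ p.F) (hW : specNorm W ≤ p.F)
    (hds : 1 ≤ ds) (hδ : 0 < δ) (hδ2 : δ < 1 / 2) (hN : 2 ≤ p.N) (hM : 1 ≤ p.M)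
    (hMg : 32 * fitScale ds p.N p.M p.F σ δ ≤ p.M) (hη : p.η = 1 / (8 * p.N * (1 + σ ^ 2)))
    {n : ℕ} (hn : n < p.N) :
    μ {ω | 3 * (ds * p.F ^ 2) < p.N * ∫ y, resid φ (sgdFit φ p.F p.η p.M (fun m => z n m ω) - W) y
      ∂(coverDist H (dynamics φ hφ σ W) s₀ (fun i => π i ω) n)} ≤ ENNReal.ofReal (δ / p.N) := by
  have hN0 : (2 : ℝ) ≤ p.N := by exact_mod_cast hN
  have hη0 : 0 < p.η := by rw [hη]; positivity
  have hη4 : p.η ≤ 1 / 4 := by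
    rw [hη]
    refine one_div_le_one_div_of_le (by norm_num) ?_
    nlinarith [sq_nonneg σ]
  have hprob : ∀ ω, IsProbabilityMeasure
      (coverDist H (dynamics φ hφ σ W) s₀ (fun i => π i ω) n) :=
    fun ω => isProbabilityMeasure_coverDist hH _ s₀ _ n
  -- With θη = 1/(8σ² + 4F²), both conditions on θη hold: θησ² ≤ 1/8 and 4θηF² ≤ 1.
  obtain ⟨θ, hθ⟩ : ∃ θ, θ = 1 / (p.η * (8 * σ ^ 2 + 4 * p.F ^ 2)) := ⟨_, rfl⟩
  have hθ0 : 0 < θ := by rw [hθ]; positivity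
  have hθη : θ * p.η = 1 / (8 * σ ^ 2 + 4 * p.F ^ 2) := by rw [hθ]; field_simp
  have hθσ : θ * p.η * σ ^ 2 ≤ 1 / 8 := by
    rw [hθη, one_div_mul_eq_div, div_le_iff₀ (by positivity)]
    nlinarith
  have hθF : θ * p.η * (4 * p.F ^ 2) ≤ 1 := by
    rw [hθη, one_div_mul_eq_div, div_le_one (by positivity)]
    nlinarith
  have herr := fit_error_le hF hσ hds hN hδ hδ2 hM hMg hη hθ
  refine (measure_mono fun ω hω => ?_).trans ((sgdFit_concentration hφ h1 (by linarith) hη0 hη4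
    hσ.le hθ0 hθσ hθF hW ℱ (n * (p.K + p.M) + p.K) p.M hM (z n) _ (hrun.model_measurable n hn)
    (hrun.model_law n hn) (Real.log (p.N / δ))).trans (le_of_eq ?_))
  · exact lt_of_mul_lt_mul_left (herr.trans_lt hω) (by linarith)
  · rw [Real.exp_neg, Real.exp_log (by positivity), inv_div]

/-- The hyper-parameters of the theorem guarantee that all estimates of the run are accurate with
high probability. -/
theorem IsPCMLPRun.measure_bad_le
    (hrun : IsPCMLPRun H σ p φ hφ (dynamics φ hφ σ W) r s₀ Pol μ ℱ x z π)
    (h1 : ∀ y, ‖φ y‖ ≤ 1) (hH : 0 < H) (hσ : 0 < σ) (hF : 1 ≤ p.F) (hW : specNorm W ≤ p.F)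
    (hd : 1 ≤ d) (hds : 1 ≤ ds) (hδ : 0 < δ) (hδ2 : δ < 1 / 2) (hN : 2 ≤ p.N) (hM : 1 ≤ p.M)
    (hK : p.K = ⌈32 * (p.N : ℝ) ^ 2 * Real.log (8 * p.N * d / δ)⌉₊)
    (hMg : 32 * fitScale ds p.N p.M p.F σ δ ≤ p.M) (hη : p.η = 1 / (8 * p.N * (1 + σ ^ 2))) :
    μ {ω | ¬ ∀ n < p.N, ‖∑ k ∈ Finset.range p.K, (outerVec (φ (x n k ω)).ofLp -
        vecMean (fun y => outerVec (φ y).ofLp) (avgDist H (dynamics φ hφ σ W) s₀ (π n ω)))‖ ≤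
          3 * p.K / (4 * p.N) ∧
        p.N * ∫ y, resid φ (sgdFit φ p.F p.η p.M (fun m => z n m ω) - W) y
          ∂(coverDist H (dynamics φ hφ σ W) s₀ (fun i => π i ω) n) ≤ 3 * (ds * p.F ^ 2)} ≤
      ENNReal.ofReal (2 * δ) := by
  set C : ℕ → Set Ω := fun n => {ω | 3 * p.K / (4 * p.N) ≤
    ‖∑ k ∈ Finset.range p.K, (outerVec (φ (x n k ω)).ofLp -
      vecMean (fun y => outerVec (φ y).ofLp) (avgDist H (dynamics φ hφ σ W) s₀ (π n ω)))‖}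
  set D : ℕ → Set Ω := fun n => {ω | 3 * (ds * p.F ^ 2) <
    p.N * ∫ y, resid φ (sgdFit φ p.F p.η p.M (fun m => z n m ω) - W) y
      ∂(coverDist H (dynamics φ hφ σ W) s₀ (fun i => π i ω) n)}
  have hN0 : (2 : ℝ) ≤ p.N := by exact_mod_cast hN
  calc _ ≤ μ (⋃ n ∈ Finset.range p.N, (C n ∪ D n)) := by
        refine measure_mono fun ω hω => ?_
        obtain ⟨n, hn⟩ := not_forall.1 hω
        obtain ⟨hnN, hn⟩ := Classical.not_imp.1 hn
        refine Set.mem_biUnion (Finset.mem_coe.2 (Finset.mem_range.2 hnN)) ?_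
        rcases not_and_or.1 hn with h | h
        · exact Or.inl (not_le.1 h).le
        · exact Or.inr (not_le.1 h)
    _ ≤ ∑ n ∈ Finset.range p.N, μ (C n ∪ D n) := measure_biUnion_finset_le _ _
    _ ≤ ∑ n ∈ Finset.range p.N, ENNReal.ofReal (δ / p.N + δ / p.N) := by
        -- Each of the N rounds spends δ/N on its covariance and δ/N on its fit, which adds up to
        -- 2δ.
        refine Finset.sum_le_sum fun n hn => (measure_union_le _ _).trans ?_
        have hn' := Finset.mem_range.1 hn
        rw [ENNReal.ofReal_add (by positivity) (by positivity)]
        exact add_le_add (hrun.measure_cov_le h1 hH hd hδ hδ2 hN hK hn')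
          (hrun.measure_fit_le h1 hH hσ hF hW hds hδ hδ2 hN hM hMg hη hn')
    _ = ENNReal.ofReal (2 * δ) := by
        rw [Finset.sum_const, Finset.card_range, nsmul_eq_mul, ← ENNReal.ofReal_natCast,
          ← ENNReal.ofReal_mul (by positivity)]
        congr 1
        field_simp
        ring

theorem pos_of_two_le_cplx {H d ds : ℕ} {F σ ε : ℝ} (h : 2 ≤ cplx H d ds F σ ε) :
    0 < H ∧ 1 ≤ d ∧ 1 ≤ ds := by
  refine ⟨Nat.pos_of_ne_zero ?_, Nat.pos_of_ne_zero ?_, Nat.pos_of_ne_zero ?_⟩ <;>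
  · rintro rfl
    norm_num [cplx] at h

end FailureProbability

end KNR

/-! ### The sample complexity theorem -/

theorem mainTheorem2 : ∃ C : ℝ, 1 ≤ C ∧
    ∀ (H d ds : ℕ) (F σ ε δ : ℝ), 1 ≤ F → 0 < σ → 0 < ε → ε < 1 → 0 < δ → δ < 1 / 2 →
      2 ≤ KNR.cplx H d ds F σ ε →
    ∃ p : KNR.HyperParams,
      -- the hyper-parameters
      (C⁻¹ * (KNR.cplx H d ds F σ ε * Real.log (KNR.cplx H d ds F σ ε)) ≤ p.N ∧
        p.N ≤ C * (KNR.cplx H d ds F σ ε * Real.log (KNR.cplx H d ds F σ ε))) ∧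
      (C⁻¹ * ((p.N : ℝ) ^ 2 * (F ^ 2 + F * KNR.stateBound ds p.N p.M F σ δ) ^ 2 *
          Real.log (p.N / δ) ^ 2) ≤ p.M ∧
        p.M ≤ C * ((p.N : ℝ) ^ 2 * (F ^ 2 + F * KNR.stateBound ds p.N p.M F σ δ) ^ 2 *
          Real.log (p.N / δ) ^ 2)) ∧
      (C⁻¹ * (H / σ * √(F ^ 2 * ds)) ≤ p.c ∧ p.c ≤ C * (H / σ * √(F ^ 2 * ds))) ∧
      p.K = ⌈32 * (p.N : ℝ) ^ 2 * Real.log (8 * p.N * d / δ)⌉₊ ∧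
      p.lam = 1 ∧ p.F = F ∧ 0 < p.η ∧
      -- the total number of samples
      (p.N * (p.K + p.M) : ℝ) ≤ C * ((H : ℝ) ^ 18 * d ^ 3 * ds ^ 3 / (σ ^ 6 * ε ^ 6) *
        (F ^ 10 + σ ^ 2 * F ^ 8 * ds) * KNR.logFactor H d ds p.N F σ ε δ) ∧
      -- the guarantee, for every environment and every run of the algorithm
      ∀ (A : Type*) [MeasurableSpace A]
        (φ : KNR.State ds × A → KNR.Feat d) (hφ : Measurable φ) (_ : ∀ y, ‖φ y‖ ≤ 1)
        (W : Matrix (Fin ds) (Fin d) ℝ) (_ : KNR.specNorm W ≤ F)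
        (r : KNR.State ds × A → ℝ) (_ : Measurable r) (_ : ∀ y, 0 ≤ r y ∧ r y ≤ 1)
        (s₀ : KNR.State ds) (Pol : Set (KNR.Policy ds A))
        (Ω : Type*) [mΩ : MeasurableSpace Ω] (μ : Measure Ω) [IsProbabilityMeasure μ]
        (ℱ : Filtration ℕ mΩ)
        (x : ℕ → ℕ → Ω → KNR.State ds × A) (z : ℕ → ℕ → Ω → (KNR.State ds × A) × KNR.State ds)
        (π : ℕ → Ω → KNR.Policy ds A),
        KNR.IsPCMLPRun H σ p φ hφ (KNR.dynamics φ hφ σ W) r s₀ Pol μ ℱ x z π →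
        μ {ω | ¬ (
          -- the best of the policies produced by the run is `ε`-optimal
          (∃ n < p.N,
            (∀ m < p.N, KNR.value H (KNR.dynamics φ hφ σ W) s₀ r (π m ω) ≤
              KNR.value H (KNR.dynamics φ hφ σ W) s₀ r (π n ω)) ∧
            ∀ π' ∈ Pol, KNR.value H (KNR.dynamics φ hφ σ W) s₀ r π' - ε ≤
              KNR.value H (KNR.dynamics φ hφ σ W) s₀ r (π n ω)) ∧
          -- and so is the uniform mixture of the planned policies
          2 ≤ p.N ∧
          ∀ π' ∈ Pol, KNR.value H (KNR.dynamics φ hφ σ W) s₀ r π' - ε ≤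
            (∑ n ∈ Finset.Ico 1 p.N, KNR.value H (KNR.dynamics φ hφ σ W) s₀ r (π n ω)) /
              ((p.N : ℝ) - 1))} ≤ ENNReal.ofReal (2 * δ) := by
  -- The constant is dictated by the sample count: 264 from K + M, and the cube of the constant 2^20
  -- + 1 bounding N. It exceeds all the other constants, namely 2^20 + 1, 33 and 11.
  refine ⟨264 * (2 ^ 20 + 1) ^ 3, by norm_num, ?_⟩
  intro H d ds F σ ε δ hF hσ hε _ hδ hδ2 hX
  obtain ⟨hH, hd, hds⟩ := KNR.pos_of_two_le_cplx hX
  obtain ⟨N, hNdef⟩ : ∃ N : ℕ, N = ⌈2 ^ 20 * (KNR.cplx H d ds F σ ε *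
    Real.log (KNR.cplx H d ds F σ ε))⌉₊ := ⟨_, rfl⟩
  obtain ⟨hN3, hNlo, hNhi, hNX⟩ := KNR.rounds_bounds hX hNdef
  have hN : 2 ≤ N := by omega
  obtain ⟨M, hM, hMlo, hMhi⟩ := KNR.exists_sampleSize hF hσ hds hN hδ hδ2
  have hg := KNR.one_le_fitScale hF hσ hds hN hδ hδ2 hM
  have hsamples := KNR.card_samples_le hF hd hds hN3 hδ hδ2 hM hNhi hMhi
  have hXl : 0 ≤ KNR.cplx H d ds F σ ε * Real.log (KNR.cplx H d ds F σ ε) :=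
    mul_nonneg (by linarith) (Real.log_nonneg (by linarith))
  have hc0 : 0 ≤ (H : ℝ) / σ * √(F ^ 2 * ds) := by positivity
  have hC1 : ((264 * (2 ^ 20 + 1) ^ 3 : ℝ))⁻¹ ≤ 1 := by norm_num
  have hC33 : (33 : ℝ) ≤ 264 * (2 ^ 20 + 1) ^ 3 := by norm_num
  have hCN : (2 ^ 20 + 1 : ℝ) ≤ 264 * (2 ^ 20 + 1) ^ 3 := by norm_num
  have hCinv : (0 : ℝ) ≤ ((264 * (2 ^ 20 + 1) ^ 3 : ℝ))⁻¹ := by positivity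
  generalize (264 * (2 ^ 20 + 1) ^ 3 : ℝ) = C at hC1 hC33 hCN hCinv hsamples ⊢
  have hη : 0 < 1 / (8 * (N : ℝ) * (1 + σ ^ 2)) := by
    have : (0 : ℝ) < N := by exact_mod_cast (by omega : 0 < N)
    positivity
  refine ⟨⟨N, M, ⌈32 * (N : ℝ) ^ 2 * Real.log (8 * N * d / δ)⌉₊, 11 * (H / σ * √(F ^ 2 * ds)), 1, F,
    1 / (8 * N * (1 + σ ^ 2))⟩, ⟨?_, ?_⟩, ⟨?_, ?_⟩, ⟨?_, ?_⟩, rfl, rfl, rfl, hη, hsamples, ?_⟩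
  · exact (mul_le_of_le_one_left hXl hC1).trans hNlo
  · exact hNhi.trans (mul_le_mul_of_nonneg_right hCN hXl)
  · change C⁻¹ * KNR.fitScale ds N M F σ δ ≤ M
    have := mul_le_of_le_one_left (zero_le_one.trans hg) hC1
    linarith
  · change (M : ℝ) ≤ C * KNR.fitScale ds N M F σ δ
    exact hMhi.trans (mul_le_mul_of_nonneg_right hC33 (zero_le_one.trans hg))
  · have := mul_le_of_le_one_left hc0 hC1
    change _ ≤ 11 * (H / σ * √(F ^ 2 * ds))
    linarith
  · exact mul_le_mul_of_nonneg_right (by linarith) hc0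
  intro A _ φ hφ h1 W hW r hr hr1 s₀ Pol Ω _ μ _ ℱ x z π hrun
  -- All probability lies in `measure_bad_le`. On the complement of its bad event the conclusion is
  -- deterministic, and monotonicity of the outer measure requires no measurability of the event of
  -- failure.
  refine (MeasureTheory.measure_mono fun ω hω => ?_).trans
    (hrun.measure_bad_le h1 hH hσ hF hW hd hds hδ hδ2 hN hM rfl hMlo rfl)
  intro hgood
  refine hω ?_
  have hK : 0 < ⌈32 * (N : ℝ) ^ 2 * Real.log (8 * N * d / δ)⌉₊ := by
    have h3 := KNR.three_le_mul_natCast_div hd hN hδ hδ2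
    have h8 : 8 * (N : ℝ) * d / δ = 8 * (N * d / δ) := by ring
    have hlog : 1 ≤ Real.log (8 * N * d / δ) := KNR.one_le_log (by rw [h8]; linarith)
    have hN0 : (0 : ℝ) < N := by exact_mod_cast (by omega : 0 < N)
    exact Nat.ceil_pos.2 (by positivity)
  have hmix : ∀ π' ∈ Pol, KNR.value H (KNR.dynamics φ hφ σ W) s₀ r π' - ε ≤
      (∑ n ∈ Finset.Ico 1 N, KNR.value H (KNR.dynamics φ hφ σ W) s₀ r (π n ω)) / ((N : ℝ) - 1) :=
    fun π' hπ' => KNR.mixture_optimal hφ h1 hσ hε hH hd hW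
      (fun n => KNR.specNorm_sgdFit_le φ (by linarith) (1 / (8 * N * (1 + σ ^ 2)))
        (fun m => z n m ω) M) hr hr1 s₀ (fun n => π n ω) π' hN hK (fun n k => x n k ω)
      (fun n hn => (hgood n hn).1) (fun n hn => (hgood n hn).2)
      (fun n hn => hrun.plan_max n hn ω π' hπ') hNX
  obtain ⟨n, hn, hbest, havg⟩ := KNR.exists_best_policy
    (KNR.value H (KNR.dynamics φ hφ σ W) s₀ r) (fun n => π n ω) hN
  exact ⟨⟨n, hn, hbest, fun π' hπ' => (hmix π' hπ').trans havg⟩, hN, hmix⟩
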